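/- Let $f_1,\ldots,f_r\in\mathbf{C}[x_1,\ldots,x_n]$ ($r\ge 1$) be homogeneous polynomials that form a regular sequence, with $\deg(f_i)=d_i$ and $2\le d_1\le\cdots\le d_r$. Let $H_i\subset\mathbf{A}^n$ be the hypersurface defined by $f_i$ and let $Z=H_1\cap\cdots\cap H_r$ be the closed subscheme of $\mathbf{A}^n$ defined by $(f_1,\ldots,f_r)$. Assume that on $\mathbf{A}^n\smallsetminus\{0\}$ each $H_i$ is smooth and $\sum_{i=1}^r H_i$ has simple normal crossings. Write $e_1<\cdots<e_k$ for the distinct values of $d_1,\ldots,d_r$. Let $\pi\colon Y\to\mathbf{A}^n$ be the composition of the blow-up $\pi_1\colon X_1\to\mathbf{A}^n$ of the origin with the following $\sum_{i=1}^{k-1}(e_{i+1}-e_i)=d_r-d_1$ blow-ups: for $i=1,\ldots,k-1$ in turn, perform $e_{i+1}-e_i$ blow-ups, each of them along the intersection of the exceptional divisor of the preceding blow-up with the strict transforms of all the hypersurfaces $H_j$ with $d_j\le e_i$. Such a sequence of blow-ups exists, and it has the following properties: i) If $r\le n-1$, then $\pi$ is a strong factorizing resolution of $(\mathbf{A}^n,Z)$.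 That is: $Z$ is generically reduced; $\pi$ is proper and birational, and is an isomorphism over $\mathbf{A}^n\smallsetminus Z_{\rm sing}$; $Y$ is smooth; if $E$ is the reduced exceptional divisor of $\pi$ and $\widetilde Z$ is the strict transform of $Z$, then $\widetilde Z$ is smooth, and $E$ and $\widetilde Z$ have simple normal crossings (around every point of $Y$ there are algebraic coordinates such that $E$ is the divisor of the product of some of them and $\widetilde Z$ is either empty or the zero locus of some of the others); and there is an effective divisor $F$ supported on $E$ such that $$I_Z\cdot\mathcal{O}_Y=I_{\widetilde Z}\cdot\mathcal{O}_Y(-F).$$ ii) If $r=n$, then $\pi$ is a log resolution of $(\mathbf{A}^n,Z)$. That is: $\pi$ is proper and birational; $Y$ is smooth; $I_Z\cdot\mathcal{O}_Y=\mathcal{O}_Y(-F)$ for an effective divisor $F$; the exceptional locus $\mathrm{Exc}(\pi)$ is a divisor (possibly zero); and $\mathrm{Exc}(\pi)\cup\mathrm{Supp}(F)$ is a simple normal crossing divisor. -/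

import Mathlib

open CategoryTheory AlgebraicGeometry TopologicalSpace

namespace BlowUpRes

noncomputable section

/-! ### Affine space and closed subschemes -/

/-- The affine space `𝐀ⁿ = Spec ℂ[x₁, …, xₙ]`. -/
abbrev Aff (n : ℕ) : Scheme.{0} := Spec (CommRingCat.of (MvPolynomial (Fin n) ℂ))

/-- The structure morphism `𝐀ⁿ ⟶ Spec ℂ`. -/
abbrev affStr (n : ℕ) : Aff n ⟶ Spec (CommRingCat.of ℂ) :=
  Spec.map (CommRingCat.ofHom (MvPolynomial.C : ℂ →+* MvPolynomial (Fin n) ℂ))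

/-- The ideal sheaf on `𝐀ⁿ` given by an ideal of `ℂ[x₁, …, xₙ]`. Closed subschemes are handled
throughout through their (quasi-coherent) ideal sheaves. -/
def affIdeal {n : ℕ} (I : Ideal (MvPolynomial (Fin n) ℂ)) : (Aff n).IdealSheafData :=
  Scheme.IdealSheafData.ofIdealTop
    (I.map (Scheme.ΓSpecIso (CommRingCat.of (MvPolynomial (Fin n) ℂ))).inv.hom)

/-- The ideal sheaf of the origin of `𝐀ⁿ`. -/
def originIdeal (n : ℕ) : (Aff n).IdealSheafData :=
  affIdeal (Ideal.span (Set.range MvPolynomial.X))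

/-- The hypersurface of `𝐀ⁿ` defined by `g`. -/
def hypersurface {n : ℕ} (g : MvPolynomial (Fin n) ℂ) : (Aff n).IdealSheafData :=
  affIdeal (Ideal.span {g})

/-- The closed subscheme of `𝐀ⁿ` defined by `f₁, …, f_r`. -/
def zeroScheme {n r : ℕ} (f : Fin r → MvPolynomial (Fin n) ℂ) : (Aff n).IdealSheafData :=
  affIdeal (Ideal.span (Set.range f))

/-- The open complement of the closed subscheme with ideal sheaf `I`. -/
def complOpen {X : Scheme.{0}} (I : X.IdealSheafData) : X.Opens := I.support.compl

/-- For `X` over `ℂ`, the closed subscheme with ideal sheaf `Z` is smooth on the open set `W`,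
that is, `Z ∩ W` is smooth over `ℂ`. -/
def SmoothOn {X : Scheme.{0}} (p : X ⟶ Spec (CommRingCat.of ℂ)) (Z : X.IdealSheafData)
    (W : X.Opens) : Prop :=
  Smooth ((Z.comap W.ι).subschemeι ≫ W.ι ≫ p)

/-- The complement `X ∖ Z_sing` of the singular locus of `Z`: the largest open subset of `X` on
which `Z` is smooth. -/
def complSing {X : Scheme.{0}} (p : X ⟶ Spec (CommRingCat.of ℂ)) (Z : X.IdealSheafData) :
    X.Opens :=
  sSup {W | SmoothOn p Z W}

/-! ### Effective Cartier divisors, blow-ups, strict transforms -/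

/-- The ideal sheaf `I` is the ideal `𝒪_X(-F)` of an effective Cartier divisor `F`: locally it is
generated by one non-zero-divisor. -/
def IsInvertible {X : Scheme.{0}} (I : X.IdealSheafData) : Prop :=
  ∀ x : X, ∃ U : X.affineOpens, x ∈ U.1 ∧
    ∃ g ∈ nonZeroDivisors Γ(X, U.1), I.ideal U = Ideal.span {g}

/-- `π : X' ⟶ X` is the blow-up of `X` along the closed subscheme with ideal sheaf `I`: the inverse
image ideal is invertible, and `π` is universal (terminal) among the morphisms to `X` with this
property. -/
structure IsBlowUp {X' X : Scheme.{0}} (π : X' ⟶ X) (I : X.IdealSheafData) : Prop where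
  invertible : IsInvertible (I.comap π)
  universal : ∀ (T : Scheme.{0}) (g : T ⟶ X), IsInvertible (I.comap g) →
    ∃! h : T ⟶ X', h ≫ π = g

/-- The strict transform of `Z` under `π`, relative to an open set `U` (over which `π` is an
isomorphism): the scheme-theoretic closure in `X'` of `π⁻¹(Z ∩ U)`. -/
def strictTransform {X' X : Scheme.{0}} (π : X' ⟶ X) (U : X.Opens) (Z : X.IdealSheafData) :
    X'.IdealSheafData :=
  ((Z.comap π).comap (π ⁻¹ᵁ U).ι).map (π ⁻¹ᵁ U).ι

/-! ### Exceptional locus and simple normal crossings -/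

/-- The open set of points at which `π` is a local isomorphism. -/
def locIsoOpen {X' X : Scheme.{0}} (π : X' ⟶ X) : X'.Opens :=
  sSup {V | IsOpenImmersion (V.ι ≫ π)}

/-- The exceptional locus of `π`: the closed set of points at which `π` is not a local
isomorphism. -/
def excLocus {X' X : Scheme.{0}} (π : X' ⟶ X) : Closeds X' := (locIsoOpen π).compl

/-- The ideal sheaf of the exceptional locus with its reduced structure. -/
def excIdeal {X' X : Scheme.{0}} (π : X' ⟶ X) : X'.IdealSheafData :=
  Scheme.IdealSheafData.vanishingIdeal (excLocus π)

/-- Algebraic coordinates `x₁, …, x_m` on the open subset `V` of `X`, a scheme over `ℂ`: an étale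
morphism `(x₁, …, x_m) : V ⟶ 𝐀ᵐ` over `ℂ`. -/
structure AlgCoords {X : Scheme.{0}} (p : X ⟶ Spec (CommRingCat.of ℂ)) (V : X.Opens) (m : ℕ) where
  /-- the morphism to affine space -/
  map : V.toScheme ⟶ Aff m
  etale : Etale map
  comm : map ≫ affStr m = V.ι ≫ p

/-- `E` and the closed subscheme `Z` have simple normal crossings: around every point there are
algebraic coordinates `x₁, …, x_m` and disjoint sets of indices `A`, `B` such that `E` is the
reduced divisor `∑_{i ∈ A} div(xᵢ)` and `Z` is either empty or defined by the `xᵢ` with `i ∈ B`. -/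
def HaveSNC {X : Scheme.{0}} (p : X ⟶ Spec (CommRingCat.of ℂ)) (E Z : X.IdealSheafData) : Prop :=
  ∀ x : X, ∃ (V : X.Opens) (m : ℕ) (c : AlgCoords p V m) (A B : Finset (Fin m)),
    x ∈ V ∧ Disjoint A B ∧
    E.comap V.ι = (hypersurface (∏ i ∈ A, MvPolynomial.X i)).comap c.map ∧
    (Z.comap V.ι = ⊤ ∨
      Z.comap V.ι = (affIdeal (Ideal.span (MvPolynomial.X '' (B : Set (Fin m))))).comap c.map)

/-- `E` is a (reduced) simple normal crossing divisor: around every point there are algebraic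
coordinates `x₁, …, x_m` such that `E = ∑_{i ∈ A} div(xᵢ)` for some set `A` of indices. -/
def IsSNCDivisor {X : Scheme.{0}} (p : X ⟶ Spec (CommRingCat.of ℂ)) (E : X.IdealSheafData) :
    Prop :=
  ∀ x : X, ∃ (V : X.Opens) (m : ℕ) (c : AlgCoords p V m) (A : Finset (Fin m)),
    x ∈ V ∧ E.comap V.ι = (hypersurface (∏ i ∈ A, MvPolynomial.X i)).comap c.map

/-! ### Resolutions -/

/-- `π` is birational: an isomorphism over a dense open subset whose inverse image is dense. -/
def IsBirationalMorphism {X' X : Scheme.{0}} (π : X' ⟶ X) : Prop :=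
  ∃ U : X.Opens, Dense (U : Set X) ∧ Dense ((π ⁻¹ᵁ U : X'.Opens) : Set X') ∧ IsIso (π ∣_ U)

/-- A scheme is generically reduced if it is reduced on a dense open subset. -/
def GenericallyReduced (X : Scheme.{0}) : Prop :=
  ∃ U : X.Opens, Dense (U : Set X) ∧ IsReduced U.toScheme

/-- `π : X' ⟶ X` is a strong factorizing resolution of `(X, Z)`, for `X` over `ℂ` via `p`. Here the
strict transform of `Z` is the closure of `π⁻¹(Z ∖ Z_sing)`. -/
structure IsStrongFactorizingResolution {X' X : Scheme.{0}} (p : X ⟶ Spec (CommRingCat.of ℂ))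
    (π : X' ⟶ X) (Z : X.IdealSheafData) : Prop where
  genericallyReduced : GenericallyReduced Z.subscheme
  proper : IsProper π
  birational : IsBirationalMorphism π
  smooth : Smooth (π ≫ p)
  iso : IsIso (π ∣_ complSing p Z)
  snc : HaveSNC (π ≫ p) (excIdeal π) (strictTransform π (complSing p Z) Z)
  smooth_strict : Smooth ((strictTransform π (complSing p Z) Z).subschemeι ≫ π ≫ p)
  factorization : ∃ F : X'.IdealSheafData, IsInvertible F ∧ F.support ≤ excLocus π ∧
    Z.comap π = strictTransform π (complSing p Z) Z * F

/-- `π : X' ⟶ X` is a log resolution of `(X, Z)`, for `X` over `ℂ` via `p`: a proper birational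
morphism from a smooth scheme such that `I_Z · 𝒪_{X'}` is the ideal of an effective divisor `F`, the
exceptional locus is a divisor, and its union with the support of `F` is a simple normal crossing
divisor. -/
structure IsLogResolution {X' X : Scheme.{0}} (p : X ⟶ Spec (CommRingCat.of ℂ))
    (π : X' ⟶ X) (Z : X.IdealSheafData) : Prop where
  proper : IsProper π
  birational : IsBirationalMorphism π
  smooth : Smooth (π ≫ p)
  invertible : IsInvertible (Z.comap π)
  exc_divisor : IsInvertible (excIdeal π)
  snc : IsSNCDivisor (π ≫ p)
    (Scheme.IdealSheafData.vanishingIdeal (excLocus π ⊔ (Z.comap π).support))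

/-! ### The sequence of blow-ups -/

/-- The centre of the next blow-up, after the blow-up of the origin and `s` further ones: the
intersection of the last exceptional divisor `E` with the current strict transforms `H j` of those
hypersurfaces whose degree `d j` is at most `d₀ + s`, where `d₀` is the smallest degree.

If `e₁ < … < e_k` are the distinct degrees, so `d₀ = e₁`, then for the `e_{i+1} - e_i` values of `s`
with `e_i ≤ e₁ + s < e_{i+1}` these are exactly the hypersurfaces of degree at most `e_i`. -/
def nextCentre {r : ℕ} (d : Fin r → ℕ) (d₀ s : ℕ) {Y : Scheme.{0}} (E : Y.IdealSheafData)
    (H : Fin r → Y.IdealSheafData) : Y.IdealSheafData :=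
  E ⊔ ⨆ j ∈ {j : Fin r | d j ≤ d₀ + s}, H j

/-- `IsTower f d d₀ s π E H`: the morphism `π : Y ⟶ 𝐀ⁿ` is the composition of the blow-up of the
origin with the first `s` further blow-ups of the sequence, `E` is the exceptional divisor of the
last blow-up, and `H j` is the strict transform on `Y` of the hypersurface defined by `f j`. -/
inductive IsTower {n r : ℕ} (f : Fin r → MvPolynomial (Fin n) ℂ) (d : Fin r → ℕ) (d₀ : ℕ) :
    ℕ → ∀ {Y : Scheme.{0}}, (Y ⟶ Aff n) → Y.IdealSheafData → (Fin r → Y.IdealSheafData) → Prop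
  | origin {Y : Scheme.{0}} (π : Y ⟶ Aff n) (hπ : IsBlowUp π (originIdeal n)) :
      IsTower f d d₀ 0 π ((originIdeal n).comap π)
        (fun j => strictTransform π (complOpen (originIdeal n)) (hypersurface (f j)))
  | next {s : ℕ} {Y Y' : Scheme.{0}} {π : Y ⟶ Aff n} {E : Y.IdealSheafData}
      {H : Fin r → Y.IdealSheafData} (h : IsTower f d d₀ s π E H)
      (ρ : Y' ⟶ Y) (hρ : IsBlowUp ρ (nextCentre d d₀ s E H)) :
      IsTower f d d₀ (s + 1) (ρ ≫ π) ((nextCentre d d₀ s E H).comap ρ)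
        (fun j => strictTransform ρ (complOpen (nextCentre d d₀ s E H)) (H j))

end

end BlowUpRes

open BlowUpRes

/-! On the blow-up of the origin let t be a local equation of the exceptional divisor. By
homogeneity f_l = t^{d_l} w_l, where w_l is an equation of the strict transform of H_l. The normal
crossing hypothesis makes the gradients of those f_l that vanish at a given non-zero point linearly
independent (`linearIndependent_gradAt`, by comparing orders of vanishing along lines). With Euler's
identity it follows that t and the w_l that are not units form part of a system of étale coordinates
(`linearIndependent_gradAt_dehom`, `exists_etale_coords`), so everything further is a computation
with coordinate subspaces.

The invariant of the induction is `HasGoodCharts`. After s further steps put N = d₀ + s. On a main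
chart f_l = t^{max(d_l, N)} w_l, and the next centre is t = 0, w_l = 0 for all l with d_l ≤ N. Where
t generates the centre, each such w_l becomes t w_l' and the exponent N grows to N + 1, while the
other equations keep their shape: again a main chart. Where some w_l generates the centre, f_l
divides all f_m and also a power of the local equation of the inverse image of the origin, and the
strict transform of H_l becomes empty, so that the later centres miss this side chart
(`CoordChart.IsMain.exists_next`, `CoordChart.IsSide.exists_next`). A main chart on which some w_l
with d_l ≤ N is a unit is a side chart as well.

At the end N is the largest degree. On a main chart I_Z becomes t^N (w_1, …, w_r), with the w_l
distinct coordinates different from t; on a side chart it is principal. This is the factorization,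
and F is given globally by the pull-back of m^N + I_Z, with m the ideal of the origin
(`factorIdeal`). For r = n a main chart would need n + 1 distinct coordinates, so only side charts
occur and I_Z becomes invertible.

The remaining points are that Z_sing is the origin (`complSing_zeroScheme`: gradients away from the
origin, Nakayama at it), that the exceptional locus is the inverse image of the origin when n ≥ 2
(`excLocus_eq`), and that Z is generically reduced when r < n, by Krull's height theorem.

Blow-ups enter only through their universal property. Existence and affine charts come from the Rees
algebra (`isBlowUp_blowUpSpec`, `exists_isBlowUp`); for a coordinate subspace the charts are
push-outs of the substitutions X_j ↦ X_k X_j along the étale coordinates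
(`isBlowUpAlgebra_of_isRingPushout`). -/

namespace BlowUpRes

noncomputable section

/-! ### Ideal sheaves on affine schemes -/

/-- The ideal sheaf on `Spec R` given by an ideal of `R`. -/
def specIdeal {R : CommRingCat.{0}} (a : Ideal R) : (Spec R).IdealSheafData :=
  Scheme.IdealSheafData.ofIdealTop (a.map (Scheme.ΓSpecIso R).inv.hom)

lemma affIdeal_eq_specIdeal {n : ℕ} (I : Ideal (MvPolynomial (Fin n) ℂ)) :
    affIdeal I = specIdeal (R := CommRingCat.of (MvPolynomial (Fin n) ℂ)) I := rfl

/-- The ring isomorphism `R ≃+* Γ(Spec R, ⊤)`. -/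
def topEquiv (R : CommRingCat.{0}) : R ≃+* Γ(Spec R, ⊤) :=
  (Scheme.ΓSpecIso R).symm.commRingCatIsoToRingEquiv

lemma specIdeal_eq {R : CommRingCat.{0}} (a : Ideal R) :
    specIdeal a = Scheme.IdealSheafData.equivOfIsAffine.symm (a.map (topEquiv R)) := rfl

lemma specIdeal_ideal_top {R : CommRingCat.{0}} (a : Ideal R) :
    (specIdeal a).ideal ⟨⊤, isAffineOpen_top _⟩ = a.map (topEquiv R) := by
  rw [specIdeal_eq, ← Scheme.IdealSheafData.equivOfIsAffine_apply, OrderRingIso.apply_symm_apply]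

lemma specIdeal_le_iff {R : CommRingCat.{0}} {a b : Ideal R} :
    specIdeal a ≤ specIdeal b ↔ a ≤ b := by
  rw [specIdeal_eq, specIdeal_eq, OrderIsoClass.map_le_map_iff]
  constructor
  · intro h
    have := Ideal.comap_mono (f := topEquiv R) h
    rwa [Ideal.comap_map_of_bijective _ (topEquiv R).bijective,
      Ideal.comap_map_of_bijective _ (topEquiv R).bijective] at this
  · exact Ideal.map_mono

lemma specIdeal_inj {R : CommRingCat.{0}} {a b : Ideal R} :
    specIdeal a = specIdeal b ↔ a = b := by
  rw [le_antisymm_iff, le_antisymm_iff, specIdeal_le_iff, specIdeal_le_iff]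

lemma exists_eq_specIdeal {R : CommRingCat.{0}} (J : (Spec R).IdealSheafData) :
    ∃ a : Ideal R, J = specIdeal a := by
  refine ⟨(Scheme.IdealSheafData.equivOfIsAffine J).comap (topEquiv R), ?_⟩
  rw [specIdeal_eq, Ideal.map_comap_of_surjective _ (topEquiv R).surjective,
    OrderRingIso.symm_apply_apply]

lemma specIdeal_mul {R : CommRingCat.{0}} (a b : Ideal R) :
    specIdeal (a * b) = specIdeal a * specIdeal b := by
  rw [specIdeal_eq, specIdeal_eq, specIdeal_eq, Ideal.map_mul, map_mul]

lemma specIdeal_sup {R : CommRingCat.{0}} (a b : Ideal R) :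
    specIdeal (a ⊔ b) = specIdeal a ⊔ specIdeal b := by
  rw [specIdeal_eq, specIdeal_eq, specIdeal_eq, Ideal.map_sup]
  exact map_add _ _ _

lemma specIdeal_top {R : CommRingCat.{0}} : specIdeal (⊤ : Ideal R) = ⊤ := by
  rw [specIdeal_eq, Ideal.map_top, ← Ideal.one_eq_top]
  exact map_one (Scheme.IdealSheafData.equivOfIsAffine.symm :
    Ideal Γ(Spec R, ⊤) ≃+*o (Spec R).IdealSheafData)

lemma specIdeal_bot {R : CommRingCat.{0}} : specIdeal (⊥ : Ideal R) = ⊥ := by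
  rw [specIdeal_eq, Ideal.map_bot]
  exact map_zero (Scheme.IdealSheafData.equivOfIsAffine.symm :
    Ideal Γ(Spec R, ⊤) ≃+*o (Spec R).IdealSheafData)

lemma specIdeal_prod {R : CommRingCat.{0}} {ι : Type*} (s : Finset ι) (a : ι → Ideal R) :
    specIdeal (∏ i ∈ s, a i) = ∏ i ∈ s, specIdeal (a i) := by
  classical
  induction s using Finset.induction_on with
  | empty => simpa using specIdeal_top
  | insert i s hi ih => rw [Finset.prod_insert hi, Finset.prod_insert hi, specIdeal_mul, ih]

lemma map_specIdeal {R S : CommRingCat.{0}} (φ : R ⟶ S) (b : Ideal S) :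
    (specIdeal b).map (Spec.map φ) = specIdeal (b.comap φ.hom) := by
  apply Scheme.IdealSheafData.ext_of_isAffine
  rw [Scheme.IdealSheafData.ideal_map_of_isAffineHom, specIdeal_ideal_top]
  change Ideal.comap _ ((specIdeal b).ideal ⟨⊤, isAffineOpen_top _⟩) = _
  rw [specIdeal_ideal_top, ← Ideal.comap_symm, ← Ideal.comap_symm]
  ext x
  change (topEquiv S).symm ((Spec.map φ).appTop.hom x) ∈ b ↔ φ.hom ((topEquiv R).symm x) ∈ b
  have h : (topEquiv S).symm ((Spec.map φ).appTop.hom x) = φ.hom ((topEquiv R).symm x) :=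
    congr($(Scheme.ΓSpecIso_naturality φ).hom x)
  rw [h]

/-- Pull-back is left adjoint to push-forward, which on spectra is contraction of ideals; extension
of ideals is the left adjoint of contraction. -/
lemma comap_specIdeal {R S : CommRingCat.{0}} (φ : R ⟶ S) (a : Ideal R) :
    (specIdeal a).comap (Spec.map φ) = specIdeal (a.map φ.hom) := by
  obtain ⟨c, hc⟩ := exists_eq_specIdeal ((specIdeal a).comap (Spec.map φ))
  apply eq_of_forall_ge_iff
  intro J
  obtain ⟨b, rfl⟩ := exists_eq_specIdeal J
  rw [← Scheme.IdealSheafData.le_map_iff_comap_le, map_specIdeal, specIdeal_le_iff,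
    specIdeal_le_iff, Ideal.map_le_iff_le_comap]

lemma mem_support_specIdeal {R : CommRingCat.{0}} {a : Ideal R} {x : Spec R} :
    x ∈ (specIdeal a).support ↔ a ≤ x.asIdeal := by
  have h : ((specIdeal a).support : Set (Spec R)) = PrimeSpectrum.zeroLocus (a : Set R) := by
    rw [specIdeal, Scheme.IdealSheafData.coe_support_ofIdealTop, Ideal.map, Scheme.zeroLocus_span]
    exact Spec_zeroLocus_eq_zeroLocus _
  rw [← SetLike.mem_coe, h]
  rfl

/-! ### Open charts -/

lemma ideal_comap_mul_of_bijective {A B : Type*} [CommRing A] [CommRing B] (f : A →+* B)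
    (hf : Function.Bijective f) (I J : Ideal B) :
    (I * J).comap f = I.comap f * J.comap f := by
  obtain ⟨e, rfl⟩ : ∃ e : A ≃+* B, (e : A →+* B) = f := ⟨RingEquiv.ofBijective f hf, rfl⟩
  have h (K : Ideal B) : K.comap (e : A →+* B) = K.map (e.symm : B →+* A) :=
    (Ideal.map_symm e).symm
  rw [h, h, h, Ideal.map_mul]

section Charts

variable {X Y : Scheme.{0}}

lemma comap_le_comap_of_chart {I J : X.IdealSheafData}
    (h : ∀ x : X, ∃ (B : CommRingCat.{0}) (j : Spec B ⟶ X), IsOpenImmersion j ∧ x ∈ Set.range j ∧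
      I.comap j ≤ J.comap j) : I ≤ J := by
  choose B j hj hx h using h
  refine Scheme.IdealSheafData.le_of_iSup_eq_top
    (fun x => ⟨j x ''ᵁ ⊤, (isAffineOpen_top _).image_of_isOpenImmersion (j x)⟩) ?_ ?_
  · ext x
    simp only [Opens.coe_iSup, Set.mem_iUnion, Opens.coe_top, Set.mem_univ, iff_true]
    obtain ⟨y, hy⟩ := hx x
    exact ⟨x, y, trivial, hy⟩
  · intro x
    have := h x ⟨⊤, isAffineOpen_top _⟩
    rw [Scheme.IdealSheafData.ideal_comap_of_isOpenImmersion,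
      Scheme.IdealSheafData.ideal_comap_of_isOpenImmersion] at this
    exact (Ideal.comap_le_comap_iff_of_surjective _
      ((j x).appIso ⊤).symm.commRingCatIsoToRingEquiv.surjective _ _).mp this

lemma eq_of_chart {I J : X.IdealSheafData}
    (h : ∀ x : X, ∃ (B : CommRingCat.{0}) (j : Spec B ⟶ X), IsOpenImmersion j ∧ x ∈ Set.range j ∧
      I.comap j = J.comap j) : I = J := by
  apply le_antisymm <;> apply comap_le_comap_of_chart <;> intro x <;>
    obtain ⟨B, j, h1, h2, h3⟩ := h x
  exacts [⟨B, j, h1, h2, h3.le⟩, ⟨B, j, h1, h2, h3.ge⟩]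

lemma comap_mul_of_isOpenImmersion (I J : Y.IdealSheafData) (f : X ⟶ Y) [IsOpenImmersion f] :
    (I * J).comap f = I.comap f * J.comap f := by
  ext U : 2
  rw [Scheme.IdealSheafData.ideal_comap_of_isOpenImmersion, Scheme.IdealSheafData.ideal_mul,
    Scheme.IdealSheafData.ideal_mul]
  simp only [Pi.mul_apply]
  rw [Scheme.IdealSheafData.ideal_comap_of_isOpenImmersion,
    Scheme.IdealSheafData.ideal_comap_of_isOpenImmersion]
  exact ideal_comap_mul_of_bijective _
    (f.appIso U).symm.commRingCatIsoToRingEquiv.bijective _ _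

lemma comap_radical_of_isOpenImmersion (I : Y.IdealSheafData) (f : X ⟶ Y) [IsOpenImmersion f] :
    I.radical.comap f = (I.comap f).radical := by
  ext U : 2
  rw [Scheme.IdealSheafData.ideal_comap_of_isOpenImmersion, Scheme.IdealSheafData.radical_ideal,
    Scheme.IdealSheafData.radical_ideal, Ideal.comap_radical,
    Scheme.IdealSheafData.ideal_comap_of_isOpenImmersion]

lemma specIdeal_radical {R : CommRingCat.{0}} (a : Ideal R) :
    specIdeal a.radical = (specIdeal a).radical := by
  apply Scheme.IdealSheafData.ext_of_isAffine
  rw [Scheme.IdealSheafData.radical_ideal, specIdeal_ideal_top, specIdeal_ideal_top,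
    ← Ideal.comap_symm, ← Ideal.comap_symm, Ideal.comap_radical]

lemma exists_chart (x : X) (U : X.Opens) (hx : x ∈ U) :
    ∃ (B : CommRingCat.{0}) (j : Spec B ⟶ X), IsOpenImmersion j ∧ x ∈ Set.range j ∧
      Set.range j ⊆ U := by
  obtain ⟨W, hW, hxW, hWU⟩ := exists_isAffineOpen_mem_and_subset hx
  refine ⟨_, hW.fromSpec, inferInstance, ?_, ?_⟩
  · rwa [hW.range_fromSpec]
  · rwa [hW.range_fromSpec]

lemma exists_chart_hom (f : X ⟶ Y) (x : X) :
    ∃ (R B : CommRingCat.{0}) (k : Spec R ⟶ Y) (j : Spec B ⟶ X) (φ : R ⟶ B),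
      IsOpenImmersion k ∧ IsOpenImmersion j ∧ x ∈ Set.range j ∧ j ≫ f = Spec.map φ ≫ k := by
  obtain ⟨R, k, hk, hxk, -⟩ := exists_chart (f x) ⊤ trivial
  obtain ⟨B, j, hj, hxj, hjU⟩ := exists_chart x (f ⁻¹ᵁ k.opensRange) hxk
  have h : Set.range (j ≫ f) ⊆ Set.range k := by
    rintro _ ⟨y, rfl⟩
    exact hjU ⟨y, rfl⟩
  refine ⟨R, B, k, j, Spec.preimage (IsOpenImmersion.lift k (j ≫ f) h), hk, hj, hxj, ?_⟩
  rw [Spec.map_preimage, IsOpenImmersion.lift_fac]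

/-- The claim is local on source and target, and for ring homomorphisms extension of ideals is
multiplicative. -/
lemma comap_mul (I J : Y.IdealSheafData) (f : X ⟶ Y) :
    (I * J).comap f = I.comap f * J.comap f := by
  apply eq_of_chart
  intro x
  obtain ⟨R, B, k, j, φ, hk, hj, hx, h⟩ := exists_chart_hom f x
  refine ⟨B, j, hj, hx, ?_⟩
  obtain ⟨a, ha⟩ := exists_eq_specIdeal (I.comap k)
  obtain ⟨b, hb⟩ := exists_eq_specIdeal (J.comap k)
  rw [comap_mul_of_isOpenImmersion _ _ j, ← Scheme.IdealSheafData.comap_comp,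
    ← Scheme.IdealSheafData.comap_comp, ← Scheme.IdealSheafData.comap_comp, h]
  simp only [Scheme.IdealSheafData.comap_comp]
  rw [comap_mul_of_isOpenImmersion _ _ k, ha, hb, ← specIdeal_mul, comap_specIdeal, comap_specIdeal,
    comap_specIdeal, ← specIdeal_mul, Ideal.map_mul]

end Charts

section AffineOpen

variable {X : Scheme.{0}}

lemma comap_fromSpec (I : X.IdealSheafData) {U : X.Opens} (hU : IsAffineOpen U) :
    I.comap hU.fromSpec = specIdeal (I.ideal ⟨U, hU⟩) := by
  apply Scheme.IdealSheafData.ext_of_isAffine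
  have e : hU.fromSpec ''ᵁ ⊤ = U := by
    rw [Scheme.Hom.image_top_eq_opensRange, hU.opensRange_fromSpec]
  refine (Scheme.IdealSheafData.ideal_comap_of_isOpenImmersion _ _ _).trans ?_
  refine Eq.trans ?_ (specIdeal_ideal_top _).symm
  rw [← I.map_ideal' (U := ⟨hU.fromSpec ''ᵁ ⊤, (isAffineOpen_top _).image_of_isOpenImmersion _⟩)
    (V := ⟨U, hU⟩) (homOfLE e.le).op]
  have h := Ideal.comap_symm (I := (I.ideal ⟨U, hU⟩).map (X.presheaf.map (homOfLE e.le).op).hom)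
    (hU.fromSpec.appIso ⊤).commRingCatIsoToRingEquiv
  refine h.trans ?_
  change Ideal.map ((hU.fromSpec.appIso ⊤).hom.hom) _ = Ideal.map (Scheme.ΓSpecIso _).inv.hom _
  rw [Ideal.map_map, ← CommRingCat.hom_comp]
  congr 2
  rw [Scheme.Hom.appIso_hom', Scheme.Hom.map_appLE, Scheme.Hom.appLE, hU.fromSpec_app_self,
    Category.assoc, ← Functor.map_comp]
  exact (congr_arg _ (CategoryTheory.Functor.map_id _ _)).trans (Category.comp_id _)

lemma exists_iso_of_chart {B : CommRingCat.{0}} (j : Spec B ⟶ X) [IsOpenImmersion j] :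
    ∃ (U : X.Opens) (hU : IsAffineOpen U) (φ : Γ(X, U) ≅ B), (U : Set X) = Set.range j ∧
      j = Spec.map φ.hom ≫ hU.fromSpec := by
  have hV : IsAffineOpen j.opensRange := isAffineOpen_opensRange j
  have hU : Set.range j = Set.range hV.fromSpec := by rw [hV.range_fromSpec]; rfl
  let e : Spec B ≅ Spec Γ(X, j.opensRange) := IsOpenImmersion.isoOfRangeEq j hV.fromSpec hU
  refine ⟨_, hV, ⟨Spec.preimage e.hom, Spec.preimage e.inv, ?_, ?_⟩, rfl, ?_⟩
  · apply Spec.map_injective; simp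
  · apply Spec.map_injective; simp
  · simp [e]

end AffineOpen

/-! ### Invertible ideal sheaves -/

section Invertible

variable {X Y : Scheme.{0}}

/-- `IsInvertible` speaks of affine open subsets, the later arguments of open immersions from
spectra; `exists_iso_of_chart` identifies the two. -/
lemma isInvertible_of_chart {I : X.IdealSheafData}
    (h : ∀ x : X, ∃ (B : CommRingCat.{0}) (j : Spec B ⟶ X) (g : B), IsOpenImmersion j ∧
      x ∈ Set.range j ∧ g ∈ nonZeroDivisors B ∧ I.comap j = specIdeal (Ideal.span {g})) :
    IsInvertible I := by
  intro x
  obtain ⟨B, j, g, hj, hx, hg, hI⟩ := h x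
  obtain ⟨U, hU, φ, hUj, hj⟩ := exists_iso_of_chart j
  let e : Γ(X, U) ≃+* B := φ.commRingCatIsoToRingEquiv
  refine ⟨⟨U, hU⟩, by rwa [← hUj] at hx, e.symm g, ?_, ?_⟩
  · rw [← MulEquivClass.map_nonZeroDivisors e.symm]
    exact ⟨g, hg, rfl⟩
  · rw [hj, Scheme.IdealSheafData.comap_comp, comap_fromSpec, comap_specIdeal, specIdeal_inj] at hI
    have h2 : Ideal.map (e : Γ(X, U) →+* B) (I.ideal ⟨U, hU⟩) = Ideal.span {g} := hI
    rw [← Ideal.comap_map_of_bijective (e : Γ(X, U) →+* B) e.bijective (I := I.ideal ⟨U, hU⟩), h2]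
    have := Ideal.map_symm (I := Ideal.span {g}) e
    refine this.symm.trans ?_
    rw [Ideal.map_span, Set.image_singleton]

lemma range_specMap_away (B : CommRingCat.{0}) (s : B) :
    Set.range (Spec.map (CommRingCat.ofHom (algebraMap B (Localization.Away s)))) =
      {y : Spec B | s ∉ y.asIdeal} :=
  PrimeSpectrum.localization_away_comap_range _ s

/-- Shrinking a chart to a basic open neighbourhood of a point. -/
lemma exists_away_chart {B : CommRingCat.{0}} (j : Spec B ⟶ X) [IsOpenImmersion j] (x : X)
    (hx : x ∈ Set.range j) (V : X.Opens) (hV : x ∈ V) :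
    ∃ s : B, x ∈ Set.range
        (Spec.map (CommRingCat.ofHom (algebraMap B (Localization.Away s))) ≫ j) ∧
      Set.range (Spec.map (CommRingCat.ofHom (algebraMap B (Localization.Away s))) ≫ j) ⊆ V := by
  obtain ⟨y, rfl⟩ := hx
  obtain ⟨_, ⟨_, ⟨s, rfl⟩, rfl⟩, hy, hs⟩ :=
    PrimeSpectrum.isBasis_basic_opens.exists_subset_of_mem_open
      (show y ∈ (j ⁻¹ᵁ V : Set (Spec B)) from hV) (j ⁻¹ᵁ V).isOpen
  obtain ⟨z, hz⟩ := (range_specMap_away B s).ge hy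
  refine ⟨s, ⟨z, by rw [Scheme.Hom.comp_apply, hz]⟩, ?_⟩
  rintro _ ⟨z, rfl⟩
  rw [Scheme.Hom.comp_apply]
  exact hs ((range_specMap_away B s).le ⟨z, rfl⟩)

lemma IsInvertible.exists_chart {I : X.IdealSheafData} (hI : IsInvertible I) (x : X) (V : X.Opens)
    (hx : x ∈ V) :
    ∃ (B : CommRingCat.{0}) (j : Spec B ⟶ X) (g : B), IsOpenImmersion j ∧ x ∈ Set.range j ∧
      Set.range j ⊆ V ∧ g ∈ nonZeroDivisors B ∧ I.comap j = specIdeal (Ideal.span {g}) := by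
  obtain ⟨⟨U, hU' : IsAffineOpen U⟩, hxU, g, hg, hI⟩ := hI x
  have hU : IsAffineOpen U := hU'
  obtain ⟨s, hs, hsV⟩ := exists_away_chart hU.fromSpec x (by rwa [hU.range_fromSpec]) V hx
  refine ⟨CommRingCat.of (Localization.Away s), _, algebraMap _ _ g, inferInstance, hs, hsV,
    IsLocalization.map_nonZeroDivisors_le (.powers s) _ ⟨g, hg, rfl⟩, ?_⟩
  rw [Scheme.IdealSheafData.comap_comp, comap_fromSpec, hI, comap_specIdeal, Ideal.map_span,
    Set.image_singleton]
  rfl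

lemma IsInvertible.comap_of_isOpenImmersion {I : Y.IdealSheafData} (hI : IsInvertible I)
    (f : X ⟶ Y) [IsOpenImmersion f] : IsInvertible (I.comap f) := by
  apply isInvertible_of_chart
  intro x
  obtain ⟨B, j, g, hj, hx, hjV, hg, h⟩ := hI.exists_chart (f x) f.opensRange ⟨x, rfl⟩
  have hr : Set.range j ⊆ Set.range f := hjV
  refine ⟨B, IsOpenImmersion.lift f j hr, g, ?_, ?_, hg, ?_⟩
  · have : IsOpenImmersion (IsOpenImmersion.lift f j hr ≫ f) := by
      rwa [IsOpenImmersion.lift_fac]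
    exact .of_comp _ f
  · obtain ⟨y, hy⟩ := hx
    refine ⟨y, f.injective ?_⟩
    rw [← Scheme.Hom.comp_apply, IsOpenImmersion.lift_fac, hy]
  · rw [← Scheme.IdealSheafData.comap_comp, IsOpenImmersion.lift_fac, h]

lemma isInvertible_top : IsInvertible (⊤ : X.IdealSheafData) := by
  apply isInvertible_of_chart
  intro x
  obtain ⟨B, j, hj, hx, -⟩ := BlowUpRes.exists_chart x ⊤ trivial
  exact ⟨B, j, 1, hj, hx, one_mem _, by
    rw [Ideal.span_singleton_one, specIdeal_top, Scheme.IdealSheafData.comap_top]⟩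

/-- Invertibility can be checked on an open cover. -/
lemma isInvertible_of_openCover {I : X.IdealSheafData}
    (h : ∀ x : X, ∃ (V : Scheme.{0}) (j : V ⟶ X), IsOpenImmersion j ∧ x ∈ Set.range j ∧
      IsInvertible (I.comap j)) : IsInvertible I := by
  apply isInvertible_of_chart
  intro x
  obtain ⟨V, j, hj, ⟨v, rfl⟩, hI⟩ := h x
  obtain ⟨B, k, g, hk, ⟨y, hy⟩, -, hg, h⟩ := hI.exists_chart v ⊤ trivial
  exact ⟨B, k ≫ j, g, inferInstance, ⟨y, by rw [Scheme.Hom.comp_apply, hy]⟩, hg,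
    by rw [Scheme.IdealSheafData.comap_comp, h]⟩

end Invertible

/-! ### Saturation and vanishing ideals on charts -/

section Saturation

variable {X : Scheme.{0}}

/-- The saturation of `c` with respect to `t`. -/
def saturation {B : Type*} [CommRing B] (t : B) (c : Ideal B) : Ideal B :=
  (c.map (algebraMap B (Localization.Away t))).comap (algebraMap B (Localization.Away t))

lemma mem_saturation {B : Type*} [CommRing B] {t : B} {c : Ideal B} {b : B} :
    b ∈ saturation t c ↔ ∃ k : ℕ, t ^ k * b ∈ c := by
  rw [saturation, Ideal.mem_comap, IsLocalization.algebraMap_mem_map_algebraMap_iff (.powers t)]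
  simp [Submonoid.mem_powers_iff]

lemma preimage_complOpen (K : X.IdealSheafData) {Y : Scheme.{0}} (f : Y ⟶ X) :
    f ⁻¹ᵁ complOpen K = complOpen (K.comap f) := by
  ext x
  simp [complOpen]

lemma mem_complOpen {K : X.IdealSheafData} {x : X} : x ∈ complOpen K ↔ x ∉ K.support := Iff.rfl

lemma preimage_complOpen_eq {K : X.IdealSheafData} {B : CommRingCat.{0}} (j : Spec B ⟶ X) (t : B)
    (hK : K.comap j = specIdeal (Ideal.span {t})) :
    ((j ⁻¹ᵁ complOpen K : (Spec B).Opens) : Set (Spec B)) = {y | t ∉ y.asIdeal} := by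
  rw [preimage_complOpen, hK]
  ext y
  rw [SetLike.mem_coe, mem_complOpen, mem_support_specIdeal, Ideal.span_singleton_le_iff_mem]
  rfl

/-- On a chart on which `K` is principal, the complement of the support of `K` is a basic open
set. -/
lemma exists_isPullback_complOpen (K : X.IdealSheafData) {B : CommRingCat.{0}} (j : Spec B ⟶ X)
    [IsOpenImmersion j] (t : B) (hK : K.comap j = specIdeal (Ideal.span {t})) :
    ∃ k : Spec (CommRingCat.of (Localization.Away t)) ⟶ (complOpen K).toScheme,
      IsPullback (Spec.map (CommRingCat.ofHom (algebraMap B (Localization.Away t)))) k j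
        (complOpen K).ι := by
  have hj := preimage_complOpen_eq j t hK
  have hr : Set.range (Spec.map (CommRingCat.ofHom (algebraMap B (Localization.Away t))) ≫ j) ⊆
      Set.range (complOpen K).ι := by
    rw [Scheme.Opens.range_ι]
    rintro _ ⟨z, rfl⟩
    rw [Scheme.Hom.comp_apply]
    exact hj.ge ((range_specMap_away B t).le ⟨z, rfl⟩)
  refine ⟨IsOpenImmersion.lift (complOpen K).ι _ hr, IsPullback.flip ?_⟩
  apply IsOpenImmersion.isPullback
  · rw [IsOpenImmersion.lift_fac]
  · ext1
    rw [Scheme.Opens.opensRange_ι, hj]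
    exact (range_specMap_away B t).symm

/-- The complement of an effective Cartier divisor is locally a basic open set. Affineness supplies
the quasi-compactness that lets scheme-theoretic closures be computed on charts. -/
lemma isAffineHom_complOpen_ι {K : X.IdealSheafData} (hK : IsInvertible K) :
    IsAffineHom (complOpen K).ι := by
  apply isAffineHom_of_forall_exists_isAffineOpen
  intro x
  obtain ⟨B, j, t, hj, hx, -, ht, hKj⟩ := hK.exists_chart x ⊤ trivial
  obtain ⟨k, hk⟩ := exists_isPullback_complOpen K j t hKj
  have : IsOpenImmersion k := MorphismProperty.of_isPullback hk inferInstance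
  refine ⟨j.opensRange, hx, isAffineOpen_opensRange j, ?_⟩
  rw [← j.image_top_eq_opensRange,
    ← IsOpenImmersion.image_preimage_eq_preimage_image_of_isPullback hk,
    Scheme.Hom.preimage_top]
  exact (isAffineOpen_top _).image_of_isOpenImmersion k

/-- A push-forward of ideals is the kernel of a morphism from a closed subscheme, and such kernels
commute with restriction to open subsets of the target when the morphism is quasi-compact. -/
lemma comap_map_of_isPullback {U V Y : Scheme.{0}} {f : X ⟶ Y} {f' : U ⟶ V} {iU : U ⟶ X}
    {iV : V ⟶ Y} [IsOpenImmersion iV] [QuasiCompact f] (H : IsPullback f' iU iV f)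
    (M : X.IdealSheafData) : (M.map f).comap iV = (M.comap iU).map f' := by
  have h1 : IsPullback (M.comap iU).subschemeι
      (Scheme.IdealSheafData.subschemeMap _ _ iU (M.le_map_comap iU)) iU M.subschemeι := by
    apply isPullback_of_isClosedImmersion
    · rw [Scheme.IdealSheafData.subschemeMap_subschemeι]
    · rw [Scheme.IdealSheafData.ker_subschemeι, Scheme.IdealSheafData.ker_subschemeι]
  have h2 := h1.paste_horiz H
  ext W : 2
  rw [Scheme.IdealSheafData.ideal_comap_of_isOpenImmersion]
  exact (Scheme.ker_ideal_of_isPullback_of_isOpenImmersion _ _ _ _ h2 W).symm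

/-- Restriction to the complement of t = 0 is localization at t, and scheme-theoretic closure is
contraction back. -/
lemma comap_map_ι {K : X.IdealSheafData} (hK : IsInvertible K) (I : X.IdealSheafData)
    {B : CommRingCat.{0}} (j : Spec B ⟶ X) [IsOpenImmersion j] (t : B) (c : Ideal B)
    (hKj : K.comap j = specIdeal (Ideal.span {t})) (hIj : I.comap j = specIdeal c) :
    ((I.comap (complOpen K).ι).map (complOpen K).ι).comap j = specIdeal (saturation t c) := by
  obtain ⟨k, hk⟩ := exists_isPullback_complOpen K j t hKj
  have := isAffineHom_complOpen_ι hK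
  rw [comap_map_of_isPullback hk, ← Scheme.IdealSheafData.comap_comp, ← hk.w,
    Scheme.IdealSheafData.comap_comp, hIj, comap_specIdeal, map_specIdeal]
  rfl

lemma comap_vanishingIdeal_support (K : X.IdealSheafData) {B : CommRingCat.{0}} (j : Spec B ⟶ X)
    [IsOpenImmersion j] (c : Ideal B) (hK : K.comap j = specIdeal c) :
    (Scheme.IdealSheafData.vanishingIdeal K.support).comap j = specIdeal c.radical := by
  rw [Scheme.IdealSheafData.vanishingIdeal_support, comap_radical_of_isOpenImmersion, hK,
    specIdeal_radical]

/-- The strict transform on a chart. -/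
lemma comap_strictTransform {Y : Scheme.{0}} (π : X ⟶ Y) (C Z : Y.IdealSheafData)
    (hC : IsInvertible (C.comap π)) {B : CommRingCat.{0}} (j : Spec B ⟶ X) [IsOpenImmersion j]
    (t : B) (c : Ideal B) (hCj : C.comap (j ≫ π) = specIdeal (Ideal.span {t}))
    (hZj : Z.comap (j ≫ π) = specIdeal c) :
    (strictTransform π (complOpen C) Z).comap j = specIdeal (saturation t c) := by
  rw [Scheme.IdealSheafData.comap_comp] at hCj hZj
  rw [strictTransform, preimage_complOpen]
  exact comap_map_ι hC _ j t c hCj hZj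

end Saturation

end

end BlowUpRes

namespace BlowUpRes

noncomputable section

/-! ### The Rees algebra as a graded ring -/

section Rees

open Polynomial HomogeneousLocalization

variable {R : Type} [CommRing R] (I : Ideal R)

/-- The grading of the Rees algebra by the degree in the auxiliary variable. -/
def reesGrading (i : ℕ) : Submodule R (reesAlgebra I) where
  carrier := {f | ∀ k ≠ i, (f : R[X]).coeff k = 0}
  add_mem' hf hg k hk := by simp [hf k hk, hg k hk]
  zero_mem' k _ := by simp
  smul_mem' c f hf k hk := by simp [hf k hk]

/-- The element `b Xⁱ` of the Rees algebra, for `b ∈ Iⁱ`. -/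
def reesMonomial (i : ℕ) (b : R) (hb : b ∈ I ^ i) : reesAlgebra I :=
  ⟨monomial i b, reesAlgebra.monomial_mem.mpr hb⟩

variable {I}

lemma reesMonomial_mem (i : ℕ) (b : R) (hb : b ∈ I ^ i) :
    reesMonomial I i b hb ∈ reesGrading I i := by
  intro k hk
  exact coeff_monomial_of_ne _ hk

lemma eq_reesMonomial {i : ℕ} {f : reesAlgebra I} (hf : f ∈ reesGrading I i) :
    f = reesMonomial I i ((f : R[X]).coeff i) (f.2 i) := by
  apply Subtype.ext
  ext k
  rw [reesMonomial, coeff_monomial]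
  split_ifs with h
  · rw [h]
  · exact hf k (Ne.symm h)

lemma reesMonomial_mul (i k : ℕ) (b c : R) (hb : b ∈ I ^ i) (hc : c ∈ I ^ k) :
    reesMonomial I i b hb * reesMonomial I k c hc =
      reesMonomial I (i + k) (b * c) (pow_add I i k ▸ Ideal.mul_mem_mul hb hc) :=
  Subtype.ext (monomial_mul_monomial _ _ _ _)

lemma coeff_coeAddMonoidHom_reesGrading (x : DirectSum ℕ fun i => reesGrading I i) (k : ℕ) :
    ((DirectSum.coeAddMonoidHom (reesGrading I) x : reesAlgebra I) : R[X]).coeff k =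
      ((x k : reesAlgebra I) : R[X]).coeff k := by
  induction x using DirectSum.induction_on with
  | zero => simp
  | of i y =>
    rw [DirectSum.coeAddMonoidHom_of]
    by_cases h : i = k
    · subst h; rw [DirectSum.of_eq_same]
    · rw [DirectSum.of_eq_of_ne _ _ _ (Ne.symm h), y.2 k (Ne.symm h)]
      simp
  | add x y hx hy => simp [hx, hy]

lemma isInternal_reesGrading : DirectSum.IsInternal (reesGrading I) := by
  constructor
  · refine fun x y hxy => DFinsupp.ext fun k => ?_
    have h := coeff_coeAddMonoidHom_reesGrading x k
    rw [hxy, coeff_coeAddMonoidHom_reesGrading] at h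
    apply Subtype.ext
    rw [eq_reesMonomial (x k).2, eq_reesMonomial (y k).2]
    apply Subtype.ext
    simp [reesMonomial, ← h]
  · intro f
    refine ⟨∑ i ∈ (f : R[X]).support, DirectSum.of (fun i => reesGrading I i) i
      ⟨reesMonomial I i ((f : R[X]).coeff i) (f.2 i), reesMonomial_mem _ _ _⟩, ?_⟩
    rw [map_sum]
    simp only [DirectSum.coeAddMonoidHom_of]
    apply Subtype.ext
    rw [AddSubmonoidClass.coe_finsetSum]
    exact (f : R[X]).as_sum_support.symm

instance : GradedRing (reesGrading I) where
  one_mem := by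
    intro k hk
    simp [coeff_one, hk]
  mul_mem i k f g hf hg := by
    rw [eq_reesMonomial hf, eq_reesMonomial hg, reesMonomial_mul]
    exact reesMonomial_mem _ _ _
  toDecomposition := isInternal_reesGrading.chooseDecomposition

/-- The identification of `R` with the degree zero part of the Rees algebra. -/
def reesZero (I : Ideal R) : R ≃+* reesGrading I 0 where
  toFun b := ⟨reesMonomial I 0 b (by simp), reesMonomial_mem _ _ _⟩
  invFun f := ((f : reesAlgebra I) : R[X]).coeff 0
  left_inv b := coeff_monomial_same _ _
  right_inv f := Subtype.ext (eq_reesMonomial f.2).symm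
  map_mul' b c := by
    apply Subtype.ext
    exact (reesMonomial_mul 0 0 b c (by simp) (by simp)).symm
  map_add' b c := by
    apply Subtype.ext
    apply Subtype.ext
    exact (monomial 0).map_add b c

/-! ### The affine charts of the blow-up -/

/-- The element `a X` of the Rees algebra, for `a ∈ I`. -/
def reesX {a : R} (ha : a ∈ I) : reesAlgebra I := reesMonomial I 1 a (by simpa)

lemma reesX_mem {a : R} (ha : a ∈ I) : reesX ha ∈ reesGrading I 1 := reesMonomial_mem _ _ _

lemma reesX_pow {a : R} (ha : a ∈ I) (k : ℕ) :
    reesX ha ^ k = reesMonomial I k (a ^ k) (Ideal.pow_mem_pow ha k) := by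
  apply Subtype.ext
  change (monomial 1 a) ^ k = monomial k (a ^ k)
  rw [monomial_pow, one_mul]

/-- The algebra `R[I/a]`, the degree zero part of the localization of the Rees algebra at `a X`. -/
abbrev ReesAway {a : R} (ha : a ∈ I) : Type := Away (reesGrading I) (reesX ha)

/-- The structure map `R → R[I/a]`. -/
def toReesAway {a : R} (ha : a ∈ I) : R →+* ReesAway ha :=
  (fromZeroRingHom (reesGrading I) _).comp (reesZero I : R →+* reesGrading I 0)

/-- The fraction `b / aᵏ`, for `b ∈ Iᵏ`. -/
def reesFrac {a : R} (ha : a ∈ I) (k : ℕ) (b : R) (hb : b ∈ I ^ k) : ReesAway ha :=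
  Away.mk (reesGrading I) (reesX_mem ha) k (reesMonomial I k b hb)
    (by simpa using reesMonomial_mem k b hb)

lemma exists_eq_reesFrac {a : R} (ha : a ∈ I) (x : ReesAway ha) :
    ∃ k b hb, x = reesFrac ha k b hb := by
  obtain ⟨k, f, hf, rfl⟩ := Away.mk_surjective _ (reesX_mem ha) x
  have hf' : f ∈ reesGrading I k := by simpa using hf
  refine ⟨k, (f : R[X]).coeff k, f.2 k, ?_⟩
  unfold reesFrac
  congr 1
  exact eq_reesMonomial hf'

lemma toReesAway_val {a : R} (ha : a ∈ I) (b : R) :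
    (toReesAway ha b).val = algebraMap _ _ (reesMonomial I 0 b (by simp)) := rfl

lemma reesFrac_val {a : R} (ha : a ∈ I) (k : ℕ) (b : R) (hb : b ∈ I ^ k) :
    (reesFrac ha k b hb).val = Localization.mk (reesMonomial I k b hb)
      ⟨reesX ha ^ k, Submonoid.mem_powers_iff _ _ |>.mpr ⟨k, rfl⟩⟩ := by
  rw [reesFrac, Away.val_mk]

/-- With `exists_eq_reesFrac` this relation is what computes in R[I/a]: the image of a being a
non-zero-divisor, it characterizes b / aᵏ. -/
lemma toReesAway_pow_mul_reesFrac {a : R} (ha : a ∈ I) (k : ℕ) (b : R) (hb : b ∈ I ^ k) :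
    toReesAway ha (a ^ k) * reesFrac ha k b hb = toReesAway ha b := by
  apply val_injective
  rw [val_mul, toReesAway_val, toReesAway_val, reesFrac_val, ← Localization.mk_one_eq_algebraMap,
    ← Localization.mk_one_eq_algebraMap, Localization.mk_mul, Localization.mk_eq_mk_iff,
    Localization.r_iff_exists]
  refine ⟨1, ?_⟩
  simp only [OneMemClass.coe_one, one_mul, reesX_pow, reesMonomial_mul]
  apply Subtype.ext
  simp [reesMonomial]

lemma toReesAway_mem_nonZeroDivisors {a : R} (ha : a ∈ I) :
    toReesAway ha a ∈ nonZeroDivisors (ReesAway ha) := by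
  refine (mem_nonZeroDivisors_iff_right (M₀ := ReesAway ha)).mpr fun x hx => ?_
  obtain ⟨k, b, hb, rfl⟩ := exists_eq_reesFrac ha x
  have h := congr_arg HomogeneousLocalization.val hx
  rw [val_mul, toReesAway_val, reesFrac_val, ← Localization.mk_one_eq_algebraMap,
    Localization.mk_mul, val_zero, ← Localization.mk_zero (1 : Submonoid.powers (reesX ha)),
    Localization.mk_eq_mk_iff, Localization.r_iff_exists] at h
  obtain ⟨⟨_, m, rfl⟩, h⟩ := h
  simp only [reesX_pow, reesMonomial_mul, mul_zero, OneMemClass.coe_one, one_mul, mul_one] at h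
  have h' : a ^ m * (b * a) = 0 := by
    have := congr_arg (fun f : reesAlgebra I => (f : R[X]).coeff (m + (k + 0))) h
    simpa [reesMonomial] using this
  apply val_injective
  rw [reesFrac_val, val_zero, ← Localization.mk_zero (1 : Submonoid.powers (reesX ha)),
    Localization.mk_eq_mk_iff, Localization.r_iff_exists]
  -- One more power of a X than in the given relation absorbs the extra factor a.
  refine ⟨⟨reesX ha ^ (m + 1), m + 1, rfl⟩, ?_⟩
  simp only [reesX_pow, reesMonomial_mul, mul_zero, OneMemClass.coe_one, one_mul]
  apply Subtype.ext
  have : a ^ (m + 1) * b = 0 := by rw [← h']; ring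
  simp [reesMonomial, this]

lemma map_toReesAway {a : R} (ha : a ∈ I) :
    I.map (toReesAway ha) = Ideal.span {toReesAway ha a} := by
  apply le_antisymm
  · rw [Ideal.map_le_iff_le_comap]
    intro b hb
    rw [Ideal.mem_comap, Ideal.mem_span_singleton]
    refine ⟨reesFrac ha 1 b (by simpa), ?_⟩
    rw [← toReesAway_pow_mul_reesFrac ha 1 b (by simpa)]
    congr 2
    rw [pow_one]
  · rw [Ideal.span_singleton_le_iff_mem]
    exact Ideal.mem_map_of_mem _ ha

/-- Every element becomes an element of R after multiplication by a power of a, and that power can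
be cancelled in S. -/
lemma reesAway_hom_ext {a : R} (ha : a ∈ I) {S : Type} [CommRing S] {ψ₁ ψ₂ : ReesAway ha →+* S}
    (hS : ψ₁ (toReesAway ha a) ∈ nonZeroDivisors S)
    (h : ψ₁.comp (toReesAway ha) = ψ₂.comp (toReesAway ha)) : ψ₁ = ψ₂ := by
  ext x
  obtain ⟨k, b, hb, rfl⟩ := exists_eq_reesFrac ha x
  have e (c : R) : ψ₁ (toReesAway ha c) = ψ₂ (toReesAway ha c) := congr($h c)
  have h1 := congr_arg ψ₁ (toReesAway_pow_mul_reesFrac ha k b hb)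
  have h2 := congr_arg ψ₂ (toReesAway_pow_mul_reesFrac ha k b hb)
  rw [map_mul] at h1 h2
  rw [← e, ← e, ← h1] at h2
  have hk : ψ₁ (toReesAway ha (a ^ k)) ∈ nonZeroDivisors S := by
    have := map_pow (ψ₁.comp (toReesAway ha)) a k
    exact this ▸ pow_mem hS k
  exact (mul_cancel_left_mem_nonZeroDivisors hk).mp h2.symm

/-- The map is first built into S[1/φ(a)], sending the Rees variable to 1/φ(a), so that a X goes to
1. It lands in the subring S because b ∈ Iᵏ forces φ(b) to be a multiple of φ(a)ᵏ. -/
lemma exists_reesAway_lift {a : R} (ha : a ∈ I) {S : Type} [CommRing S] (φ : R →+* S)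
    (hS : φ a ∈ nonZeroDivisors S) (hI : I.map φ ≤ Ideal.span {φ a}) :
    ∃ ψ : ReesAway ha →+* S, ψ.comp (toReesAway ha) = φ := by
  let L := Localization.Away (φ a)
  have hinj : Function.Injective (algebraMap S L) :=
    IsLocalization.injective L (M := .powers (φ a)) (by
      rintro _ ⟨k, rfl⟩; exact pow_mem hS k)
  let u : L := IsLocalization.Away.invSelf (φ a)
  have hu : algebraMap S L (φ a) * u = 1 := IsLocalization.Away.mul_invSelf _
  let θ : reesAlgebra I →+* L :=
    (eval₂RingHom ((algebraMap S L).comp φ) u).comp (reesAlgebra I).val.toRingHom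
  have hθ (k b hb) : θ (reesMonomial I k b hb) = algebraMap S L (φ b) * u ^ k :=
    eval₂_monomial _ _
  have hθX : θ (reesX ha) = 1 := by rw [reesX, hθ, pow_one, hu]
  let Θ : ReesAway ha →+* L :=
    (IsLocalization.Away.lift (S := Localization.Away (reesX ha)) (reesX ha) (g := θ)
      (by rw [hθX]; exact isUnit_one)).comp (algebraMap _ _)
  have hΘ0 (b) : Θ (toReesAway ha b) = algebraMap S L (φ b) := by
    change IsLocalization.Away.lift _ (by rw [hθX]; exact isUnit_one) (toReesAway ha b).val = _
    rw [toReesAway_val, IsLocalization.Away.lift_eq, hθ, pow_zero, mul_one]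
  have hΘ (x) : Θ x ∈ (algebraMap S L).range := by
    obtain ⟨k, b, hb, rfl⟩ := exists_eq_reesFrac ha x
    have h1 := congr_arg Θ (toReesAway_pow_mul_reesFrac ha k b hb)
    rw [map_mul, hΘ0, hΘ0, map_pow, map_pow] at h1
    have h2 : φ b ∈ Ideal.span {φ a ^ k} := by
      rw [← Ideal.span_singleton_pow]
      refine Ideal.pow_right_mono hI k ?_
      rw [← Ideal.map_pow]
      exact Ideal.mem_map_of_mem _ hb
    obtain ⟨c, hc⟩ := Ideal.mem_span_singleton.mp h2
    refine ⟨c, ?_⟩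
    rw [hc, map_mul, map_pow] at h1
    have hun : IsUnit (algebraMap S L (φ a) ^ k) := (IsUnit.of_mul_eq_one _ hu).pow k
    exact (hun.mul_left_cancel h1).symm
  let e : S ≃+* (algebraMap S L).range := RingEquiv.ofLeftInverse
    (f := algebraMap S L) (Function.leftInverse_invFun hinj)
  refine ⟨(e.symm : _ →+* S).comp (Θ.codRestrict _ hΘ), ?_⟩
  ext b
  change e.symm ⟨Θ (toReesAway ha b), _⟩ = _
  rw [RingEquiv.symm_apply_eq]
  exact Subtype.ext (hΘ0 b)

end Rees

end

end BlowUpRes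

namespace BlowUpRes

noncomputable section

/-! ### Blow-up algebras and generators of invertible ideals -/

/-- `ρ : R → B` is the affine blow-up algebra `R[I/a]`: the image of `a` is a non-zero-divisor which
generates `I · B`, and `B` is universal with this property. -/
structure IsBlowUpAlgebra {R B : Type} [CommRing R] [CommRing B] (I : Ideal R) (a : R)
    (ρ : R →+* B) : Prop where
  mem : a ∈ I
  mem_nonZeroDivisors : ρ a ∈ nonZeroDivisors B
  map_le : I.map ρ ≤ Ideal.span {ρ a}
  exists_lift : ∀ {S : Type} [CommRing S] (φ : R →+* S), φ a ∈ nonZeroDivisors S →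
    I.map φ ≤ Ideal.span {φ a} → ∃ ψ : B →+* S, ψ.comp ρ = φ
  hom_ext : ∀ {S : Type} [CommRing S] (ψ₁ ψ₂ : B →+* S), ψ₁ (ρ a) ∈ nonZeroDivisors S →
    ψ₁.comp ρ = ψ₂.comp ρ → ψ₁ = ψ₂

lemma isBlowUpAlgebra_reesAway {R : Type} [CommRing R] {I : Ideal R} {a : R} (ha : a ∈ I) :
    IsBlowUpAlgebra I a (toReesAway ha) where
  mem := ha
  mem_nonZeroDivisors := toReesAway_mem_nonZeroDivisors ha
  map_le := (map_toReesAway ha).le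
  exists_lift φ h1 h2 := exists_reesAway_lift ha φ h1 h2
  hom_ext _ _ h1 h2 := reesAway_hom_ext ha h1 h2

namespace IsBlowUpAlgebra

variable {R B B' : Type} [CommRing R] [CommRing B] [CommRing B'] {I : Ideal R} {a : R}
  {ρ : R →+* B} {ρ' : R →+* B'}

lemma map_eq (h : IsBlowUpAlgebra I a ρ) : I.map ρ = Ideal.span {ρ a} :=
  le_antisymm h.map_le
    ((Ideal.span_singleton_le_iff_mem _).mpr (Ideal.mem_map_of_mem _ h.mem))

lemma exists_equiv (h : IsBlowUpAlgebra I a ρ) (h' : IsBlowUpAlgebra I a ρ') :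
    ∃ e : B ≃+* B', (e : B →+* B').comp ρ = ρ' := by
  obtain ⟨ψ, hψ⟩ := h.exists_lift ρ' h'.mem_nonZeroDivisors h'.map_le
  obtain ⟨ψ', hψ'⟩ := h'.exists_lift ρ h.mem_nonZeroDivisors h.map_le
  have h1 : ψ'.comp ψ = RingHom.id B := by
    apply h.hom_ext
    · have : (ψ'.comp ψ) (ρ a) = ρ a := by
        rw [← RingHom.comp_apply, RingHom.comp_assoc, hψ, hψ']
      rw [this]
      exact h.mem_nonZeroDivisors
    · rw [RingHom.comp_assoc, hψ, hψ', RingHom.id_comp]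
  have h2 : ψ.comp ψ' = RingHom.id B' := by
    apply h'.hom_ext
    · have : (ψ.comp ψ') (ρ' a) = ρ' a := by
        rw [← RingHom.comp_apply, RingHom.comp_assoc, hψ', hψ]
      rw [this]
      exact h'.mem_nonZeroDivisors
    · rw [RingHom.comp_assoc, hψ', hψ, RingHom.id_comp]
  exact ⟨RingEquiv.ofRingHom ψ ψ' h2 h1, hψ⟩

end IsBlowUpAlgebra

/-- If `I · S` is generated by a non-zero-divisor then locally on `Spec S` it is generated by one of
the given generators of `I`. -/
lemma exists_generator {R S : Type} [CommRing R] [CommRing S] (φ : R →+* S) (G : Set R) (g : S)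
    (hg : g ∈ nonZeroDivisors S) (hI : (Ideal.span G).map φ = Ideal.span {g}) (p : Ideal S)
    [p.IsPrime] :
    ∃ a ∈ G, ∃ s ∉ p,
      algebraMap S (Localization.Away s) (φ a) ∈ nonZeroDivisors (Localization.Away s) ∧
      (Ideal.span G).map ((algebraMap S (Localization.Away s)).comp φ) =
        Ideal.span {algebraMap S (Localization.Away s) (φ a)} := by
  have hc (a : R) (ha : a ∈ G) : ∃ c, φ a = g * c := by
    have : φ a ∈ Ideal.span {g} := hI ▸ Ideal.mem_map_of_mem _ (Ideal.subset_span ha)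
    exact Ideal.mem_span_singleton.mp this
  -- If all quotients φ(a)/g lay in p, then (g) would be contained in g · p, and cancelling g would
  -- give 1 ∈ p. Inverting a quotient outside p makes φ(a) and g associates.
  have key : ∃ a ∈ G, ∃ c ∉ p, φ a = g * c := by
    by_contra! hcon
    have h1 : (Ideal.span G).map φ ≤ Ideal.span {g} * p := by
      rw [Ideal.map_span, Ideal.span_le]
      rintro _ ⟨a, ha, rfl⟩
      obtain ⟨c, h⟩ := hc a ha
      rw [SetLike.mem_coe, h]
      refine Ideal.mul_mem_mul (Ideal.mem_span_singleton_self g) ?_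
      by_contra hcp
      exact hcon a ha c hcp h
    rw [hI, Ideal.span_singleton_le_iff_mem, Ideal.mem_span_singleton_mul] at h1
    obtain ⟨z, hz, hgz⟩ := h1
    have : z = 1 := (mul_cancel_left_mem_nonZeroDivisors hg).mp (by rw [hgz, mul_one])
    exact (Ideal.ne_top_iff_one p).mp ‹p.IsPrime›.ne_top (this ▸ hz)
  obtain ⟨a, ha, c, hcp, h⟩ := key
  have hu : IsUnit (algebraMap S (Localization.Away c) c) := IsLocalization.Away.algebraMap_isUnit c
  have hg' : algebraMap S (Localization.Away c) g ∈ nonZeroDivisors (Localization.Away c) :=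
    IsLocalization.map_nonZeroDivisors_le (.powers c) _ ⟨g, hg, rfl⟩
  refine ⟨a, ha, c, hcp, ?_, ?_⟩
  · rw [h, map_mul]
    exact mul_mem hg' hu.mem_nonZeroDivisors
  · rw [← Ideal.map_map, hI, Ideal.map_span, Set.image_singleton, h, map_mul,
      Ideal.span_singleton_mul_right_unit hu]

/-- Locally, an invertible inverse image ideal is generated by one of the given generators. -/
lemma exists_chart_generator {T : Scheme.{0}} {R : CommRingCat.{0}} (G : Set R) (g : T ⟶ Spec R)
    (hg : IsInvertible ((specIdeal (Ideal.span G)).comap g)) (x : T) (V : T.Opens) (hx : x ∈ V) :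
    ∃ (S : CommRingCat.{0}) (k : Spec S ⟶ T) (φ : R ⟶ S) (a : R), IsOpenImmersion k ∧
      x ∈ Set.range k ∧ Set.range k ⊆ V ∧ k ≫ g = Spec.map φ ∧ a ∈ G ∧
      φ.hom a ∈ nonZeroDivisors S ∧ (Ideal.span G).map φ.hom = Ideal.span {φ.hom a} := by
  obtain ⟨S, k, c, hk, ⟨y, hy⟩, hkV, hc, hI⟩ := hg.exists_chart x V hx
  have hkg : k ≫ g = Spec.map (Spec.preimage (k ≫ g)) := (Spec.map_preimage _).symm
  rw [← Scheme.IdealSheafData.comap_comp, hkg, comap_specIdeal, specIdeal_inj] at hI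
  have := PrimeSpectrum.isPrime y
  obtain ⟨a, ha, s, hs, h1, h2⟩ := exists_generator _ G c hc hI y.asIdeal
  refine ⟨.of (Localization.Away s), Spec.map (CommRingCat.ofHom (algebraMap S _)) ≫ k,
    Spec.preimage (k ≫ g) ≫ CommRingCat.ofHom (algebraMap S _), a, inferInstance, ?_, ?_, ?_, ha,
    h1, h2⟩
  · obtain ⟨z, hz⟩ := (range_specMap_away S s).ge hs
    exact ⟨z, by rw [Scheme.Hom.comp_apply, hz, hy]⟩
  · rintro _ ⟨z, rfl⟩
    exact hkV ⟨_, (Scheme.Hom.comp_apply _ _ _).symm⟩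
  · rw [Category.assoc, Spec.map_comp, Spec.map_preimage]

/-! ### Lifting morphisms locally -/

/-- The open cover by open neighbourhoods of all points. -/
def coverOfCharts {T : Scheme.{0}} (V : T → Scheme.{0}) (j : ∀ x, V x ⟶ T)
    [∀ x, IsOpenImmersion (j x)] (hx : ∀ x, x ∈ Set.range (j x)) : T.OpenCover where
  I₀ := T
  X := V
  f := j
  mem₀ := by
    rw [Scheme.presieve₀_mem_precoverage_iff]
    exact ⟨fun x => ⟨x, hx x⟩, inferInstance⟩

lemma hom_ext_of_charts {T Y : Scheme.{0}} {h₁ h₂ : T ⟶ Y}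
    (h : ∀ x : T, ∃ (V : Scheme.{0}) (j : V ⟶ T), IsOpenImmersion j ∧ x ∈ Set.range j ∧
      j ≫ h₁ = j ≫ h₂) : h₁ = h₂ := by
  choose V j hj hx h using h
  exact Scheme.Cover.hom_ext (coverOfCharts V j hx) _ _ h

lemma exists_glue_of_charts {T Y : Scheme.{0}} (V : T → Scheme.{0}) (j : ∀ x, V x ⟶ T)
    [∀ x, IsOpenImmersion (j x)] (hx : ∀ x, x ∈ Set.range (j x)) (h : ∀ x, V x ⟶ Y)
    (hglue : ∀ x y, Limits.pullback.fst (j x) (j y) ≫ h x =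
      Limits.pullback.snd (j x) (j y) ≫ h y) : ∃ k : T ⟶ Y, ∀ x, j x ≫ k = h x :=
  ⟨Scheme.Cover.glueMorphisms (coverOfCharts V j hx) h hglue,
    Scheme.Cover.ι_glueMorphisms (coverOfCharts V j hx) h hglue⟩

/-- Uniqueness is demanded over every open piece of T: on overlaps it makes the local lifts glue,
and on T itself it gives global uniqueness. -/
lemma existsUnique_lift_of_local {T Y Y' : Scheme.{0}} (ρ : Y' ⟶ Y) (g : T ⟶ Y)
    (hex : ∀ x : T, ∃ (V : Scheme.{0}) (j : V ⟶ T), IsOpenImmersion j ∧ x ∈ Set.range j ∧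
      ∃ h : V ⟶ Y', h ≫ ρ = j ≫ g)
    (huniq : ∀ (V : Scheme.{0}) (j : V ⟶ T) (h₁ h₂ : V ⟶ Y'), IsOpenImmersion j →
      h₁ ≫ ρ = j ≫ g → h₂ ≫ ρ = j ≫ g → h₁ = h₂) :
    ∃! h : T ⟶ Y', h ≫ ρ = g := by
  choose V j hj hx h hh using hex
  obtain ⟨k, hk⟩ := exists_glue_of_charts V j hx h fun x y =>
    huniq _ (Limits.pullback.fst (j x) (j y) ≫ j x) _ _ inferInstance
      (by rw [Category.assoc, hh, Category.assoc])
      (by rw [Limits.pullback.condition, Category.assoc, hh, Category.assoc])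
  have hkg : k ≫ ρ = g := hom_ext_of_charts fun x =>
    ⟨V x, j x, hj x, hx x, by rw [← Category.assoc, hk, hh]⟩
  refine ⟨k, hkg, fun k' hk' => ?_⟩
  exact huniq T (𝟙 T) _ _ inferInstance (by rw [hk', Category.id_comp])
    (by rw [hkg, Category.id_comp])

/-! ### The blow-up of an affine scheme -/

section BlowUpSpec

variable {R : CommRingCat.{0}} (I : Ideal R)

/-- The blow-up of `Spec R` along `I`. -/
abbrev blowUpSpec : Scheme.{0} := Proj (reesGrading I)

/-- The blow-up morphism. -/
def blowUpSpecπ : blowUpSpec I ⟶ Spec R :=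
  Proj.toSpecZero (reesGrading I) ≫
    Spec.map (CommRingCat.ofHom (reesZero I : R →+* reesGrading I 0))

variable {I}

/-- The chart `Spec R[I/a]` of the blow-up. -/
def blowUpSpecChart {a : R} (ha : a ∈ I) : Spec (.of (ReesAway ha)) ⟶ blowUpSpec I :=
  Proj.awayι (reesGrading I) (reesX ha) (reesX_mem ha) one_pos

instance {a : R} (ha : a ∈ I) : IsOpenImmersion (blowUpSpecChart ha) :=
  inferInstanceAs (IsOpenImmersion (Proj.awayι _ _ _ _))

lemma blowUpSpecChart_π {a : R} (ha : a ∈ I) :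
    blowUpSpecChart ha ≫ blowUpSpecπ I = Spec.map (CommRingCat.ofHom (toReesAway ha)) := by
  refine (Proj.awayι_toSpecZero_assoc _ _ _ _ _).trans ?_
  rw [← Spec.map_comp]
  rfl

/-- The elements a X with a ∈ G generate degree one by linearity, and higher degrees because I^{k+1}
= Iᵏ · I. Hence the charts indexed by generators of I cover Proj. -/
lemma reesMonomial_mem_span {G : Set R} (hG : I = Ideal.span G) (k : ℕ) (b : R)
    (hb : b ∈ I ^ (k + 1)) :
    reesMonomial I (k + 1) b hb ∈
      Ideal.span (Set.range fun a : G => reesX (I := I) (hG ▸ Ideal.subset_span a.2)) := by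
  set J := Ideal.span (Set.range fun a : G => reesX (I := I) (hG ▸ Ideal.subset_span a.2)) with hJ
  have add (i : ℕ) (b c : R) (hb : b ∈ I ^ i) (hc : c ∈ I ^ i) :
      reesMonomial I i (b + c) (add_mem hb hc) = reesMonomial I i b hb + reesMonomial I i c hc :=
    Subtype.ext (map_add _ _ _)
  have h1 (b : R) (hb : b ∈ I) : reesX hb ∈ J := by
    have hb' : b ∈ Ideal.span G := hG ▸ hb
    induction hb' using Submodule.span_induction with
    | mem x h => exact Ideal.subset_span ⟨⟨x, h⟩, rfl⟩
    | zero =>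
      have : reesX hb = 0 := Subtype.ext (map_zero _)
      rw [this]
      exact zero_mem _
    | add x y hx hy ihx ihy =>
      replace hx : x ∈ I := by rw [hG]; exact hx
      replace hy : y ∈ I := by rw [hG]; exact hy
      have : reesX hb = reesX hx + reesX hy := add _ _ _ _ _
      rw [this]
      exact add_mem (ihx hx) (ihy hy)
    | smul c x hx ih =>
      replace hx : x ∈ I := by rw [hG]; exact hx
      have : reesX hb = reesMonomial I 0 c (by simp) * reesX hx := by
        rw [reesX, reesX, reesMonomial_mul]
        rfl
      rw [this]
      exact Ideal.mul_mem_left _ _ (ih hx)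
  have hb' : b ∈ I ^ k * I := pow_succ I k ▸ hb
  induction hb' using Submodule.mul_induction_on' with
  | mem_mul_mem m hm c hc =>
    have := Ideal.mul_mem_left J (reesMonomial I k m hm) (h1 c hc)
    rwa [reesX, reesMonomial_mul] at this
  | add x hx y hy ihx ihy =>
    rw [← pow_succ] at hx hy
    rw [add _ _ _ hx hy]
    exact add_mem (ihx hx) (ihy hy)

lemma irrelevant_le_span {G : Set R} (hG : I = Ideal.span G) :
    (HomogeneousIdeal.irrelevant (reesGrading I)).toIdeal ≤
      Ideal.span (Set.range fun a : G => reesX (I := I) (hG ▸ Ideal.subset_span a.2)) := by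
  classical
  intro z hz
  rw [← DirectSum.sum_support_decompose (reesGrading I) z]
  refine Ideal.sum_mem _ fun k hk => ?_
  cases k with
  | zero =>
    exfalso
    rw [DFinsupp.mem_support_iff] at hk
    apply hk
    apply Subtype.ext
    rw [HomogeneousIdeal.mem_iff, HomogeneousIdeal.mem_irrelevant_iff] at hz
    simpa [GradedRing.proj_apply] using hz
  | succ k =>
    rw [eq_reesMonomial (DirectSum.decompose (reesGrading I) z (k + 1)).2]
    exact reesMonomial_mem_span hG k _ _

lemma exists_mem_range_blowUpSpecChart {G : Set R} (hG : I = Ideal.span G) (y : blowUpSpec I) :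
    ∃ (a : R) (ha : a ∈ I), a ∈ G ∧ y ∈ Set.range (blowUpSpecChart ha) := by
  have h := Proj.iSup_basicOpen_eq_top (reesGrading I) _ (irrelevant_le_span hG)
  obtain ⟨a, ha⟩ := Opens.mem_iSup.mp (h.ge (Set.mem_univ y))
  refine ⟨a, hG ▸ Ideal.subset_span a.2, a.2, ?_⟩
  rw [← Proj.opensRange_awayι _ _ (reesX_mem _) one_pos] at ha
  exact ha

/-- This is the source of uniqueness of lifts to the blow-up. A point of the lift lies in some chart
of b ∈ I. Since φ(b) = φ(a) c and the image u of a/b satisfies φ(b) u = φ(a), cancelling φ(a) gives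
c u = 1; so a/b is invertible at the point, which therefore lies in the chart of a as well. -/
lemma range_subset_chart {S : CommRingCat.{0}} (φ : R ⟶ S) {a : R} (ha : a ∈ I)
    (hφ : φ.hom a ∈ nonZeroDivisors S) (hI : I.map φ.hom ≤ Ideal.span {φ.hom a})
    (h : Spec S ⟶ blowUpSpec I) (hh : h ≫ blowUpSpecπ I = Spec.map φ) :
    Set.range h ⊆ Set.range (blowUpSpecChart ha) := by
  rintro _ ⟨y, rfl⟩
  obtain ⟨b, hb, -, hy⟩ := exists_mem_range_blowUpSpecChart (Ideal.span_eq I).symm (h y)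
  obtain ⟨s, ⟨z, hz⟩, hs⟩ := exists_away_chart (𝟙 (Spec S)) y ⟨y, rfl⟩
    (h ⁻¹ᵁ (blowUpSpecChart hb).opensRange) hy
  have e := Category.comp_id (Spec.map (CommRingCat.ofHom (algebraMap S (Localization.Away s))))
  replace hz := congr($e z).symm.trans hz
  let S' : CommRingCat.{0} := CommRingCat.of (Localization.Away s)
  let ι : S ⟶ S' := CommRingCat.ofHom (algebraMap S (Localization.Away s))
  have hr : Set.range (Spec.map ι ≫ h) ⊆ Set.range (blowUpSpecChart hb) := by
    rintro _ ⟨w, rfl⟩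
    exact hs ⟨w, rfl⟩
  let m := IsOpenImmersion.lift (blowUpSpecChart hb) (Spec.map ι ≫ h) hr
  have hm : m ≫ blowUpSpecChart hb = Spec.map ι ≫ h := IsOpenImmersion.lift_fac _ _ _
  have hψ : CommRingCat.ofHom (toReesAway hb) ≫ Spec.preimage m = φ ≫ ι := by
    apply Spec.map_injective
    rw [Spec.map_comp, Spec.map_preimage, ← blowUpSpecChart_π, ← Category.assoc, hm,
      Category.assoc, hh, Spec.map_comp]
  let ψ : ReesAway hb →+* S' := (Spec.preimage m).hom
  have hψ' (c : R) : ψ (toReesAway hb c) = ι.hom (φ.hom c) := congr($(hψ).hom c)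
  have hnzd : ι.hom (φ.hom a) ∈ nonZeroDivisors S' :=
    IsLocalization.map_nonZeroDivisors_le (.powers s) _ ⟨_, hφ, rfl⟩
  obtain ⟨c, hc⟩ := Ideal.mem_span_singleton.mp (hI (Ideal.mem_map_of_mem φ.hom hb))
  have hunit : IsUnit (ψ (reesFrac hb 1 a (by simpa))) := by
    refine .of_mul_eq_one (ι.hom c) ((mul_cancel_left_mem_nonZeroDivisors hnzd).mp ?_)
    have h1 := congr_arg ψ (toReesAway_pow_mul_reesFrac hb 1 a (by simpa))
    rw [map_mul, hψ', hψ', pow_one, hc, map_mul] at h1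
    rw [mul_one]
    linear_combination h1
  -- Inside the chart of b, the chart of a is the basic open set where a/b is invertible.
  have hmem : m z ∈ blowUpSpecChart hb ⁻¹ᵁ Proj.basicOpen (reesGrading I) (reesX ha) := by
    refine (Proj.awayι_preimage_basicOpen (reesGrading I) (reesX_mem hb) one_pos
      (reesX_mem ha) one_pos).ge ?_
    have e : HomogeneousLocalization.Away.isLocalizationElem (reesX_mem hb) (reesX_mem ha) =
        reesFrac hb 1 a (by simpa) := by
      apply HomogeneousLocalization.val_injective
      rw [HomogeneousLocalization.Away.val_mk, reesFrac_val]
      congr 1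
      rw [pow_one]
      rfl
    change _ ∉ (m z).asIdeal
    rw [e]
    have hmz : m z = Spec.map (Spec.preimage m) z := by rw [Spec.map_preimage]
    rw [hmz]
    intro hcon
    have := PrimeSpectrum.isPrime z
    exact this.ne_top (Ideal.eq_top_of_isUnit_mem _ hcon hunit)
  rw [← Proj.opensRange_awayι _ _ (reesX_mem ha) one_pos] at hmem
  have : blowUpSpecChart hb (m z) = h y := by
    rw [← Scheme.Hom.comp_apply, hm, Scheme.Hom.comp_apply]
    exact congr_arg h hz
  rw [← this]
  exact hmem

/-- Locally on T one element a ∈ I generates the invertible inverse image. There the universal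
property of R[I/a] provides a lift, and `range_subset_chart` forces every lift through the chart of
a, where the same universal property gives uniqueness. -/
theorem isBlowUp_blowUpSpec : IsBlowUp (blowUpSpecπ I) (specIdeal I) where
  invertible := by
    apply isInvertible_of_chart
    intro y
    obtain ⟨a, ha, -, hy⟩ := exists_mem_range_blowUpSpecChart (Ideal.span_eq I).symm y
    refine ⟨_, blowUpSpecChart ha, toReesAway ha a, inferInstance, hy,
      toReesAway_mem_nonZeroDivisors ha, ?_⟩
    rw [← Scheme.IdealSheafData.comap_comp, blowUpSpecChart_π, comap_specIdeal]
    exact congr_arg _ (map_toReesAway ha)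
  universal T g hg := by
    have key (V : Scheme.{0}) (k : V ⟶ T) [IsOpenImmersion k] (x : V) :
        ∃ (S : CommRingCat.{0}) (l : Spec S ⟶ V) (φ : R ⟶ S) (a : R), IsOpenImmersion l ∧
          x ∈ Set.range l ∧ l ≫ k ≫ g = Spec.map φ ∧ a ∈ I ∧
          φ.hom a ∈ nonZeroDivisors S ∧ I.map φ.hom = Ideal.span {φ.hom a} := by
      have := hg.comap_of_isOpenImmersion k
      rw [← Scheme.IdealSheafData.comap_comp, ← Ideal.span_eq I] at this
      obtain ⟨S, l, φ, a, h1, h2, -, h3, h4, h5, h6⟩ :=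
        exists_chart_generator (I : Set R) (k ≫ g) this x ⊤ trivial
      exact ⟨S, l, φ, a, h1, h2, h3, h4, h5, by rwa [Ideal.span_eq] at h6⟩
    apply existsUnique_lift_of_local
    · intro x
      obtain ⟨S, k, φ, a, hk, hx, hkg, ha, h1, h2⟩ := key T (𝟙 T) x
      obtain ⟨ψ, hψ⟩ := exists_reesAway_lift ha φ.hom h1 h2.le
      refine ⟨_, k, hk, hx, Spec.map (CommRingCat.ofHom ψ) ≫ blowUpSpecChart ha, ?_⟩
      rw [Category.id_comp] at hkg
      rw [Category.assoc, blowUpSpecChart_π, ← Spec.map_comp, hkg, ← CommRingCat.ofHom_comp, hψ]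
      rfl
    · intro V k h₁ h₂ hk e₁ e₂
      apply hom_ext_of_charts
      intro x
      obtain ⟨S, l, φ, a, hl, hx, hlg, ha, h1, h2⟩ := key V k x
      refine ⟨_, l, hl, hx, ?_⟩
      have aux (h : V ⟶ blowUpSpec I) (e : h ≫ blowUpSpecπ I = k ≫ g) :
          ∃ ψ : ReesAway ha →+* S, ψ.comp (toReesAway ha) = φ.hom ∧
            l ≫ h = Spec.map (CommRingCat.ofHom ψ) ≫ blowUpSpecChart ha := by
        have e' : (l ≫ h) ≫ blowUpSpecπ I = Spec.map φ := by rw [Category.assoc, e, hlg]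
        have hr := range_subset_chart φ ha h1 h2.le _ e'
        let m := IsOpenImmersion.lift (blowUpSpecChart ha) (l ≫ h) hr
        have hm : m ≫ blowUpSpecChart ha = l ≫ h := IsOpenImmersion.lift_fac _ _ _
        refine ⟨(Spec.preimage m).hom, ?_, ?_⟩
        · have : CommRingCat.ofHom (toReesAway ha) ≫ Spec.preimage m = φ := by
            apply Spec.map_injective
            rw [Spec.map_comp, Spec.map_preimage, ← blowUpSpecChart_π, ← Category.assoc, hm, e']
          exact congr_arg CommRingCat.Hom.hom this
        · rw [CommRingCat.ofHom_hom, Spec.map_preimage, hm]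
      obtain ⟨ψ₁, p₁, q₁⟩ := aux h₁ e₁
      obtain ⟨ψ₂, p₂, q₂⟩ := aux h₂ e₂
      rw [q₁, q₂, reesAway_hom_ext ha (ψ₁ := ψ₁) (ψ₂ := ψ₂) ?_ (p₁.trans p₂.symm)]
      exact (congr($p₁ a) : ψ₁ (toReesAway ha a) = φ.hom a) ▸ h1

end BlowUpSpec

end

end BlowUpRes

namespace BlowUpRes

noncomputable section

/-! ### Blow-ups of schemes -/

section BlowUp

variable {X X' U U' : Scheme.{0}}

lemma IsBlowUp.hom_ext {π : X' ⟶ X} {I : X.IdealSheafData} (h : IsBlowUp π I) {T : Scheme.{0}}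
    {f g : T ⟶ X'} (hf : IsInvertible (I.comap (f ≫ π))) (e : f ≫ π = g ≫ π) : f = g :=
  (h.universal T (f ≫ π) hf).unique rfl e.symm

lemma IsBlowUp.exists_iso {X'' : Scheme.{0}} {π : X' ⟶ X} {π₂ : X'' ⟶ X} {I : X.IdealSheafData}
    (h : IsBlowUp π I) (h₂ : IsBlowUp π₂ I) : ∃ e : X' ≅ X'', e.hom ≫ π₂ = π := by
  obtain ⟨f, hf, -⟩ := h₂.universal _ π h.invertible
  obtain ⟨g, hg, -⟩ := h.universal _ π₂ h₂.invertible
  have e₁ : f ≫ g = 𝟙 X' := h.hom_ext (by rw [Category.assoc, hg, hf]; exact h.invertible)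
    (by rw [Category.assoc, hg, hf, Category.id_comp])
  have e₂ : g ≫ f = 𝟙 X'' := h₂.hom_ext (by rw [Category.assoc, hf, hg]; exact h₂.invertible)
    (by rw [Category.assoc, hf, hg, Category.id_comp])
  exact ⟨⟨f, g, e₁, e₂⟩, hf⟩

lemma isBlowUp_id {I : X.IdealSheafData} (hI : IsInvertible I) : IsBlowUp (𝟙 X) I where
  invertible := by rwa [Scheme.IdealSheafData.comap_id]
  universal T g _ := ⟨g, Category.comp_id _, fun h hh => by rw [← hh, Category.comp_id]⟩

lemma IsBlowUp.isIso {π : X' ⟶ X} {I : X.IdealSheafData} (h : IsBlowUp π I)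
    (hI : IsInvertible I) : IsIso π := by
  obtain ⟨e, he⟩ := h.exists_iso (isBlowUp_id hI)
  rw [← he, Category.comp_id]
  infer_instance

/-- Invertible ideals stay invertible under open immersions, so existence and uniqueness of lifts
over U reduce to those over X. -/
lemma IsBlowUp.of_isPullback {π : X' ⟶ X} {I : X.IdealSheafData} (h : IsBlowUp π I)
    {i' : U' ⟶ X'} {π' : U' ⟶ U} {i : U ⟶ X} [IsOpenImmersion i] (H : IsPullback i' π' π i) :
    IsBlowUp π' (I.comap i) where
  invertible := by
    have : IsOpenImmersion i' := MorphismProperty.of_isPullback H.flip ‹_›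
    rw [← Scheme.IdealSheafData.comap_comp, ← H.w, Scheme.IdealSheafData.comap_comp]
    exact h.invertible.comap_of_isOpenImmersion i'
  universal T g hg := by
    rw [← Scheme.IdealSheafData.comap_comp] at hg
    obtain ⟨k, hk, -⟩ := h.universal T (g ≫ i) hg
    refine ⟨H.lift k g hk, H.lift_snd _ _ _, fun k' hk' => ?_⟩
    apply H.hom_ext
    · rw [H.lift_fst]
      refine h.hom_ext ?_ ?_
      · rwa [Category.assoc, H.w, reassoc_of% hk']
      · rw [Category.assoc, H.w, reassoc_of% hk', hk]
    · rw [H.lift_snd, hk']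

/-- Being a blow-up can be checked locally on the target. -/
lemma isBlowUp_of_local {π : X' ⟶ X} {I : X.IdealSheafData}
    (h : ∀ x : X, ∃ (U U' : Scheme.{0}) (i' : U' ⟶ X') (π' : U' ⟶ U) (i : U ⟶ X),
      IsOpenImmersion i ∧ x ∈ Set.range i ∧ IsPullback i' π' π i ∧ IsBlowUp π' (I.comap i)) :
    IsBlowUp π I where
  invertible := by
    apply isInvertible_of_openCover
    intro x'
    obtain ⟨U, U', i', π', i, hi, ⟨u, hu⟩, H, hB⟩ := h (π x')
    have : IsOpenImmersion i' := MorphismProperty.of_isPullback H.flip ‹_›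
    refine ⟨U', i', this, ?_, ?_⟩
    · obtain ⟨z, hz, -⟩ := Scheme.exists_preimage_of_isPullback H x' u hu.symm
      exact ⟨z, hz⟩
    · rw [← Scheme.IdealSheafData.comap_comp, H.w, Scheme.IdealSheafData.comap_comp]
      exact hB.invertible
  universal T g hg := by
    apply existsUnique_lift_of_local
    · intro x
      obtain ⟨U, U', i', π', i, hi, ⟨u, hu⟩, H, hB⟩ := h (g x)
      refine ⟨_, Limits.pullback.fst g i, inferInstance, ?_, ?_⟩
      · obtain ⟨z, hz, -⟩ := Scheme.exists_preimage_of_isPullback (.of_hasPullback g i) x u hu.symm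
        exact ⟨z, hz⟩
      · obtain ⟨k, hk, -⟩ := hB.universal _ (Limits.pullback.snd g i) (by
          rw [← Scheme.IdealSheafData.comap_comp, ← Limits.pullback.condition,
            Scheme.IdealSheafData.comap_comp]
          exact hg.comap_of_isOpenImmersion _)
        exact ⟨k ≫ i', by rw [Category.assoc, H.w, reassoc_of% hk, Limits.pullback.condition]⟩
    · intro V j h₁ h₂ hj e₁ e₂
      apply hom_ext_of_charts
      intro v
      obtain ⟨U, U', i', π', i, hi, ⟨u, hu⟩, H, hB⟩ := h ((j ≫ g) v)
      refine ⟨_, Limits.pullback.fst (j ≫ g) i, inferInstance, ?_, ?_⟩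
      · obtain ⟨z, hz, -⟩ :=
          Scheme.exists_preimage_of_isPullback (.of_hasPullback (j ≫ g) i) v u hu.symm
        exact ⟨z, hz⟩
      · have w : Limits.pullback.fst (j ≫ g) i ≫ j ≫ g = Limits.pullback.snd (j ≫ g) i ≫ i :=
          Limits.pullback.condition
        have aux (k : V ⟶ X') (e : k ≫ π = j ≫ g) :
            ∃ m, m ≫ i' = Limits.pullback.fst (j ≫ g) i ≫ k ∧
              m ≫ π' = Limits.pullback.snd (j ≫ g) i :=
          ⟨H.lift (Limits.pullback.fst (j ≫ g) i ≫ k) (Limits.pullback.snd (j ≫ g) i)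
            (by rw [Category.assoc, e, w]), H.lift_fst _ _ _, H.lift_snd _ _ _⟩
        obtain ⟨m₁, p₁, q₁⟩ := aux h₁ e₁
        obtain ⟨m₂, p₂, q₂⟩ := aux h₂ e₂
        rw [← p₁, ← p₂, hB.hom_ext (f := m₁) (g := m₂) ?_ (by rw [q₁, q₂])]
        rw [q₁, ← Scheme.IdealSheafData.comap_comp, ← w, Scheme.IdealSheafData.comap_comp,
          Scheme.IdealSheafData.comap_comp]
        exact (hg.comap_of_isOpenImmersion j).comap_of_isOpenImmersion _

lemma exists_isBlowUp_of_isAffine (X : Scheme.{0}) [IsAffine X] (I : X.IdealSheafData) :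
    ∃ (X' : Scheme.{0}) (π : X' ⟶ X), IsBlowUp π I := by
  obtain ⟨a, ha⟩ := exists_eq_specIdeal (I.comap X.isoSpec.inv)
  have H : IsPullback (𝟙 (blowUpSpec a)) (blowUpSpecπ a ≫ X.isoSpec.inv) (blowUpSpecπ a)
      X.isoSpec.hom := IsPullback.of_horiz_isIso_mono ⟨by simp⟩
  refine ⟨_, blowUpSpecπ a ≫ X.isoSpec.inv, ?_⟩
  have := isBlowUp_blowUpSpec.of_isPullback H
  rwa [← ha, ← Scheme.IdealSheafData.comap_comp, Iso.hom_inv_id,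
    Scheme.IdealSheafData.comap_id] at this

/-- The fibre product is also a blow-up of U, hence canonically isomorphic to U'. This is the
cartesian condition needed to glue the blow-ups of affine open subsets. -/
lemma IsBlowUp.isPullback_of_comp {V V' : Scheme.{0}} {p : V' ⟶ V} {I : V.IdealSheafData}
    (h : IsBlowUp p I) {q : U' ⟶ U} {i : U ⟶ V} [IsOpenImmersion i]
    (h' : IsBlowUp q (I.comap i)) {k : U' ⟶ V'} (hk : k ≫ p = q ≫ i) : IsPullback k q p i := by
  have hP := h.of_isPullback (IsPullback.of_hasPullback p i)
  obtain ⟨e, he⟩ := h'.exists_iso hP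
  refine .of_iso_pullback ⟨hk⟩ e ?_ he
  refine h.hom_ext ?_ ?_
  · rw [Category.assoc, Limits.pullback.condition, reassoc_of% he,
      Scheme.IdealSheafData.comap_comp]
    exact h'.invertible
  · rw [Category.assoc, Limits.pullback.condition, reassoc_of% he, hk]

section Gluing

lemma isInvertible_comap_comp_homOfLE {Y : Scheme.{0}} (C : Y.IdealSheafData)
    (B : Y.affineOpens → Scheme.{0}) (p : ∀ W : Y.affineOpens, B W ⟶ W.1.toScheme)
    (hp : ∀ W : Y.affineOpens, IsBlowUp (p W) (C.comap W.1.ι)) {W W' : Y.affineOpens}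
    (h : W ≤ W') : IsInvertible ((C.comap W'.1.ι).comap (p W ≫ Y.homOfLE h)) := by
  rw [← Scheme.IdealSheafData.comap_comp, Category.assoc, Scheme.homOfLE_ι,
    Scheme.IdealSheafData.comap_comp]
  exact (hp W).invertible

variable {Y : Scheme.{0}} (C : Y.IdealSheafData) (B : Y.affineOpens → Scheme.{0})
  (p : ∀ W : Y.affineOpens, B W ⟶ W.1.toScheme)
  (hp : ∀ W : Y.affineOpens, IsBlowUp (p W) (C.comap W.1.ι))

/-- The transition map between the blow-ups of two affine open subsets. -/
def blowUpTrans {W W' : Y.affineOpens} (h : W ≤ W') : B W ⟶ B W' :=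
  ((hp W').universal _ (p W ≫ Y.homOfLE h) (isInvertible_comap_comp_homOfLE C B p hp h)).choose

lemma blowUpTrans_comp {W W' : Y.affineOpens} (h : W ≤ W') :
    blowUpTrans C B p hp h ≫ p W' = p W ≫ Y.homOfLE h :=
  ((hp W').universal _ (p W ≫ Y.homOfLE h)
    (isInvertible_comap_comp_homOfLE C B p hp h)).choose_spec.1

lemma blowUpTrans_eq {W W' : Y.affineOpens} (h : W ≤ W') {k : B W ⟶ B W'}
    (hk : k ≫ p W' = p W ≫ Y.homOfLE h) : blowUpTrans C B p hp h = k :=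
  (hp W').hom_ext (by
    rw [blowUpTrans_comp]; exact isInvertible_comap_comp_homOfLE C B p hp h)
    ((blowUpTrans_comp C B p hp h).trans hk.symm)

lemma blowUpTrans_trans {W₁ W₂ W₃ : Y.affineOpens} (h₁ : W₁ ≤ W₂) (h₂ : W₂ ≤ W₃) :
    blowUpTrans C B p hp (h₁.trans h₂) = blowUpTrans C B p hp h₁ ≫ blowUpTrans C B p hp h₂ :=
  blowUpTrans_eq C B p hp _ (by
    rw [Category.assoc, blowUpTrans_comp, ← Category.assoc, blowUpTrans_comp, Category.assoc,
      Scheme.homOfLE_homOfLE])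

/-- The diagram of the blow-ups of the affine open subsets. -/
def blowUpFunctor : Y.directedAffineCover.I₀ ⥤ Scheme.{0} where
  obj W := B W
  map h := blowUpTrans C B p hp (leOfHom h)
  map_id W := blowUpTrans_eq C B p hp _ (by
    rw [Category.id_comp]
    exact ((Category.comp_id _).symm.trans (congr_arg (p W ≫ ·) (Scheme.homOfLE_rfl Y W.1).symm)))
  map_comp h₁ h₂ := blowUpTrans_trans C B p hp (leOfHom h₁) (leOfHom h₂)

/-- The gluing datum of the blow-ups of the affine open subsets. -/
def blowUpGluingData : Scheme.Cover.RelativeGluingData Y.directedAffineCover where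
  functor := blowUpFunctor C B p hp
  natTrans :=
    { app := fun W => p W
      naturality := fun W W' h => blowUpTrans_comp C B p hp (leOfHom h) }
  equifibered W W' h := by
    have h' := hp W
    have e : C.comap W.1.ι = (C.comap W'.1.ι).comap (Y.homOfLE (leOfHom h)) := by
      rw [← Scheme.IdealSheafData.comap_comp, Scheme.homOfLE_ι]
    rw [e] at h'
    exact (hp W').isPullback_of_comp h' (blowUpTrans_comp C B p hp (leOfHom h))

end Gluing

/-- Blow-ups exist. -/
theorem exists_isBlowUp (Y : Scheme.{0}) (C : Y.IdealSheafData) :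
    ∃ (Y' : Scheme.{0}) (ρ : Y' ⟶ Y), IsBlowUp ρ C := by
  have h (W : Y.affineOpens) := 
    haveI : IsAffine W.1.toScheme := W.2
    exists_isBlowUp_of_isAffine W.1.toScheme (C.comap W.1.ι)
  choose B p hp using h
  refine ⟨_, (blowUpGluingData C B p hp).toBase, isBlowUp_of_local fun y => ?_⟩
  obtain ⟨W, hW, hy, -⟩ := exists_isAffineOpen_mem_and_subset (U := (⊤ : Y.Opens)) (x := y) trivial
  refine ⟨_, _, _, _, W.ι, inferInstance, by simpa using hy,
    ((blowUpGluingData C B p hp).isPullback_natTrans_ι_toBase ⟨W, hW⟩).flip, hp ⟨W, hW⟩⟩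

/-! ### Charts of blow-ups -/

/-- A finitely generated ideal has a Rees algebra of finite type over its degree zero part R, so its
Proj is proper over Spec R. -/
lemma isProper_blowUpSpecπ {R : CommRingCat.{0}} {I : Ideal R} (hI : I.FG) :
    IsProper (blowUpSpecπ I) := by
  have : Algebra.FiniteType (reesGrading I 0) (reesAlgebra I) := by
    obtain ⟨s, hs⟩ : (⊤ : Subalgebra R (reesAlgebra I)).FG :=
      (reesAlgebra I).fg_top.mpr (reesAlgebra.fg hI)
    refine ⟨s, eq_top_iff.mpr fun x _ => ?_⟩
    have hx : x ∈ Algebra.adjoin R (s : Set (reesAlgebra I)) := hs ▸ Algebra.mem_top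
    induction hx using Algebra.adjoin_induction with
    | mem x hx => exact Algebra.subset_adjoin hx
    | algebraMap r =>
      have e : algebraMap R (reesAlgebra I) r =
          algebraMap (reesGrading I 0) (reesAlgebra I) (reesZero I r) := rfl
      rw [e]
      exact Subalgebra.algebraMap_mem _ _
    | add x y _ _ hx hy => exact add_mem (hx trivial) (hy trivial)
    | mul x y _ _ hx hy => exact mul_mem (hx trivial) (hy trivial)
  let e : R ≅ CommRingCat.of (reesGrading I 0) := (reesZero I).toCommRingCatIso
  change IsProper (Proj.toSpecZero (reesGrading I) ≫ Spec.map e.hom)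
  infer_instance

/-- The blow-up of a locally finitely generated ideal is proper. -/
lemma IsBlowUp.isProper {ρ : X' ⟶ X} {C : X.IdealSheafData} (hρ : IsBlowUp ρ C)
    (h : ∀ x : X, ∃ (B : CommRingCat.{0}) (j : Spec B ⟶ X) (a : Ideal B), IsOpenImmersion j ∧
      x ∈ Set.range j ∧ a.FG ∧ C.comap j = specIdeal a) : IsProper ρ := by
  choose B j a hj hx ha hC using h
  have key (x : X) : IsProper (Limits.pullback.snd ρ (j x)) := by
    have hP := hρ.of_isPullback (IsPullback.of_hasPullback ρ (j x))
    rw [hC] at hP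
    obtain ⟨e, he⟩ := hP.exists_iso isBlowUp_blowUpSpec
    have := isProper_blowUpSpecπ (ha x)
    rw [← he]
    infer_instance
  exact IsZariskiLocalAtTarget.of_openCover (coverOfCharts _ j hx) key

/-- The charts of a blow-up over a chart of the base. -/
lemma IsBlowUp.exists_chart {ρ : X' ⟶ X} {C : X.IdealSheafData} (hρ : IsBlowUp ρ C)
    {B : CommRingCat.{0}} (j : Spec B ⟶ X) [IsOpenImmersion j] (G : Set B)
    (hC : C.comap j = specIdeal (Ideal.span G)) (x' : X') (hx : ρ x' ∈ Set.range j) :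
    ∃ a ∈ G, ∀ (B' : CommRingCat.{0}) (φ : B ⟶ B'), IsBlowUpAlgebra (Ideal.span G) a φ.hom →
      ∃ k : Spec B' ⟶ X', IsOpenImmersion k ∧ x' ∈ Set.range k ∧ k ≫ ρ = Spec.map φ ≫ j := by
  have hP := hρ.of_isPullback (IsPullback.of_hasPullback ρ j)
  rw [hC] at hP
  obtain ⟨e, he⟩ := isBlowUp_blowUpSpec.exists_iso hP
  obtain ⟨z, hz⟩ := hx
  obtain ⟨q, hq, -⟩ :=
    Scheme.exists_preimage_of_isPullback (IsPullback.of_hasPullback ρ j) x' z hz.symm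
  obtain ⟨a, ha, haG, w, hw⟩ := exists_mem_range_blowUpSpecChart rfl (e.inv q)
  refine ⟨a, haG, fun B' φ hφ => ?_⟩
  -- Any ring with the universal property of R[I/a] can replace the Rees chart; this later allows
  -- explicit coordinate rings.
  obtain ⟨ε, hε⟩ := hφ.exists_equiv (isBlowUpAlgebra_reesAway ha)
  let ι : B' ≅ CommRingCat.of (ReesAway ha) := ε.toCommRingCatIso
  have hι : φ ≫ ι.hom = CommRingCat.ofHom (toReesAway ha) := CommRingCat.hom_ext hε
  refine ⟨Spec.map ι.inv ≫ blowUpSpecChart ha ≫ e.hom ≫ Limits.pullback.fst ρ j,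
    inferInstance, ⟨Spec.map ι.hom w, ?_⟩, ?_⟩
  · rw [← Scheme.Hom.comp_apply, ← Category.assoc, ← Spec.map_comp, Iso.inv_hom_id, Spec.map_id,
      Category.id_comp, Scheme.Hom.comp_apply, hw, ← Scheme.Hom.comp_apply, Iso.inv_hom_id_assoc]
    exact hq
  · simp only [Category.assoc]
    rw [Limits.pullback.condition, reassoc_of% he, ← Category.assoc (blowUpSpecChart ha),
      blowUpSpecChart_π, ← hι, ← Category.assoc, ← Spec.map_comp, Category.assoc, Iso.hom_inv_id,
      Category.comp_id]

/-- Over an open subset on which the centre is invertible, a blow-up is an isomorphism. -/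
lemma IsBlowUp.exists_lift {ρ : X' ⟶ X} {C : X.IdealSheafData} (hρ : IsBlowUp ρ C)
    (j : U ⟶ X) [IsOpenImmersion j] (hC : IsInvertible (C.comap j)) :
    ∃ k : U ⟶ X', IsOpenImmersion k ∧ k ≫ ρ = j ∧ ∀ x', ρ x' ∈ Set.range j → x' ∈ Set.range k := by
  have hP := hρ.of_isPullback (IsPullback.of_hasPullback ρ j)
  have := hP.isIso hC
  refine ⟨inv (Limits.pullback.snd ρ j) ≫ Limits.pullback.fst ρ j, inferInstance, ?_, ?_⟩
  · rw [Category.assoc, Limits.pullback.condition, IsIso.inv_hom_id_assoc]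
  · rintro x' ⟨z, hz⟩
    obtain ⟨q, hq, -⟩ :=
      Scheme.exists_preimage_of_isPullback (IsPullback.of_hasPullback ρ j) x' z hz.symm
    refine ⟨Limits.pullback.snd ρ j q, ?_⟩
    rw [← Scheme.Hom.comp_apply, IsIso.hom_inv_id_assoc]
    exact hq

lemma comap_complOpen_ι (C : X.IdealSheafData) : C.comap (complOpen C).ι = ⊤ := by
  rw [← Scheme.IdealSheafData.support_eq_bot_iff]
  ext x
  rw [Scheme.IdealSheafData.support_comap]
  have hx : (complOpen C).ι x ∉ C.support := mem_complOpen.mp x.2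
  simpa using hx

lemma IsBlowUp.isIso_restrict {ρ : X' ⟶ X} {C : X.IdealSheafData} (hρ : IsBlowUp ρ C)
    (W : X.Opens) (hW : IsInvertible (C.comap W.ι)) : IsIso (ρ ∣_ W) :=
  (hρ.of_isPullback (isPullback_morphismRestrict ρ W).flip).isIso hW

end BlowUp

end

end BlowUpRes

namespace BlowUpRes

noncomputable section

open MvPolynomial TensorProduct

/-! ### Push-outs of étale ring homomorphisms -/

/-- A push-out square of ring homomorphisms. -/
structure IsRingPushout {P B Q B' : Type} [CommRing P] [CommRing B] [CommRing Q] [CommRing B']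
    (e : P →+* B) (β : P →+* Q) (ρ : B →+* B') (e' : Q →+* B') : Prop where
  w : ρ.comp e = e'.comp β
  exists_desc : ∀ {S : Type} [CommRing S] (φ : B →+* S) (θ : Q →+* S), φ.comp e = θ.comp β →
    ∃ ψ : B' →+* S, ψ.comp ρ = φ ∧ ψ.comp e' = θ
  hom_ext : ∀ {S : Type} [CommRing S] {ψ₁ ψ₂ : B' →+* S}, ψ₁.comp ρ = ψ₂.comp ρ →
    ψ₁.comp e' = ψ₂.comp e' → ψ₁ = ψ₂

/-- The tensor product is a push-out; étaleness and surjectivity are stable under base change. -/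
lemma exists_isRingPushout {P B Q : Type} [CommRing P] [CommRing B] [CommRing Q]
    (e : P →+* B) (β : P →+* Q) :
    ∃ (B' : CommRingCat.{0}) (ρ : B →+* B') (e' : Q →+* B'), IsRingPushout e β ρ e' ∧
      (e.Etale → e'.Etale) ∧ (Function.Surjective β → Function.Surjective ρ) := by
  algebraize [e, β]
  refine ⟨.of (Q ⊗[P] B), (Algebra.TensorProduct.includeRight : B →ₐ[P] Q ⊗[P] B).toRingHom,
    algebraMap Q (Q ⊗[P] B), ⟨?_, ?_, ?_⟩, ?_, ?_⟩
  · exact ((Algebra.TensorProduct.includeRight : B →ₐ[P] Q ⊗[P] B).comp_algebraMap).trans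
      (IsScalarTower.algebraMap_eq P Q (Q ⊗[P] B))
  · intro S _ φ θ h
    algebraize [θ.comp β]
    let θ' : Q →ₐ[P] S := { θ with commutes' := fun _ => rfl }
    let φ' : B →ₐ[P] S := { φ with commutes' := fun x => congr($h x) }
    refine ⟨(Algebra.TensorProduct.lift θ' φ' fun _ _ => .all _ _).toRingHom, ?_, ?_⟩
    · ext x
      change Algebra.TensorProduct.lift θ' φ' (fun _ _ => .all _ _) (1 ⊗ₜ x) = φ x
      rw [Algebra.TensorProduct.lift_tmul, map_one, one_mul]
      rfl
    · ext x
      change Algebra.TensorProduct.lift θ' φ' (fun _ _ => .all _ _) (x ⊗ₜ 1) = θ x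
      rw [Algebra.TensorProduct.lift_tmul, map_one, mul_one]
      rfl
  · intro S _ ψ₁ ψ₂ h₁ h₂
    refine RingHom.ext fun (x : Q ⊗[P] B) => ?_
    induction x using TensorProduct.induction_on with
    | zero => rw [map_zero, map_zero]
    | add x y hx hy => rw [map_add, map_add, hx, hy]
    | tmul x y =>
      have : x ⊗ₜ[P] y = algebraMap Q (Q ⊗[P] B) x *
          (Algebra.TensorProduct.includeRight : B →ₐ[P] Q ⊗[P] B) y := by
        simp [Algebra.TensorProduct.algebraMap_apply]
      rw [this, map_mul, map_mul]
      exact congr_arg₂ _ congr($h₂ x) congr($h₁ y)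
  · intro he
    have : Algebra.Etale P B := he
    exact RingHom.etale_algebraMap.mpr inferInstance
  · intro h
    exact Algebra.TensorProduct.includeRight_surjective (R := P) (S := Q) B h

namespace IsRingPushout

variable {P B Q B' : Type} [CommRing P] [CommRing B] [CommRing Q] [CommRing B']
    {e : P →+* B} {β : P →+* Q} {ρ : B →+* B'} {e' : Q →+* B'}

/-- The base change of P → P/K to B is B/KB: the push-out property gives a map from B' to B/KB
through which the quotient map factors. -/
lemma ker_eq (h : IsRingPushout e β ρ e') (hβ : Function.Surjective β) :
    RingHom.ker ρ = (RingHom.ker β).map e := by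
  apply le_antisymm
  · let J := (RingHom.ker β).map e
    let θ : Q →+* B ⧸ J := (Ideal.Quotient.lift (RingHom.ker β) ((Ideal.Quotient.mk J).comp e)
      fun a ha => Ideal.Quotient.eq_zero_iff_mem.mpr (Ideal.mem_map_of_mem e ha)).comp
        (RingHom.quotientKerEquivOfSurjective hβ).symm.toRingHom
    obtain ⟨ψ, hψ, -⟩ := h.exists_desc (Ideal.Quotient.mk J) θ (by
      ext x
      have : (RingHom.quotientKerEquivOfSurjective hβ).symm (β x) =
          Ideal.Quotient.mk (RingHom.ker β) x := by
        rw [RingEquiv.symm_apply_eq]; rfl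
      simp [θ, this])
    intro x hx
    rw [← Ideal.Quotient.eq_zero_iff_mem, ← hψ, RingHom.comp_apply, hx, map_zero]
  · rw [Ideal.map_le_iff_le_comap]
    intro x hx
    rw [Ideal.mem_comap, RingHom.mem_ker, ← RingHom.comp_apply, h.w, RingHom.comp_apply, hx,
      map_zero]

end IsRingPushout

lemma etale_flat {P B : Type} [CommRing P] [CommRing B] {e : P →+* B} (he : e.Etale) :
    e.Flat := by
  algebraize [e]
  exact inferInstanceAs (Module.Flat P B)

/-- Étale homomorphisms are flat, and flat base change keeps multiplication by x injective. -/
lemma mem_nonZeroDivisors_of_etale {P B : Type} [CommRing P] [IsDomain P] [CommRing B] {e : P →+* B}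
    (he : e.Etale) {x : P} (hx : x ≠ 0) : e x ∈ nonZeroDivisors B := by
  have hf := etale_flat he
  algebraize [e]
  have := Module.Flat.isSMulRegular_of_nonZeroDivisors (M := B) (mem_nonZeroDivisors_of_ne_zero hx)
  rw [mem_nonZeroDivisors_iff_right]
  intro y hy
  apply this
  simp only [smul_zero]
  rw [Algebra.smul_def, mul_comm]
  exact hy

/-- An étale algebra over a domain is reduced. -/
lemma isReduced_of_etale {P B : Type} [CommRing P] [IsDomain P] [CommRing B] {e : P →+* B}
    (he : e.Etale) : IsReduced B := by
  have hf := etale_flat he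
  algebraize [e]
  let K := FractionRing P
  -- By flatness B embeds in its base change to the fraction field of P, an étale algebra over a
  -- field and hence reduced.
  have : Function.Injective (Algebra.TensorProduct.includeRight : B →ₐ[P] K ⊗[P] B) :=
    Algebra.TensorProduct.includeRight_injective (IsFractionRing.injective P K)
  have h : IsReduced (K ⊗[P] B) := Algebra.FormallyUnramified.isReduced_of_field K _
  exact isReduced_of_injective _ this

/-! ### Étale coordinates -/

section Coordinates

variable {n : ℕ} {B : Type} [CommRing B]

/-- Setting the variables `Xᵢ`, `i ∈ A`, equal to zero. -/
def killVars (A : Finset (Fin n)) : MvPolynomial (Fin n) ℂ →+* MvPolynomial {i // i ∉ A} ℂ :=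
  (aeval fun i => if h : i ∈ A then 0 else X ⟨i, h⟩ :
    MvPolynomial (Fin n) ℂ →ₐ[ℂ] MvPolynomial {i // i ∉ A} ℂ).toRingHom

lemma killVars_X_of_mem {A : Finset (Fin n)} {i : Fin n} (h : i ∈ A) : killVars A (X i) = 0 := by
  simp [killVars, h]

lemma killVars_X_of_notMem {A : Finset (Fin n)} {i : Fin n} (h : i ∉ A) :
    killVars A (X i) = X ⟨i, h⟩ := by
  simp [killVars, h]

lemma killVars_C (A : Finset (Fin n)) (c : ℂ) : killVars A (C c) = C c := by
  simp [killVars]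

lemma killVars_rename (A : Finset (Fin n)) (q : MvPolynomial {i // i ∉ A} ℂ) :
    killVars A (rename Subtype.val q) = q := by
  induction q using MvPolynomial.induction_on with
  | C c => rw [rename_C, killVars_C]
  | add p q hp hq => rw [map_add, map_add, hp, hq]
  | mul_X p i hp => rw [map_mul, map_mul, hp, rename_X, killVars_X_of_notMem i.2]

lemma killVars_surjective (A : Finset (Fin n)) : Function.Surjective (killVars A) :=
  fun q => ⟨_, killVars_rename A q⟩

/-- Modulo the variables in A every polynomial is congruent to the one obtained by setting them to
zero. -/
lemma ker_killVars (A : Finset (Fin n)) :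
    RingHom.ker (killVars A) = Ideal.span (X '' (A : Set (Fin n))) := by
  apply le_antisymm
  · have key (q : MvPolynomial (Fin n) ℂ) :
        q - rename Subtype.val (killVars A q) ∈
          Ideal.span (X '' (A : Set (Fin n)) : Set (MvPolynomial (Fin n) ℂ)) := by
      induction q using MvPolynomial.induction_on with
      | C c => simp [killVars_C]
      | add p q hp hq =>
        rw [map_add, map_add, add_sub_add_comm]
        exact add_mem hp hq
      | mul_X p i hp =>
        by_cases hi : i ∈ A
        · rw [map_mul, killVars_X_of_mem hi, mul_zero, map_zero, sub_zero]
          exact Ideal.mul_mem_left _ _ (Ideal.subset_span ⟨i, hi, rfl⟩)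
        · rw [map_mul, killVars_X_of_notMem hi, map_mul, rename_X, ← sub_mul]
          exact Ideal.mul_mem_right _ _ hp
    intro q hq
    have := key q
    rwa [show killVars A q = 0 from hq, map_zero, sub_zero] at this
  · rw [Ideal.span_le]
    rintro _ ⟨i, hi, rfl⟩
    exact killVars_X_of_mem hi

/-- The locus where some of the coordinates vanish has the others as étale coordinates. -/
lemma exists_coord_quotient {e : MvPolynomial (Fin n) ℂ →+* B} (he : e.Etale)
    (A : Finset (Fin n)) :
    ∃ (B' : CommRingCat.{0}) (ρ : B →+* B') (e' : MvPolynomial {i // i ∉ A} ℂ →+* B'),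
      e'.Etale ∧ ρ.comp e = e'.comp (killVars A) ∧ Function.Surjective ρ ∧
      RingHom.ker ρ = Ideal.span ((fun i => e (X i)) '' (A : Set (Fin n))) := by
  obtain ⟨B', ρ, e', h, h1, h2⟩ := exists_isRingPushout e (killVars A)
  refine ⟨B', ρ, e', h1 he, h.w, h2 (killVars_surjective A), ?_⟩
  rw [h.ker_eq (killVars_surjective A), ker_killVars, Ideal.map_span, Set.image_image]

lemma coord_mem_nonZeroDivisors {e : MvPolynomial (Fin n) ℂ →+* B} (he : e.Etale) (i : Fin n) :
    e (X i) ∈ nonZeroDivisors B :=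
  mem_nonZeroDivisors_of_etale he (X_ne_zero i)

/-- Modulo one coordinate the ring is étale over the polynomial ring in the others, where X_b is a
non-zero-divisor. -/
lemma mem_span_of_coord_mul_mem {e : MvPolynomial (Fin n) ℂ →+* B} (he : e.Etale) {a b : Fin n}
    (hab : a ≠ b) {x : B} (hx : e (X b) * x ∈ Ideal.span {e (X a)}) :
    x ∈ Ideal.span {e (X a)} := by
  obtain ⟨B', ρ, e', he', w, -, hker⟩ := exists_coord_quotient he {a}
  rw [Finset.coe_singleton, Set.image_singleton] at hker
  rw [← hker, RingHom.mem_ker] at hx ⊢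
  have hb : b ∉ ({a} : Finset (Fin n)) := by simpa using hab.symm
  have hw : ρ (e (X b)) = e' (X ⟨b, hb⟩) := by
    rw [← killVars_X_of_notMem hb]; exact congr($w (X b))
  rw [map_mul, hw] at hx
  exact (mul_left_mem_nonZeroDivisors_eq_zero_iff
    (mem_nonZeroDivisors_of_etale he' (X_ne_zero _))).mp hx

lemma isRadical_span_coord {e : MvPolynomial (Fin n) ℂ →+* B} (he : e.Etale) (a : Fin n) :
    (Ideal.span {e (X a)}).IsRadical := by
  obtain ⟨B', ρ, e', he', w, -, hker⟩ := exists_coord_quotient he {a}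
  rw [Finset.coe_singleton, Set.image_singleton] at hker
  have := isReduced_of_etale he'
  rw [← hker]
  intro x hx
  obtain ⟨k, hk⟩ := hx
  rw [RingHom.mem_ker, map_pow] at hk
  exact eq_zero_of_pow_eq_zero hk

/-- Distinct coordinates are non-zero-divisors modulo each other, so after removing the factor
e(X_a) the cofactor is still divisible by the remaining coordinates. -/
lemma mem_span_prod_coord {e : MvPolynomial (Fin n) ℂ →+* B} (he : e.Etale) (A : Finset (Fin n))
    {x : B} (hx : ∀ i ∈ A, x ∈ Ideal.span {e (X i)}) : x ∈ Ideal.span {∏ i ∈ A, e (X i)} := by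
  induction A using Finset.induction_on generalizing x with
  | empty => simp
  | insert a A ha ih =>
    obtain ⟨y, rfl⟩ := Ideal.mem_span_singleton.mp (hx a (Finset.mem_insert_self _ _))
    have hy : y ∈ Ideal.span {∏ i ∈ A, e (X i)} := ih fun i hi =>
      mem_span_of_coord_mul_mem he (ne_of_mem_of_not_mem hi ha) (hx i (Finset.mem_insert_of_mem hi))
    rw [Finset.prod_insert ha, Ideal.mem_span_singleton]
    exact mul_dvd_mul_left _ (Ideal.mem_span_singleton.mp hy)

lemma isRadical_span_prod_coord {e : MvPolynomial (Fin n) ℂ →+* B} (he : e.Etale)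
    (A : Finset (Fin n)) : (Ideal.span {∏ i ∈ A, e (X i)}).IsRadical := by
  intro x hx
  refine mem_span_prod_coord he A fun i hi => isRadical_span_coord he i ?_
  refine Ideal.radical_mono ?_ hx
  rw [Ideal.span_singleton_le_span_singleton]
  exact Finset.dvd_prod_of_mem _ hi

end Coordinates

/-- When t is a non-zero-divisor modulo w, saturation removes exactly the factor t^N. This reads off
a strict transform from the total transform. -/
lemma saturation_pow_mul {B : Type} [CommRing B] {t w : B}
    (hw : ∀ x, t * x ∈ Ideal.span {w} → x ∈ Ideal.span {w}) (N : ℕ) :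
    saturation t (Ideal.span {t ^ N * w}) = Ideal.span {w} := by
  have hw' (k : ℕ) (x : B) (h : t ^ k * x ∈ Ideal.span {w}) : x ∈ Ideal.span {w} := by
    induction k with
    | zero => simpa using h
    | succ k ih => exact ih (hw _ (by rwa [← mul_assoc, ← pow_succ']))
  ext x
  rw [mem_saturation]
  constructor
  · rintro ⟨k, hk⟩
    exact hw' k x (Ideal.span_singleton_le_span_singleton.mpr (Dvd.intro_left _ rfl) hk)
  · intro hx
    obtain ⟨y, rfl⟩ := Ideal.mem_span_singleton.mp hx
    exact ⟨N, Ideal.mem_span_singleton.mpr ⟨y, by ring⟩⟩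

lemma saturation_eq_top {B : Type} [CommRing B] {t : B} {c : Ideal B} {k : ℕ} (h : t ^ k ∈ c) :
    saturation t c = ⊤ :=
  (Ideal.eq_top_iff_one _).mpr (mem_saturation.mpr ⟨k, by rwa [mul_one]⟩)

/-! ### Blow-ups of coordinate subspaces -/

section LinearBlowUp

variable {n : ℕ}

/-- The chart `Xⱼ ↦ X_k Xⱼ` (`j ∈ T`, `j ≠ k`) of the blow-up of the linear subspace `X_T = 0`. -/
def linBlowUp (T : Finset (Fin n)) (k : Fin n) :
    MvPolynomial (Fin n) ℂ →ₐ[ℂ] MvPolynomial (Fin n) ℂ :=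
  aeval fun j => if j ∈ T ∧ j ≠ k then X k * X j else X j

lemma linBlowUp_X_of_mem {T : Finset (Fin n)} {k j : Fin n} (hj : j ∈ T) (hjk : j ≠ k) :
    linBlowUp T k (X j) = X k * X j := by
  simp [linBlowUp, hj, hjk]

lemma linBlowUp_X_self (T : Finset (Fin n)) (k : Fin n) : linBlowUp T k (X k) = X k := by
  simp [linBlowUp]

lemma linBlowUp_X_of_notMem {T : Finset (Fin n)} {k j : Fin n} (hj : j ∉ T) :
    linBlowUp T k (X j) = X j := by
  simp [linBlowUp, hj]

/-- The charts of the blow-up of a coordinate subspace. -/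
lemma isBlowUpAlgebra_of_isRingPushout {B B' : Type} [CommRing B] [CommRing B']
    {e : MvPolynomial (Fin n) ℂ →+* B} {e' : MvPolynomial (Fin n) ℂ →+* B'} {ρ : B →+* B'}
    {T : Finset (Fin n)} {k : Fin n} (hk : k ∈ T)
    (h : IsRingPushout e
      (linBlowUp T k : MvPolynomial (Fin n) ℂ →+* MvPolynomial (Fin n) ℂ) ρ e')
    (he' : e'.Etale) :
    IsBlowUpAlgebra (Ideal.span ((fun i => e (X i)) '' (T : Set (Fin n)))) (e (X k)) ρ := by
  have w (p : MvPolynomial (Fin n) ℂ) : ρ (e p) = e' (linBlowUp T k p) := congr($h.w p)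
  have wk : ρ (e (X k)) = e' (X k) := by rw [w, linBlowUp_X_self]
  refine ⟨?_, ?_, ?_, ?_, ?_⟩
  · exact Ideal.subset_span ⟨k, hk, rfl⟩
  · rw [wk]
    exact coord_mem_nonZeroDivisors he' k
  · rw [Ideal.map_span, Ideal.span_le]
    rintro _ ⟨_, ⟨i, hi, rfl⟩, rfl⟩
    rw [SetLike.mem_coe, Ideal.mem_span_singleton]
    by_cases hik : i = k
    · rw [hik]
    · simp only [wk, w, linBlowUp_X_of_mem hi hik, map_mul]
      exact dvd_mul_right _ _
  · intro S _ φ hφ hI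
    have hc (i : Fin n) : ∃ c, i ∈ T → φ (e (X i)) = φ (e (X k)) * c := by
      by_cases hi : i ∈ T
      · obtain ⟨c, hc⟩ := Ideal.mem_span_singleton.mp
          (hI (Ideal.mem_map_of_mem φ (Ideal.subset_span ⟨i, hi, rfl⟩)))
        exact ⟨c, fun _ => hc⟩
      · exact ⟨0, fun h => absurd h hi⟩
    choose c hc using hc
    -- With φ(x_i) = φ(x_k) c_i, the new coordinate X_i must go to c_i for i ∈ T other than k; these
    -- values are compatible with the substitution.
    obtain ⟨ψ, hψ, -⟩ := h.exists_desc φ (eval₂Hom ((φ.comp e).comp C)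
      fun i => if i ∈ T ∧ i ≠ k then c i else φ (e (X i))) (by
        apply MvPolynomial.ringHom_ext
        · intro r
          simp
        · intro i
          by_cases hi : i ∈ T ∧ i ≠ k
          · simp [linBlowUp_X_of_mem hi.1 hi.2, hi, hc i hi.1]
          · simp [linBlowUp, hi])
    exact ⟨ψ, hψ⟩
  · intro S _ ψ₁ ψ₂ h₁ h₂
    have e₂ (x : B) : ψ₁ (ρ x) = ψ₂ (ρ x) := congr($h₂ x)
    refine h.hom_ext h₂ (MvPolynomial.ringHom_ext ?_ ?_)
    · intro r
      have := e₂ (e (C r))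
      rw [w, ← algebraMap_eq, AlgHom.commutes] at this
      exact this
    · intro i
      -- For such i only X_k X_i comes from B, so the values on X_i agree after cancelling the
      -- non-zero-divisor image of X_k.
      by_cases hi : i ∈ T ∧ i ≠ k
      · have := e₂ (e (X i))
        rw [w, linBlowUp_X_of_mem hi.1 hi.2, map_mul, map_mul, map_mul, ← wk, ← e₂] at this
        exact (mul_cancel_left_mem_nonZeroDivisors h₁).mp this
      · have := e₂ (e (X i))
        rw [w] at this
        simpa [linBlowUp, hi] using this

/-- The charts of the blow-up of a coordinate subspace have étale coordinates. -/
lemma exists_linBlowUp {B : Type} [CommRing B] {e : MvPolynomial (Fin n) ℂ →+* B} (he : e.Etale)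
    (T : Finset (Fin n)) (k : Fin n) (hk : k ∈ T) :
    ∃ (B' : CommRingCat.{0}) (ρ : B →+* B') (e' : MvPolynomial (Fin n) ℂ →+* B'), e'.Etale ∧
      ρ.comp e = e'.comp (linBlowUp T k : MvPolynomial (Fin n) ℂ →+* MvPolynomial (Fin n) ℂ) ∧
      IsBlowUpAlgebra (Ideal.span ((fun i => e (X i)) '' (T : Set (Fin n)))) (e (X k)) ρ := by
  obtain ⟨B', ρ, e', h, het, -⟩ := exists_isRingPushout e
    (linBlowUp T k : MvPolynomial (Fin n) ℂ →+* MvPolynomial (Fin n) ℂ)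
  exact ⟨B', ρ, e', het he, h.w, isBlowUpAlgebra_of_isRingPushout hk h (het he)⟩

lemma isBlowUpAlgebra_linBlowUp (T : Finset (Fin n)) (k : Fin n) (hk : k ∈ T) :
    IsBlowUpAlgebra (Ideal.span ((X : Fin n → MvPolynomial (Fin n) ℂ) '' (T : Set (Fin n)))) (X k)
      (linBlowUp T k : MvPolynomial (Fin n) ℂ →+* MvPolynomial (Fin n) ℂ) := by
  refine isBlowUpAlgebra_of_isRingPushout (e := RingHom.id _) (e' := RingHom.id _) hk ⟨?_, ?_, ?_⟩
    (RingHom.Etale.of_bijective Function.bijective_id)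
  · rfl
  · intro S _ u v h
    exact ⟨v, by rw [← h]; rfl, rfl⟩
  · intro S _ u v _ h
    exact h

end LinearBlowUp

end

end BlowUpRes

namespace BlowUpRes

noncomputable section

open MvPolynomial

/-! ### First order Taylor expansion and the Jacobian criterion -/

/-- Taylor's formula modulo a square-zero ideal. -/
lemma taylor_of_sq_zero {κ S : Type*} [Fintype κ] [CommRing S] (α α' : MvPolynomial κ ℂ →+* S)
    (hC : ∀ c, α' (C c) = α (C c)) (J : Ideal S) (hJ : J ^ 2 = ⊥)
    (hb : ∀ k, α' (X k) - α (X k) ∈ J) (p : MvPolynomial κ ℂ) :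
    α' p = α p + ∑ k, α (pderiv k p) * (α' (X k) - α (X k)) := by
  classical
  have hmul {x y : S} (hx : x ∈ J) (hy : y ∈ J) : x * y = 0 := by
    have : x * y ∈ J ^ 2 := by rw [sq]; exact Ideal.mul_mem_mul hx hy
    rwa [hJ] at this
  induction p using MvPolynomial.induction_on with
  | C c => simp [hC]
  | add p q hp hq =>
    simp only [map_add, add_mul, Finset.sum_add_distrib]
    linear_combination hp + hq
  | mul_X p i hp =>
    have hs : ∑ k, α (pderiv k p) * (α' (X k) - α (X k)) ∈ J :=
      Ideal.sum_mem _ fun k _ => Ideal.mul_mem_left _ _ (hb k)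
    have h2 : ∑ k, α (pderiv k (p * X i)) * (α' (X k) - α (X k)) =
        α (X i) * ∑ k, α (pderiv k p) * (α' (X k) - α (X k)) +
          α p * (α' (X i) - α (X i)) := by
      simp only [Derivation.leibniz, pderiv_X, smul_eq_mul, map_add, map_mul, add_mul,
        Finset.sum_add_distrib]
      rw [add_comm, Finset.mul_sum]
      congr 1
      · exact Finset.sum_congr rfl fun k _ => by ring
      · rw [Finset.sum_eq_single i]
        · simp
        · intro k _ hk
          simp [Pi.single_eq_of_ne hk.symm]
        · simp
    rw [map_mul, map_mul, h2, hp]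
    -- The error term is a product of two increments in J, hence zero.
    linear_combination hmul hs (hb i)

/-- The Jacobian criterion: polynomials with invertible Jacobian matrix are étale coordinates. -/
lemma etale_of_jacobian {ι κ : Type} [Fintype ι] [Fintype κ] [DecidableEq ι] [DecidableEq κ]
    (Δ : MvPolynomial κ ℂ) (φ : ι → MvPolynomial κ ℂ)
    (N : Matrix κ ι (Localization.Away Δ))
    (hN₁ : N * (Matrix.of fun i k => algebraMap _ (Localization.Away Δ) (pderiv k (φ i))) = 1)
    (hN₂ : (Matrix.of fun i k => algebraMap _ (Localization.Away Δ) (pderiv k (φ i))) * N = 1)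
    (e : MvPolynomial ι ℂ →+* Localization.Away Δ)
    (heX : ∀ i, e (X i) = algebraMap _ _ (φ i)) 
    (heC : ∀ c, e (C c) = algebraMap (MvPolynomial κ ℂ) _ (C c)) :
    e.Etale := by
  let L := Localization.Away Δ
  let loc : MvPolynomial κ ℂ →+* L := algebraMap _ L
  have hloc {S : Type} [CommRing S] {f g : L →+* S} (h : f.comp loc = g.comp loc) : f = g :=
    IsLocalization.ringHom_ext (.powers Δ) h
  algebraize [e]
  have hfe : Algebra.FormallyEtale (MvPolynomial ι ℂ) L := by
    rw [Algebra.FormallyEtale.iff_comp_bijective]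
    intro B _ _ I hI
    constructor
    -- Uniqueness: by Taylor's formula the difference of two lifts, as a vector of values on the
    -- variables, is killed by the Jacobian matrix, which has the left inverse N.
    · intro f g hfg
      have hfgI (x : L) : g x - f x ∈ I := by
        rw [← Ideal.Quotient.eq]
        exact congr($hfg x).symm
      have hC (c : ℂ) : g (loc (C c)) = f (loc (C c)) := by
        have : loc (C c) = algebraMap (MvPolynomial ι ℂ) L (C c) := (heC c).symm
        rw [this, f.commutes, g.commutes]
      have ht (p : MvPolynomial κ ℂ) := taylor_of_sq_zero (f.toRingHom.comp loc)
        (g.toRingHom.comp loc) hC I hI (fun k => hfgI _) p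
      have h0 (i : ι) : ∑ k, f (loc (pderiv k (φ i))) * (g (loc (X k)) - f (loc (X k))) = 0 := by
        have h1 := ht (φ i)
        have h2 : g (loc (φ i)) = f (loc (φ i)) := by
          have : loc (φ i) = algebraMap (MvPolynomial ι ℂ) L (X i) := (heX i).symm
          rw [this, f.commutes, g.commutes]
        simp only [RingHom.comp_apply, AlgHom.toRingHom_eq_coe, RingHom.coe_coe] at h1
        linear_combination h2 - h1
      have hk (k : κ) : g (loc (X k)) = f (loc (X k)) := by
        have h1 (k' : κ) : ∑ i, f (N k i) * f (loc (pderiv k' (φ i))) = if k = k' then 1 else 0 := by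
          have := congr(f ($hN₁ k k'))
          rw [Matrix.mul_apply, map_sum, Matrix.one_apply] at this
          simp only [map_mul, Matrix.of_apply] at this
          rw [apply_ite f, map_one, map_zero] at this
          exact this
        have h2 : ∑ i, f (N k i) *
            ∑ k', f (loc (pderiv k' (φ i))) * (g (loc (X k')) - f (loc (X k'))) = 0 :=
          Finset.sum_eq_zero fun i _ => by rw [h0, mul_zero]
        simp only [Finset.mul_sum, ← mul_assoc] at h2
        rw [Finset.sum_comm] at h2
        simp only [← Finset.sum_mul, h1] at h2
        simp only [ite_mul, one_mul, zero_mul, Finset.sum_ite_eq, Finset.mem_univ, if_true] at h2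
        exact sub_eq_zero.mp h2
      have : f.toRingHom = g.toRingHom := hloc (MvPolynomial.ringHom_ext (fun c => (hC c).symm)
        (fun k => (hk k).symm))
      exact AlgHom.ext fun x => congr($this x)
    -- Existence is one Newton step: lift the variables arbitrarily to y and correct the lift once;
    -- modulo I² = 0 this is exact.
    · intro f
      have hnil : IsNilpotent I := ⟨2, hI⟩
      choose y hy using fun k => Ideal.Quotient.mk_surjective (I := I) (f (loc (X k)))
      let γ : ℂ →+* B := (algebraMap (MvPolynomial ι ℂ) B).comp C
      have hγ (c : ℂ) : Ideal.Quotient.mk I (γ c) = f (loc (C c)) := by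
        have : loc (C c) = algebraMap (MvPolynomial ι ℂ) L (C c) := (heC c).symm
        rw [this, f.commutes]
        rfl
      have ext_loc (z : κ → B) (hz : ∀ k, Ideal.Quotient.mk I (z k) = f (loc (X k))) :
          ∃ F : L →+* B, F.comp loc = eval₂Hom γ z ∧ (Ideal.Quotient.mk I).comp F = f := by
        have h1 : (Ideal.Quotient.mk I).comp (eval₂Hom γ z) = f.toRingHom.comp loc :=
          MvPolynomial.ringHom_ext (fun c => by simpa using hγ c) (fun k => by simpa using hz k)
        have h2 : IsUnit (eval₂Hom γ z Δ) := by
          rw [← hnil.isUnit_quotient_mk_iff]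
          have h3 : Ideal.Quotient.mk I (eval₂Hom γ z Δ) = f (loc Δ) := congr($h1 Δ)
          rw [h3]
          exact (IsLocalization.Away.algebraMap_isUnit (S := L) Δ).map f
        refine ⟨IsLocalization.Away.lift Δ h2, IsLocalization.Away.lift_comp Δ h2, hloc ?_⟩
        rw [RingHom.comp_assoc, IsLocalization.Away.lift_comp Δ h2, h1]
        rfl
      obtain ⟨F, hF, hFf⟩ := ext_loc y hy
      let r (i : ι) : B := algebraMap (MvPolynomial ι ℂ) B (X i) - F (loc (φ i))
      have hr (i : ι) : r i ∈ I := by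
        have h1 : Ideal.Quotient.mk I (F (loc (φ i))) = f (loc (φ i)) := congr($hFf (loc (φ i)))
        have h2 : loc (φ i) = algebraMap (MvPolynomial ι ℂ) L (X i) := (heX i).symm
        rw [← Ideal.Quotient.eq_zero_iff_mem, map_sub, h1, h2, f.commutes]
        exact sub_self _
      -- Here r is the error of the first lift. Since N is a right inverse of the Jacobian matrix,
      -- moving y by b = N r changes the values of the φ_i by exactly r.
      let b (k : κ) : B := ∑ i, F (N k i) * r i
      have hb (k : κ) : b k ∈ I := Ideal.sum_mem _ fun i _ => Ideal.mul_mem_left _ _ (hr i)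
      obtain ⟨G, hG, hGf⟩ := ext_loc (fun k => y k + b k) (fun k => by
        rw [map_add, Ideal.Quotient.eq_zero_iff_mem.mpr (hb k), add_zero, hy])
      have hFX (k : κ) : F (loc (X k)) = y k := by simpa using congr($hF (X k))
      have hGX (k : κ) : G (loc (X k)) = y k + b k := by simpa using congr($hG (X k))
      have hFC (c : ℂ) : F (loc (C c)) = γ c := by simpa using congr($hF (C c))
      have hGC (c : ℂ) : G (loc (C c)) = γ c := by simpa using congr($hG (C c))
      have hGφ (i : ι) : G (loc (φ i)) = algebraMap (MvPolynomial ι ℂ) B (X i) := by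
        have ht := taylor_of_sq_zero (F.comp loc) (G.comp loc)
          (fun c => by simp only [RingHom.comp_apply, hFC, hGC]) I hI
          (fun k => by simp only [RingHom.comp_apply, hFX, hGX, add_sub_cancel_left, hb]) (φ i)
        simp only [RingHom.comp_apply, hFX, hGX, add_sub_cancel_left] at ht
        have h1 (i' : ι) : ∑ k, F (loc (pderiv k (φ i))) * F (N k i') = if i = i' then 1 else 0 := by
          have := congr(F ($hN₂ i i'))
          rw [Matrix.mul_apply, map_sum, Matrix.one_apply] at this
          simp only [map_mul, Matrix.of_apply] at this
          rw [apply_ite F, map_one, map_zero] at this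
          exact this
        have h2 : ∑ k, F (loc (pderiv k (φ i))) * b k = r i := by
          simp only [b, Finset.mul_sum, ← mul_assoc]
          rw [Finset.sum_comm]
          simp only [← Finset.sum_mul, h1]
          simp
        rw [ht, h2]
        simp only [r]
        ring
      have hcomm : G.comp (algebraMap (MvPolynomial ι ℂ) L) = algebraMap (MvPolynomial ι ℂ) B := by
        apply MvPolynomial.ringHom_ext
        · intro c
          have : algebraMap (MvPolynomial ι ℂ) L (C c) = loc (C c) := heC c
          rw [RingHom.comp_apply, this, hGC]
          rfl
        · intro i
          have : algebraMap (MvPolynomial ι ℂ) L (X i) = loc (φ i) := heX i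
          rw [RingHom.comp_apply, this, hGφ]
      refine ⟨{ G with commutes' := fun x => congr($hcomm x) }, ?_⟩
      exact AlgHom.ext fun x => congr($hGf x)
  -- L is finitely presented over ℂ, hence also over the intermediate polynomial ring.
  have hfp : Algebra.FinitePresentation (MvPolynomial ι ℂ) L := by
    have : IsScalarTower ℂ (MvPolynomial ι ℂ) L := .of_algebraMap_eq fun c => by
      have h1 : algebraMap (MvPolynomial ι ℂ) L (C c) = loc (C c) := heC c
      rw [MvPolynomial.algebraMap_eq, h1, IsScalarTower.algebraMap_apply ℂ (MvPolynomial κ ℂ) L]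
      rfl
    have : Algebra.FinitePresentation ℂ L :=
      have := IsLocalization.Away.finitePresentation (S := L) Δ
      .trans ℂ (MvPolynomial κ ℂ) L
    exact .of_restrict_scalars_finitePresentation ℂ (MvPolynomial ι ℂ) L
  exact ⟨hfe, hfp⟩

section Gradient

variable {n : ℕ}

/-- The gradient of a polynomial at a point. -/
def gradAt (a : Fin n → ℂ) (p : MvPolynomial (Fin n) ℂ) : Fin n → ℂ :=
  fun k => eval a (pderiv k p)

/-- Polynomials with linearly independent gradients at a point are part of a system of étale
coordinates near the point. -/
lemma exists_etale_coords {ι : Type} [Finite ι] (h : ι → MvPolynomial (Fin n) ℂ) (a : Fin n → ℂ)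
    (hli : LinearIndependent ℂ fun i => gradAt a (h i)) (u : MvPolynomial (Fin n) ℂ)
    (hu : eval a u ≠ 0) :
    ∃ (Δ : MvPolynomial (Fin n) ℂ) (e : MvPolynomial (Fin n) ℂ →+* Localization.Away Δ)
      (σ : ι → Fin n), eval a Δ ≠ 0 ∧ e.Etale ∧ Function.Injective σ ∧
      (∀ i, e (X (σ i)) = algebraMap _ _ (h i)) ∧
      (∀ c, e (C c) = algebraMap (MvPolynomial (Fin n) ℂ) _ (C c)) ∧
      IsUnit (algebraMap _ (Localization.Away Δ) u) := by
  classical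
  -- The gradients are completed to a basis, and each added vector is realized as the gradient of a
  -- linear form.
  let b := Module.Basis.sumExtend hli
  have : Fintype (ι ⊕ Module.Basis.sumExtendIndex hli) :=
    FiniteDimensional.fintypeBasisIndex b
  have hcard : Fintype.card (ι ⊕ Module.Basis.sumExtendIndex hli) = n := by
    rw [← Module.finrank_eq_card_basis b, Module.finrank_fin_fun]
  let E : ι ⊕ Module.Basis.sumExtendIndex hli ≃ Fin n := Fintype.equivFinOfCardEq hcard
  let b' : Module.Basis (Fin n) ℂ (Fin n → ℂ) := b.reindex E
  let φ' : ι ⊕ Module.Basis.sumExtendIndex hli → MvPolynomial (Fin n) ℂ :=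
    Sum.elim h fun y => ∑ j, C (b (.inr y) j) * X j
  let φ (i : Fin n) : MvPolynomial (Fin n) ℂ := φ' (E.symm i)
  have hb (z : ι ⊕ Module.Basis.sumExtendIndex hli) : gradAt a (φ' z) = b z := by
    cases z with
    | inl i =>
      simp only [b, φ', Module.Basis.sumExtend, Module.Basis.reindex_apply,
        Module.Basis.coe_extend, Sum.elim_inl]
      rfl
    | inr y =>
      ext k
      simp only [gradAt, φ', Sum.elim_inr, map_sum, pderiv_C_mul, pderiv_X, map_mul, eval_C]
      rw [Finset.sum_eq_single k]
      · simp
      · intro j _ hj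
        simp [Pi.single_eq_of_ne hj]
      · simp
  let J : Matrix (Fin n) (Fin n) (MvPolynomial (Fin n) ℂ) := Matrix.of fun i k => pderiv k (φ i)
  have hJ : eval a J.det ≠ 0 := by
    have h1 : eval a J.det = ((eval a).mapMatrix J).det := RingHom.map_det _ _
    rw [h1]
    have h2 : (eval a).mapMatrix J = Matrix.of fun i => b' i := by
      ext i k
      have : gradAt a (φ i) = b' i := by
        rw [hb, Module.Basis.reindex_apply]
      exact congr($this k)
    have h3 : LinearIndependent ℂ (Matrix.of fun i => b' i).row := b'.linearIndependent
    rw [h2]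
    exact ((Matrix.isUnit_iff_isUnit_det _).mp
      (Matrix.linearIndependent_rows_iff_isUnit.mp h3)).ne_zero
  -- Inverting the determinant makes the functions étale coordinates; inverting u as well makes
  -- prescribed functions units on the chart.
  let Δ := J.det * u
  let L := Localization.Away Δ
  have hΔ : IsUnit (algebraMap _ L Δ) := IsLocalization.Away.algebraMap_isUnit Δ
  rw [map_mul, IsUnit.mul_iff] at hΔ
  let JL : Matrix (Fin n) (Fin n) L := (algebraMap (MvPolynomial (Fin n) ℂ) L).mapMatrix J
  have hdet : IsUnit JL.det := by
    have : JL.det = algebraMap _ L J.det := (RingHom.map_det _ _).symm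
    rw [this]
    exact hΔ.1
  let e : MvPolynomial (Fin n) ℂ →+* L :=
    eval₂Hom ((algebraMap (MvPolynomial (Fin n) ℂ) L).comp C) fun i => algebraMap _ L (φ i)
  refine ⟨Δ, e, fun i => E (.inl i), ?_, ?_, ?_, ?_, ?_, hΔ.2⟩
  · rw [map_mul]
    exact mul_ne_zero hJ hu
  · refine etale_of_jacobian Δ φ JL⁻¹ ?_ ?_ e (fun i => eval₂Hom_X' _ _ _) (fun c => eval₂Hom_C _ _ _)
    · exact Matrix.nonsing_inv_mul JL hdet
    · exact Matrix.mul_nonsing_inv JL hdet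
  · exact E.injective.comp Sum.inl_injective
  · intro i
    refine (eval₂Hom_X' _ _ _).trans ?_
    simp only [φ, φ', Equiv.symm_apply_apply, Sum.elim_inl]
    rfl
  · intro c
    exact eval₂Hom_C _ _ _

end Gradient

/-- If `R ⧸ I` is smooth over `ℂ`, where `R` is a localization of a polynomial ring, then the
differential is injective on `I ⧸ I ^ 2`. -/
lemma exists_sub_sum_mem_sq {n : ℕ} {R : Type} [CommRing R] (α : MvPolynomial (Fin n) ℂ →+* R)
    (I : Ideal R) (hI : ((Ideal.Quotient.mk I).comp (α.comp C)).Smooth)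
    (p : MvPolynomial (Fin n) ℂ) (hp : α p ∈ I) :
    ∃ c : Fin n → R, (∀ k, c k ∈ I) ∧ α p - ∑ k, α (pderiv k p) * c k ∈ I ^ 2 := by
  let S := R ⧸ I ^ 2
  let J : Ideal S := I.map (Ideal.Quotient.mk (I ^ 2))
  have hJ : J ^ 2 = ⊥ := by
    rw [← Ideal.map_pow, Ideal.map_quotient_self]
  algebraize [α.comp C]
  have : Algebra.Smooth ℂ (R ⧸ I) := hI
  let g : (R ⧸ I) →ₐ[ℂ] S ⧸ J :=
    { Ideal.Quotient.lift I ((Ideal.Quotient.mk J).comp (Ideal.Quotient.mk (I ^ 2))) (fun x hx =>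
        Ideal.Quotient.eq_zero_iff_mem.mpr (Ideal.mem_map_of_mem _ hx)) with
      commutes' := fun c => rfl }
  -- Smoothness of R/I gives an algebra section of R/I² → R/I. Taylor's formula then compares the
  -- canonical map β with β', which factors through R/I and so kills p.
  obtain ⟨σ, hσ⟩ := Algebra.FormallySmooth.exists_lift J ⟨2, hJ⟩ g
  let β : MvPolynomial (Fin n) ℂ →+* S := (Ideal.Quotient.mk (I ^ 2)).comp α
  let β' : MvPolynomial (Fin n) ℂ →+* S := (σ.toRingHom.comp (Ideal.Quotient.mk I)).comp α
  have hβJ (q : MvPolynomial (Fin n) ℂ) : β' q - β q ∈ J := by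
    rw [← Ideal.Quotient.eq]
    exact congr($hσ (Ideal.Quotient.mk I (α q)))
  have ht := taylor_of_sq_zero β β' (fun c => σ.commutes c) J hJ (fun k => hβJ _) p
  have h0 : β' p = 0 := by
    change σ (Ideal.Quotient.mk I (α p)) = 0
    rw [Ideal.Quotient.eq_zero_iff_mem.mpr hp, map_zero]
  have hc (k : Fin n) : ∃ c ∈ I, Ideal.Quotient.mk (I ^ 2) c = β (X k) - β' (X k) := by
    have h1 : β (X k) - β' (X k) ∈ J := by
      rw [← neg_sub]; exact neg_mem (hβJ _)
    exact (Ideal.mem_map_iff_of_surjective _ Ideal.Quotient.mk_surjective).mp h1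
  choose c hcI hc using hc
  refine ⟨c, hcI, ?_⟩
  rw [← Ideal.Quotient.eq_zero_iff_mem, map_sub, map_sum]
  simp only [map_mul, hc]
  rw [h0] at ht
  have h2 : ∑ k, β (pderiv k p) * (β (X k) - β' (X k)) =
      - ∑ k, β (pderiv k p) * (β' (X k) - β (X k)) := by
    rw [← Finset.sum_neg_distrib]
    exact Finset.sum_congr rfl fun k _ => by ring
  change β p - ∑ k, β (pderiv k p) * (β (X k) - β' (X k)) = 0
  rw [h2]
  linear_combination -ht

end

end BlowUpRes

namespace BlowUpRes

noncomputable section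

open MvPolynomial

/-! ### Smoothness of closed subschemes on charts -/

section SmoothSubscheme

variable {X : Scheme.{0}}

lemma exists_isPullback_subscheme (Z : X.IdealSheafData) {B : CommRingCat.{0}} (j : Spec B ⟶ X)
    (c : Ideal B) (hZ : Z.comap j = specIdeal c) :
    ∃ k : Spec (.of (B ⧸ c)) ⟶ Z.subscheme,
      IsPullback (Spec.map (CommRingCat.ofHom (Ideal.Quotient.mk c))) k j Z.subschemeι := by
  have hcl : IsClosedImmersion (Spec.map (CommRingCat.ofHom (Ideal.Quotient.mk c))) :=
    IsClosedImmersion.spec_of_surjective _ Ideal.Quotient.mk_surjective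
  have h1 : Z.subschemeι.ker ≤
      (Spec.map (CommRingCat.ofHom (Ideal.Quotient.mk c)) ≫ j).ker := by
    rw [Scheme.IdealSheafData.ker_subschemeι, ← Scheme.IdealSheafData.map_bot,
      Scheme.IdealSheafData.le_map_iff_comap_le, Scheme.IdealSheafData.comap_comp, hZ,
      comap_specIdeal]
    rw [CommRingCat.hom_ofHom, Ideal.map_quotient_self]
    exact specIdeal_bot.le
  refine ⟨IsClosedImmersion.lift _ _ h1, isPullback_of_isClosedImmersion _ _ _ _ ?_ ?_⟩
  · rw [IsClosedImmersion.lift_fac]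
  · rw [Scheme.IdealSheafData.ker_subschemeι, hZ, ← Scheme.IdealSheafData.map_bot, ← specIdeal_bot,
      map_specIdeal]
    congr 1
    exact (Ideal.mk_ker (I := c)).symm

lemma smooth_quotient_of_smooth {q : X ⟶ Spec (.of ℂ)} {Z : X.IdealSheafData}
    (hZ : Smooth (Z.subschemeι ≫ q)) {B : CommRingCat.{0}} (j : Spec B ⟶ X) [IsOpenImmersion j]
    (c : Ideal B) (hc : Z.comap j = specIdeal c) (γ : ℂ →+* B)
    (hγ : j ≫ q = Spec.map (CommRingCat.ofHom γ)) : ((Ideal.Quotient.mk c).comp γ).Smooth := by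
  obtain ⟨k, hk⟩ := exists_isPullback_subscheme Z j c hc
  have : IsOpenImmersion k := MorphismProperty.of_isPullback hk ‹_›
  have h1 : Smooth (k ≫ Z.subschemeι ≫ q) := inferInstance
  rw [← Category.assoc, ← hk.w, Category.assoc, hγ, ← Spec.map_comp,
    HasRingHomProperty.Spec_iff (P := @Smooth)] at h1
  exact h1

lemma smooth_of_charts {q : X ⟶ Spec (.of ℂ)} {Z : X.IdealSheafData}
    (h : ∀ x ∈ Z.support, ∃ (B : CommRingCat.{0}) (j : Spec B ⟶ X) (c : Ideal B) (γ : ℂ →+* B),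
      IsOpenImmersion j ∧ x ∈ Set.range j ∧ Z.comap j = specIdeal c ∧
      j ≫ q = Spec.map (CommRingCat.ofHom γ) ∧ ((Ideal.Quotient.mk c).comp γ).Smooth) :
    Smooth (Z.subschemeι ≫ q) := by
  have key (z : Z.subscheme) : ∃ (V : Scheme.{0}) (k : V ⟶ Z.subscheme), IsOpenImmersion k ∧
      z ∈ Set.range k ∧ Smooth (k ≫ Z.subschemeι ≫ q) := by
    obtain ⟨B, j, c, γ, hj, ⟨y, hy⟩, hc, hγ, hs⟩ := h (Z.subschemeι z) (by
      have := Z.range_subschemeι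
      rw [← SetLike.mem_coe, ← this]
      exact ⟨z, rfl⟩)
    obtain ⟨k, hk⟩ := exists_isPullback_subscheme Z j c hc
    have : IsOpenImmersion k := MorphismProperty.of_isPullback hk ‹_›
    refine ⟨_, k, this, ?_, ?_⟩
    · obtain ⟨w, -, hw⟩ := Scheme.exists_preimage_of_isPullback hk y z hy
      exact ⟨w, hw⟩
    · rw [← Category.assoc, ← hk.w, Category.assoc, hγ, ← Spec.map_comp,
        HasRingHomProperty.Spec_iff (P := @Smooth)]
      exact hs
  choose V k hk hz hs using key
  have := HasRingHomProperty.instIsZariskiLocalAtSource (P := @Smooth.{0})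
  exact IsZariskiLocalAtSource.of_openCover (P := @Smooth) (coverOfCharts V k hz) hs

end SmoothSubscheme

/-! ### Points of affine space -/

section Points

variable {n : ℕ}

/-- The closed point of affine space with given coordinates. -/
def affPt (a : Fin n → ℂ) : Aff n :=
  (⟨RingHom.ker (eval a), RingHom.ker_isPrime _⟩ : PrimeSpectrum (MvPolynomial (Fin n) ℂ))

lemma mem_affPt {a : Fin n → ℂ} {p : MvPolynomial (Fin n) ℂ} :
    p ∈ (affPt a).asIdeal ↔ eval a p = 0 := Iff.rfl

lemma mem_complOpen_originIdeal {x : Aff n} :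
    x ∈ complOpen (originIdeal n) ↔ ∃ k, (X k : MvPolynomial (Fin n) ℂ) ∉ x.asIdeal := by
  rw [mem_complOpen, originIdeal, affIdeal_eq_specIdeal, mem_support_specIdeal, Ideal.span_le,
    Set.not_subset]
  simp

lemma affPt_mem_complOpen {a : Fin n → ℂ} (ha : a ≠ 0) :
    affPt a ∈ complOpen (originIdeal n) := by
  rw [mem_complOpen_originIdeal]
  obtain ⟨k, hk⟩ := Function.ne_iff.mp ha
  exact ⟨k, by rw [mem_affPt, eval_X]; exact hk⟩

/-- A basic open chart of affine space around a point. -/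
abbrev awayChart (h : MvPolynomial (Fin n) ℂ) : Spec (.of (Localization.Away h)) ⟶ Aff n :=
  Spec.map (CommRingCat.ofHom (algebraMap (MvPolynomial (Fin n) ℂ) (Localization.Away h)))

lemma awayChart_affStr (h : MvPolynomial (Fin n) ℂ) :
    awayChart h ≫ affStr n = Spec.map (CommRingCat.ofHom
      ((algebraMap (MvPolynomial (Fin n) ℂ) (Localization.Away h)).comp C)) := by
  rw [← Spec.map_comp]
  rfl

lemma mem_range_awayChart {h : MvPolynomial (Fin n) ℂ} {x : Aff n} :
    x ∈ Set.range (awayChart h) ↔ h ∉ x.asIdeal := by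
  have := range_specMap_away (.of (MvPolynomial (Fin n) ℂ)) h
  change x ∈ Set.range _ ↔ _
  rw [this]
  rfl

/-- Evaluation at a point on a basic open neighbourhood. -/
def evalAway {h : MvPolynomial (Fin n) ℂ} {a : Fin n → ℂ} (ha : eval a h ≠ 0) :
    Localization.Away h →+* ℂ :=
  IsLocalization.Away.lift h (g := eval a) (isUnit_iff_ne_zero.mpr ha)

lemma evalAway_algebraMap {h : MvPolynomial (Fin n) ℂ} {a : Fin n → ℂ} (ha : eval a h ≠ 0)
    (p : MvPolynomial (Fin n) ℂ) : evalAway ha (algebraMap _ _ p) = eval a p :=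
  IsLocalization.Away.lift_eq h _ p

lemma isDomain_away {h : MvPolynomial (Fin n) ℂ} (h0 : h ≠ 0) : IsDomain (Localization.Away h) :=
  IsLocalization.isDomain_localization (powers_le_nonZeroDivisors_of_noZeroDivisors h0)

lemma algebraMap_away_injective {h : MvPolynomial (Fin n) ℂ} (h0 : h ≠ 0) :
    Function.Injective (algebraMap (MvPolynomial (Fin n) ℂ) (Localization.Away h)) :=
  IsLocalization.injective _ (powers_le_nonZeroDivisors_of_noZeroDivisors h0)

/-- A chart of an open subset of affine space around a point. -/
lemma exists_awayChart_lift {U : Scheme.{0}} (i : U ⟶ Aff n) [IsOpenImmersion i] (x : Aff n)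
    (hx : x ∈ Set.range i) :
    ∃ (h : MvPolynomial (Fin n) ℂ) (k : Spec (.of (Localization.Away h)) ⟶ U),
      h ∉ x.asIdeal ∧ IsOpenImmersion k ∧ k ≫ i = awayChart h := by
  obtain ⟨_, ⟨_, ⟨h, rfl⟩, rfl⟩, hy, hs⟩ :=
    PrimeSpectrum.isBasis_basic_opens.exists_subset_of_mem_open
      (show x ∈ (i.opensRange : Set (Aff n)) from hx) i.opensRange.isOpen
  have hr : Set.range (awayChart h) ⊆ Set.range i := by
    intro z hz
    exact hs (mem_range_awayChart.mp hz)
  have he := IsOpenImmersion.lift_fac i (awayChart h) hr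
  refine ⟨h, IsOpenImmersion.lift i (awayChart h) hr, hy, ?_, he⟩
  have : IsOpenImmersion (IsOpenImmersion.lift i (awayChart h) hr ≫ i) := by
    rw [he]; infer_instance
  exact .of_comp _ i

/-- On a smooth hypersurface the gradient does not vanish. -/
lemma gradAt_ne_zero {f : MvPolynomial (Fin n) ℂ} (hf : f ≠ 0)
    (hs : SmoothOn (affStr n) (hypersurface f) (complOpen (originIdeal n))) {a : Fin n → ℂ}
    (ha : a ≠ 0) (hfa : eval a f = 0) : gradAt a f ≠ 0 := by
  obtain ⟨h, k, hh, hk, hki⟩ := exists_awayChart_lift (complOpen (originIdeal n)).ι (affPt a)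
    (by simpa using affPt_mem_complOpen ha)
  rw [mem_affPt] at hh
  have h0 : h ≠ 0 := fun e => hh (by rw [e, map_zero])
  have := isDomain_away h0
  let α := algebraMap (MvPolynomial (Fin n) ℂ) (Localization.Away h)
  have hsm := smooth_quotient_of_smooth (q := (complOpen (originIdeal n)).ι ≫ affStr n)
    (B := .of (Localization.Away h)) hs k (Ideal.span {α f}) (by
      rw [← Scheme.IdealSheafData.comap_comp, hki, hypersurface, affIdeal_eq_specIdeal,
        comap_specIdeal, Ideal.map_span, Set.image_singleton]
      rfl) (α.comp C) (by rw [← Category.assoc, hki]; exact awayChart_affStr h)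
  obtain ⟨c, hcI, hc⟩ := exists_sub_sum_mem_sq α _ hsm f (Ideal.mem_span_singleton_self _)
  choose c' hc' using fun k => Ideal.mem_span_singleton.mp (hcI k)
  rw [Ideal.span_singleton_pow, Ideal.mem_span_singleton] at hc
  obtain ⟨z, hz⟩ := hc
  have hαf : α f ≠ 0 := fun e => hf (algebraMap_away_injective h0 (e.trans (map_zero _).symm))
  -- As I = (f) is principal in a domain, the relation f - ∑ ∂_k f · c_k ∈ (f²) with c_k ∈ (f) can
  -- be divided by f. At the point a, where f vanishes, it says that some partial derivative is
  -- non-zero.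
  have h1 : 1 - ∑ k, α (pderiv k f) * c' k = α f * z := by
    apply mul_left_cancel₀ hαf
    rw [mul_sub, mul_one, Finset.mul_sum]
    calc _ = α f - ∑ k, α (pderiv k f) * c k := by
          congr 1
          exact Finset.sum_congr rfl fun k _ => by rw [hc']; ring
      _ = _ := by rw [hz]; ring
  intro hgrad
  have h2 := congr_arg (evalAway hh) h1
  simp only [map_sub, map_one, map_sum, map_mul, α, evalAway_algebraMap, hfa, zero_mul] at h2
  rw [Finset.sum_eq_zero] at h2
  · simp at h2
  · intro k _
    rw [show eval a (pderiv k f) = 0 from congr($hgrad k), zero_mul]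

end Points

/-! ### Independence of the gradients -/

/-- A formally smooth homomorphism has the lifting property for nilpotent thickenings. -/
lemma exists_lift_of_etale {R A B S : Type} [CommRing R] [CommRing A] [CommRing B] [CommRing S]
    {c : R →+* A} (hc : c.Etale) (τ : R →+* B) (g : B →+* S) (hg : Function.Surjective g)
    (hker : IsNilpotent (RingHom.ker g)) (f : A →+* S) (h : g.comp τ = f.comp c) :
    ∃ l : A →+* B, l.comp c = τ ∧ g.comp l = f := by
  algebraize [c, τ, f.comp c]
  let g' : B →ₐ[R] S := { g with commutes' := fun x => congr($h x) }
  let f' : A →ₐ[R] S := { f with commutes' := fun _ => rfl }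
  refine ⟨(Algebra.FormallySmooth.liftOfSurjective f' g' hg hker).toRingHom, ?_, ?_⟩
  · ext x
    exact (Algebra.FormallySmooth.liftOfSurjective f' g' hg hker).commutes x
  · ext x
    exact Algebra.FormallySmooth.liftOfSurjective_apply f' g' hg hker x

/-- The hyperplane ker x_i is covered by finitely many subspaces ker ℓ_l, hence contained in one of
them because ℂ is infinite; so some ℓ_{m(i)} is a non-zero multiple of x_i. The dual vectors v make
m injective, equality of cardinalities makes it bijective, and the ℓ_l inherit independence from the
x_i. -/
lemma linearIndependent_of_ker_subset {V S A : Type*} [AddCommGroup V] [Module ℂ V] [Fintype S]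
    [Fintype A] (ℓ : S → V →ₗ[ℂ] ℂ) (hℓ : ∀ l, ℓ l ≠ 0) (x : A → V →ₗ[ℂ] ℂ) (v : A → V)
    (hv : ∀ i, x i (v i) = 1) (hv' : ∀ i j, i ≠ j → x i (v j) = 0)
    (h : ∀ i w, x i w = 0 → ∃ l, ℓ l w = 0) (hcard : Fintype.card S = Fintype.card A) :
    LinearIndependent ℂ ℓ := by
  have h1 (i : A) : ∃ l, LinearMap.ker (x i) ≤ LinearMap.ker (ℓ l) := by
    obtain ⟨l, hl⟩ := Subspace.exists_eq_top_of_iUnion_eq_univ (k := ℂ)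
      (E := LinearMap.ker (x i)) (p := fun l => (LinearMap.ker (ℓ l)).comap (Submodule.subtype _))
      (by
        ext w
        obtain ⟨l, hl⟩ := h i w.1 w.2
        simpa using ⟨l, hl⟩)
    refine ⟨l, fun w hw => ?_⟩
    have : (⟨w, hw⟩ : LinearMap.ker (x i)) ∈
        (LinearMap.ker (ℓ l)).comap (Submodule.subtype (LinearMap.ker (x i))) := hl ▸ trivial
    exact this
  choose m hm using h1
  have hdec (i : A) (w : V) : ℓ (m i) w = x i w * ℓ (m i) (v i) := by
    have : w - x i w • v i ∈ LinearMap.ker (x i) := by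
      rw [LinearMap.mem_ker, map_sub, map_smul, hv, smul_eq_mul, mul_one, sub_self]
    have := hm i this
    rw [LinearMap.mem_ker, map_sub, map_smul, smul_eq_mul, sub_eq_zero] at this
    exact this
  have hne (i : A) : ℓ (m i) (v i) ≠ 0 := fun h0 =>
    hℓ (m i) (LinearMap.ext fun w => by rw [hdec, h0, mul_zero, LinearMap.zero_apply])
  have hinj : Function.Injective m := by
    intro i j hij
    by_contra hne'
    have := hdec i (v j)
    rw [hv' i j hne', zero_mul, hij] at this
    exact hne j this
  have hbij : Function.Bijective m :=
    (Fintype.bijective_iff_injective_and_card m).mpr ⟨hinj, hcard.symm⟩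
  rw [Fintype.linearIndependent_iff]
  intro μ hμ l
  obtain ⟨i, rfl⟩ := hbij.2 l
  have h2 := congr($hμ (v i))
  rw [LinearMap.sum_apply, Finset.sum_eq_single (m i)] at h2
  · simpa [hne i] using h2
  · intro l' _ hl'
    obtain ⟨j, rfl⟩ := hbij.2 l'
    rw [LinearMap.smul_apply, hdec, hv' j i (fun e => hl' (e ▸ rfl)), zero_mul, smul_zero]
  · simp

section PowerSeriesProduct

open PowerSeries (constantCoeff)

/-- The order of vanishing is at least the number of factors vanishing at 0, with equality unless
one of them vanishes to order two or more. This compares two equations of one divisor along a line.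
-/
lemma exists_prod_eq_X_pow_mul {ι : Type*} [DecidableEq ι] (s : Finset ι)
    (p : ι → PowerSeries ℂ) :
    ∃ Q : PowerSeries ℂ, ∏ i ∈ s, p i =
        PowerSeries.X ^ (s.filter fun i => constantCoeff (p i) = 0).card * Q ∧
      (constantCoeff Q = 0 ↔ ∃ i ∈ s, constantCoeff (p i) = 0 ∧ PowerSeries.coeff 1 (p i) = 0) := by
  induction s using Finset.induction_on with
  | empty => exact ⟨1, by simp, by simp⟩
  | insert i s hi ih =>
    obtain ⟨Q, hQ, hQ0⟩ := ih
    rw [Finset.prod_insert hi, hQ, Finset.filter_insert]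
    by_cases h0 : constantCoeff (p i) = 0
    · obtain ⟨q, hq⟩ := PowerSeries.X_dvd_iff.mpr h0
      have hq1 : PowerSeries.coeff 1 (p i) = constantCoeff q := by
        rw [hq, PowerSeries.coeff_succ_X_mul 0, PowerSeries.coeff_zero_eq_constantCoeff]
      refine ⟨q * Q, ?_, ?_⟩
      · rw [if_pos h0, Finset.card_insert_of_notMem (by simp [hi]), hq]
        ring
      · rw [map_mul, mul_eq_zero, hQ0, ← hq1]
        simp [h0]
    · refine ⟨p i * Q, ?_, ?_⟩
      · rw [if_neg h0]
        ring
      · rw [map_mul, mul_eq_zero, hQ0]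
        simp [h0]

lemma le_of_X_pow_mul_dvd {s t : ℕ} {Q Q' : PowerSeries ℂ}
    (h : PowerSeries.X ^ t * Q' ∣ PowerSeries.X ^ s * Q) (hQ : constantCoeff Q ≠ 0) : t ≤ s := by
  by_contra! hlt
  obtain ⟨k, rfl⟩ := Nat.exists_eq_add_of_lt hlt
  obtain ⟨z, hz⟩ := h
  have : Q = PowerSeries.X * (PowerSeries.X ^ k * Q' * z) := by
    apply mul_left_cancel₀ (pow_ne_zero s PowerSeries.X_ne_zero)
    rw [hz]
    ring
  apply hQ
  rw [this, map_mul, PowerSeries.constantCoeff_X, zero_mul]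

lemma constantCoeff_eq_zero_of_dvd {s : ℕ} {Q Q' : PowerSeries ℂ}
    (h : PowerSeries.X ^ s * Q' ∣ PowerSeries.X ^ s * Q) (hQ : constantCoeff Q' = 0) :
    constantCoeff Q = 0 := by
  obtain ⟨z, hz⟩ := (mul_dvd_mul_iff_left (pow_ne_zero s PowerSeries.X_ne_zero)).mp h
  rw [hz, map_mul, hQ, zero_mul]

end PowerSeriesProduct

section SNC

variable {n : ℕ} {h : MvPolynomial (Fin n) ℂ} {a : Fin n → ℂ}

/-- The restriction of polynomials to the line `a + t v`. -/
def lineHom (a v : Fin n → ℂ) : MvPolynomial (Fin n) ℂ →+* PowerSeries ℂ :=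
  eval₂Hom PowerSeries.C fun k => PowerSeries.C (a k) + PowerSeries.X * PowerSeries.C (v k)

lemma constantCoeff_lineHom (a v : Fin n → ℂ) (p : MvPolynomial (Fin n) ℂ) :
    PowerSeries.constantCoeff (lineHom a v p) = eval a p := by
  have : (PowerSeries.constantCoeff (R := ℂ)).comp (lineHom a v) = eval a :=
    MvPolynomial.ringHom_ext (by simp [lineHom]) (by simp [lineHom])
  exact congr($this p)

lemma coeff_one_lineHom (a v : Fin n → ℂ) (p : MvPolynomial (Fin n) ℂ) :
    PowerSeries.coeff 1 (lineHom a v p) = gradAt a p ⬝ᵥ v := by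
  classical
  induction p using MvPolynomial.induction_on with
  | C c => simp [lineHom, gradAt, dotProduct]
  | add p q hp hq =>
    rw [map_add, map_add, hp, hq, ← add_dotProduct]
    congr 1
    ext k
    simp [gradAt]
  | mul_X p i hp =>
    have h1 : gradAt a (p * X i) = a i • gradAt a p + eval a p • Pi.single i 1 := by
      ext k
      simp only [gradAt, Derivation.leibniz, pderiv_X, smul_eq_mul, map_add, map_mul, eval_X,
        Pi.add_apply, Pi.smul_apply]
      by_cases hk : k = i
      · subst hk; simp; ring
      · simp [Pi.single_eq_of_ne hk, Pi.single_eq_of_ne (Ne.symm hk)]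
    have h2 : lineHom a v (X i) = PowerSeries.C (a i) + PowerSeries.X * PowerSeries.C (v i) := by
      simp [lineHom]
    rw [map_mul, PowerSeries.coeff_one_mul, hp, constantCoeff_lineHom, constantCoeff_lineHom, h1,
      h2, add_dotProduct, smul_dotProduct, smul_dotProduct]
    simp [PowerSeries.coeff_C, PowerSeries.coeff_succ_X_mul 0]
    ring

/-- The restriction of functions on a basic open set to the line `a + t v`. -/
def lineAway (ha : eval a h ≠ 0) (v : Fin n → ℂ) : Localization.Away h →+* PowerSeries ℂ :=
  IsLocalization.Away.lift h (g := lineHom a v) (by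
    rw [PowerSeries.isUnit_iff_constantCoeff, constantCoeff_lineHom]
    exact isUnit_iff_ne_zero.mpr ha)

lemma lineAway_algebraMap (ha : eval a h ≠ 0) (v : Fin n → ℂ) (p : MvPolynomial (Fin n) ℂ) :
    lineAway ha v (algebraMap _ _ p) = lineHom a v p :=
  IsLocalization.Away.lift_eq h _ p

lemma constantCoeff_lineAway (ha : eval a h ≠ 0) (v : Fin n → ℂ) (x : Localization.Away h) :
    PowerSeries.constantCoeff (lineAway ha v x) = evalAway ha x := by
  have : (PowerSeries.constantCoeff (R := ℂ)).comp (lineAway ha v) = evalAway ha := by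
    apply IsLocalization.ringHom_ext (.powers h)
    refine RingHom.ext fun p => ?_
    simp only [RingHom.comp_apply]
    rw [lineAway_algebraMap, constantCoeff_lineHom, evalAway_algebraMap]
  exact congr($this x)

lemma exists_coeff_one_lineAway (ha : eval a h ≠ 0) (x : Localization.Away h) :
    ∃ g : Fin n → ℂ, ∀ v, PowerSeries.coeff 1 (lineAway ha v x) = g ⬝ᵥ v := by
  obtain ⟨N, p, hp⟩ := IsLocalization.Away.surj h x
  -- The quotient rule for x = p / h^N.
  refine ⟨(eval a h ^ N)⁻¹ • (gradAt a p - evalAway ha x • gradAt a (h ^ N)), fun v => ?_⟩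
  have h1 := congr_arg (fun z => PowerSeries.coeff 1 (lineAway ha v z)) hp
  simp only [map_mul] at h1
  rw [← map_pow, lineAway_algebraMap, lineAway_algebraMap, PowerSeries.coeff_one_mul,
    coeff_one_lineHom, coeff_one_lineHom, constantCoeff_lineHom, constantCoeff_lineAway,
    map_pow] at h1
  have h2 : eval a h ^ N ≠ 0 := pow_ne_zero N ha
  rw [smul_dotProduct, sub_dotProduct, smul_dotProduct, smul_eq_mul, smul_eq_mul]
  field_simp
  linear_combination h1

/-- Truncation of power series to dual numbers. -/
def truncHom : PowerSeries ℂ →+* DualNumber ℂ where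
  toFun p := TrivSqZeroExt.inl (PowerSeries.constantCoeff p) +
    TrivSqZeroExt.inr (PowerSeries.coeff 1 p)
  map_one' := by
    ext <;> simp [PowerSeries.coeff_one]
  map_mul' p q := by
    ext
    · simp
    · simp [PowerSeries.coeff_one_mul]
      ring
  map_zero' := by
    ext <;> simp
  map_add' p q := by
    ext <;> simp

/-- Étale coordinates have independent differentials. -/
lemma exists_dual_direction {m : ℕ} (ha : eval a h ≠ 0)
    {c : MvPolynomial (Fin m) ℂ →+* Localization.Away h} (hc : c.Etale)
    (hcC : ∀ z, c (C z) = algebraMap (MvPolynomial (Fin n) ℂ) _ (C z)) (i : Fin m) :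
    ∃ v : Fin n → ℂ, ∀ j,
      PowerSeries.coeff 1 (lineAway ha v (c (X j))) = if j = i then 1 else 0 := by
  -- τ is the i-th coordinate tangent vector at the image of a. Étaleness lifts it to a tangent
  -- vector at a, whose components are v.
  let τ : MvPolynomial (Fin m) ℂ →+* DualNumber ℂ :=
    eval₂Hom (TrivSqZeroExt.inlHom ℂ ℂ) fun j =>
      TrivSqZeroExt.inl (evalAway ha (c (X j))) + TrivSqZeroExt.inr (if j = i then 1 else 0)
  let g : DualNumber ℂ →+* ℂ := (TrivSqZeroExt.fstHom ℂ ℂ ℂ).toRingHom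
  have hg : Function.Surjective g := fun z => ⟨TrivSqZeroExt.inl z, rfl⟩
  have hker : IsNilpotent (RingHom.ker g) := by
    refine ⟨2, (sq (RingHom.ker g)).trans ?_⟩
    rw [Ideal.zero_eq_bot, eq_bot_iff, Ideal.mul_le]
    intro x hx y hy
    have hx' : x.fst = 0 := hx
    have hy' : y.fst = 0 := hy
    rw [Ideal.mem_bot]
    ext <;> simp [hx', hy']
  obtain ⟨l, hl, hgl⟩ := exists_lift_of_etale hc τ g hg hker (evalAway ha) (by
    apply MvPolynomial.ringHom_ext
    · intro z
      simp only [RingHom.comp_apply]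
      rw [hcC, evalAway_algebraMap, eval_C]
      simp [τ, g]
    · intro j
      by_cases hji : j = i <;> simp [τ, g, hji])
  let v : Fin n → ℂ := fun k => (l (algebraMap (MvPolynomial (Fin n) ℂ) _ (X k))).snd
  refine ⟨v, fun j => ?_⟩
  have hlt : truncHom.comp (lineAway ha v) = l := by
    apply IsLocalization.ringHom_ext (.powers h)
    apply MvPolynomial.ringHom_ext
    · intro z
      simp only [RingHom.comp_apply]
      rw [lineAway_algebraMap, ← hcC]
      have := congr($hl (C z))
      rw [RingHom.comp_apply] at this
      rw [this]
      ext <;> simp [truncHom, lineHom, τ]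
    · intro k
      simp only [RingHom.comp_apply]
      rw [lineAway_algebraMap]
      have h1 : (l (algebraMap (MvPolynomial (Fin n) ℂ) _ (X k))).fst = a k := by
        have := congr($hgl (algebraMap (MvPolynomial (Fin n) ℂ) _ (X k)))
        rw [evalAway_algebraMap, eval_X] at this
        exact this
      ext
      · rw [h1]
        simp [truncHom, lineHom]
      · simp [truncHom, lineHom, v, PowerSeries.coeff_C, PowerSeries.coeff_succ_X_mul 0]
  have h2 := congr(($hlt (c (X j))).snd)
  have h3 := congr(($hl (X j)).snd)
  rw [RingHom.comp_apply] at h3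
  rw [h3] at h2
  by_cases hji : j = i <;> simpa [truncHom, τ, hji] using h2

/-- Normal crossings of smooth hypersurfaces: the gradients are independent. -/
lemma linearIndependent_gradAt_of_span_eq {r m : ℕ} (f : Fin r → MvPolynomial (Fin n) ℂ)
    (ha : eval a h ≠ 0) {c : MvPolynomial (Fin m) ℂ →+* Localization.Away h} (hc : c.Etale)
    (hcC : ∀ z, c (C z) = algebraMap (MvPolynomial (Fin n) ℂ) _ (C z)) (A : Finset (Fin m))
    (hspan : Ideal.span {algebraMap _ (Localization.Away h) (∏ l, f l)} =
      Ideal.span {∏ i ∈ A, c (X i)})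
    (hgrad : ∀ l, eval a (f l) = 0 → gradAt a (f l) ≠ 0) :
    LinearIndependent ℂ fun l : {l // eval a (f l) = 0} => gradAt a (f l) := by
  classical
  choose g hg using fun i => exists_coeff_one_lineAway ha (c (X i))
  choose u hu using fun i => exists_dual_direction ha hc hcC i
  let A' := A.filter fun i => evalAway ha (c (X i)) = 0
  let Φ : (Fin n → ℂ) →ₗ[ℂ] (Fin n → ℂ) →ₗ[ℂ] ℂ := dotProductBilin ℂ ℂ
  have hΦ (p q : Fin n → ℂ) : Φ p q = p ⬝ᵥ q := rfl
  have hΦ0 (p : Fin n → ℂ) (hp : p ≠ 0) : Φ p ≠ 0 := by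
    obtain ⟨k, hk⟩ := Function.ne_iff.mp hp
    intro h0
    have := congr($h0 (Pi.single k 1))
    rw [hΦ, dotProduct_single_one] at this
    exact hk this
  have hg0 (i : Fin m) : g i ≠ 0 := by
    intro h0
    have := hu i i
    rw [hg, h0, zero_dotProduct] at this
    simp at this
  -- compare orders of vanishing along lines
  have hdvd (v : Fin n → ℂ) :
      ∏ l, lineHom a v (f l) ∣ ∏ i ∈ A, lineAway ha v (c (X i)) ∧
      ∏ i ∈ A, lineAway ha v (c (X i)) ∣ ∏ l, lineHom a v (f l) := by
    have e1 : ∏ l, lineHom a v (f l) = lineAway ha v (algebraMap _ _ (∏ l, f l)) := by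
      rw [lineAway_algebraMap, map_prod]
    rw [e1, ← map_prod]
    exact ⟨map_dvd _ (Ideal.span_singleton_le_span_singleton.mp hspan.ge),
      map_dvd _ (Ideal.span_singleton_le_span_singleton.mp hspan.le)⟩
  choose Q hQ hQ0 using fun v => exists_prod_eq_X_pow_mul Finset.univ fun l => lineHom a v (f l)
  choose R hR hR0 using fun v => exists_prod_eq_X_pow_mul A fun i => lineAway ha v (c (X i))
  simp only [hQ, hR, constantCoeff_lineHom, constantCoeff_lineAway] at hdvd
  simp only [constantCoeff_lineHom, coeff_one_lineHom, Finset.mem_univ, true_and] at hQ0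
  simp only [constantCoeff_lineAway, hg] at hR0
  -- A general direction lies in none of the finitely many kernels. Along it both products vanish
  -- exactly to the order of their number of vanishing factors, so these numbers agree.
  obtain ⟨v₀, hv₀⟩ : ∃ v, (∀ l, eval a (f l) = 0 → gradAt a (f l) ⬝ᵥ v ≠ 0) ∧
      ∀ i, g i ⬝ᵥ v ≠ 0 := by
    by_contra! hcon
    obtain ⟨z, hz⟩ := Subspace.exists_eq_top_of_iUnion_eq_univ (k := ℂ) (E := Fin n → ℂ)
      (p := fun z : {l // eval a (f l) = 0} ⊕ Fin m =>
        Sum.elim (fun l : {l // eval a (f l) = 0} => LinearMap.ker (Φ (gradAt a (f l))))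
          (fun i => LinearMap.ker (Φ (g i))) z)
      (by
        ext v
        simp only [Set.mem_iUnion, Set.mem_univ, iff_true]
        by_cases hv : ∀ l, eval a (f l) = 0 → gradAt a (f l) ⬝ᵥ v ≠ 0
        · obtain ⟨i, hi⟩ := hcon v hv
          exact ⟨.inr i, hi⟩
        · push Not at hv
          obtain ⟨l, hl, hlv⟩ := hv
          exact ⟨.inl ⟨l, hl⟩, hlv⟩)
    cases z with
    | inl l => exact hΦ0 _ (hgrad l l.2) (LinearMap.ker_eq_top.mp hz)
    | inr i => exact hΦ0 _ (hg0 i) (LinearMap.ker_eq_top.mp hz)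
  have hcard : (Finset.univ.filter fun l => eval a (f l) = 0).card = A'.card := by
    apply le_antisymm
    · refine le_of_X_pow_mul_dvd (hdvd v₀).1 fun h0 => ?_
      obtain ⟨i, -, -, hi⟩ := (hR0 v₀).mp h0
      exact hv₀.2 i hi
    · refine le_of_X_pow_mul_dvd (hdvd v₀).2 fun h0 => ?_
      obtain ⟨l, hl, hi⟩ := (hQ0 v₀).mp h0
      exact hv₀.1 l hl hi
  have key : LinearIndependent ℂ fun l : {l // eval a (f l) = 0} => Φ (gradAt a (f l)) := by
    refine linearIndependent_of_ker_subset _ (fun l => hΦ0 _ (hgrad l l.2))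
      (fun i : A' => Φ (g i)) (fun i => u i) ?_ ?_ ?_ ?_
    · intro i
      rw [hΦ, ← hg, hu, if_pos rfl]
    · intro i j hij
      rw [hΦ, ← hg, hu, if_neg (fun e => hij (Subtype.ext e))]
    -- For w in the kernel of the differential g_i the product of coordinates vanishes to higher
    -- order along w, hence so does the product of the f_l, and w is orthogonal to some gradient.
    · intro i w hw
      have hi := Finset.mem_filter.mp i.2
      have h1 : PowerSeries.constantCoeff (R w) = 0 := (hR0 w).mpr ⟨i, hi.1, hi.2, hw⟩
      have h2 := (hdvd w).2
      rw [hcard] at h2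
      obtain ⟨l, hl, hl'⟩ := (hQ0 w).mp (constantCoeff_eq_zero_of_dvd h2 h1)
      exact ⟨⟨l, hl⟩, hl'⟩
    · rw [Fintype.card_coe, ← hcard, Fintype.card_subtype]
  exact LinearIndependent.of_comp Φ key

end SNC

/-- On a normal crossing divisor with smooth components, the gradients of the equations which vanish
at a given point are linearly independent. -/
lemma linearIndependent_gradAt {n r : ℕ} (f : Fin r → MvPolynomial (Fin n) ℂ) (hf : ∀ i, f i ≠ 0)
    (hsmooth : ∀ i, SmoothOn (affStr n) (hypersurface (f i)) (complOpen (originIdeal n)))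
    (hsnc : IsSNCDivisor ((complOpen (originIdeal n)).ι ≫ affStr n)
      ((∏ i, hypersurface (f i)).comap (complOpen (originIdeal n)).ι))
    (a : Fin n → ℂ) (ha : a ≠ 0) :
    LinearIndependent ℂ fun l : {l // eval a (f l) = 0} => gradAt a (f l) := by
  obtain ⟨V, m, c, A, hxV, hE⟩ := hsnc ⟨affPt a, affPt_mem_complOpen ha⟩
  obtain ⟨h, k, hh, hk, hki⟩ := exists_awayChart_lift (V.ι ≫ (complOpen (originIdeal n)).ι)
    (affPt a) ⟨⟨_, hxV⟩, rfl⟩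
  have hk' := Spec.map_preimage (k ≫ c.map)
  have het := c.etale
  have hcet : (Spec.preimage (k ≫ c.map)).hom.Etale := by
    rw [← HasRingHomProperty.Spec_iff (P := @Etale), hk']
    infer_instance
  refine linearIndependent_gradAt_of_span_eq f hh hcet ?_ A ?_
    (fun l hl => gradAt_ne_zero (hf l) (hsmooth l) ha hl)
  · intro z
    have h1 : k ≫ c.map ≫ affStr m = awayChart h ≫ affStr n := by
      rw [c.comm, ← hki]
      simp only [Category.assoc]
    rw [awayChart_affStr, ← Category.assoc, ← hk', ← Spec.map_comp] at h1
    have h2 := Spec.map_injective h1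
    exact congr($(h2).hom z)
  · have h1 := congr_arg (fun I => Scheme.IdealSheafData.comap I k) hE
    simp only [← Scheme.IdealSheafData.comap_comp] at h1
    rw [hki, ← hk'] at h1
    have h2 : (∏ i, hypersurface (f i)) =
        specIdeal (R := .of (MvPolynomial (Fin n) ℂ)) (Ideal.span {∏ i, f i}) := by
      rw [← Ideal.prod_span_singleton, specIdeal_prod]
      rfl
    rw [h2, comap_specIdeal, hypersurface, affIdeal_eq_specIdeal, comap_specIdeal,
      specIdeal_inj, Ideal.map_span, Ideal.map_span, Set.image_singleton, Set.image_singleton,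
      map_prod (Spec.preimage (k ≫ c.map)).hom] at h1
    exact h1

end

end BlowUpRes

namespace BlowUpRes

noncomputable section

open MvPolynomial

/-! ### Main and side charts, and their behaviour under the next blow-up -/

section IdealSheaf

lemma specIdeal_iSup {R : CommRingCat.{0}} {ι : Sort*} (a : ι → Ideal R) :
    specIdeal (⨆ i, a i) = ⨆ i, specIdeal (a i) := by
  apply le_antisymm
  · obtain ⟨b, hb⟩ := exists_eq_specIdeal (⨆ i, specIdeal (a i))
    rw [hb, specIdeal_le_iff]
    refine iSup_le fun i => ?_
    rw [← specIdeal_le_iff, ← hb]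
    exact le_iSup (fun i => specIdeal (a i)) i
  · exact iSup_le fun i => specIdeal_le_iff.mpr (le_iSup a i)

lemma comap_affIdeal {n : ℕ} {Y : Scheme.{0}} {π : Y ⟶ Aff n} {B : CommRingCat.{0}}
    {j : Spec B ⟶ Y} {g : MvPolynomial (Fin n) ℂ →+* B}
    (h : j ≫ π = Spec.map (CommRingCat.ofHom g)) (I : Ideal (MvPolynomial (Fin n) ℂ)) :
    (affIdeal I).comap (j ≫ π) = specIdeal (I.map g) := by
  rw [h, affIdeal_eq_specIdeal, comap_specIdeal]
  rfl

lemma nextCentre_comap {r : ℕ} {d : Fin r → ℕ} {d₀ s : ℕ} {Y Y' : Scheme.{0}}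
    {E : Y.IdealSheafData} {H : Fin r → Y.IdealSheafData} (j : Y' ⟶ Y) :
    (nextCentre d d₀ s E H).comap j = nextCentre d d₀ s (E.comap j) fun l => (H l).comap j := by
  simp only [nextCentre, Scheme.IdealSheafData.comap_sup, (Scheme.IdealSheafData.map_gc j).l_iSup]

lemma le_nextCentre {r : ℕ} {d : Fin r → ℕ} {d₀ s : ℕ} {Y : Scheme.{0}}
    {E : Y.IdealSheafData} {H : Fin r → Y.IdealSheafData} {l : Fin r} (hl : d l ≤ d₀ + s) :
    H l ≤ nextCentre d d₀ s E H :=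
  le_trans (le_iSup₂ (f := fun j (_ : j ∈ {j : Fin r | d j ≤ d₀ + s}) => H j) l hl) le_sup_right

end IdealSheaf

/-- An affine chart of `Y` around `y` with algebraic coordinates, over `𝐀ⁿ`. -/
structure CoordChart {n : ℕ} {Y : Scheme.{0}} (π : Y ⟶ Aff n) (y : Y) where
  /-- the coordinate ring of the chart -/
  B : CommRingCat.{0}
  /-- the inclusion of the chart -/
  j : Spec B ⟶ Y
  /-- the algebraic coordinates -/
  e : MvPolynomial (Fin n) ℂ →+* B
  /-- the morphism to affine space -/
  g : MvPolynomial (Fin n) ℂ →+* B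
  isOpenImmersion : IsOpenImmersion j
  mem : y ∈ Set.range j
  etale : e.Etale
  comp : j ≫ π = Spec.map (CommRingCat.ofHom g)
  e_C : ∀ c, e (C c) = g (C c)

attribute [instance] CoordChart.isOpenImmersion

section Charts

variable {n r : ℕ} {f : Fin r → MvPolynomial (Fin n) ℂ} {d : Fin r → ℕ} {N : ℕ}
  {Y : Scheme.{0}} {π : Y ⟶ Aff n} {y : Y}

/-- A chart which meets the last exceptional divisor `E = (x_i)`, and on which the strict transforms
`H l = (w l)` are empty or given by coordinates. -/
structure CoordChart.IsMain (c : CoordChart π y) (f : Fin r → MvPolynomial (Fin n) ℂ)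
    (d : Fin r → ℕ) (N : ℕ) (E : Y.IdealSheafData) (H : Fin r → Y.IdealSheafData) (i₀ : Fin n)
    (w : Fin r → c.B) (σ : Fin r → Fin n) : Prop where
  map_origin : (Ideal.span (Set.range X)).map c.g = Ideal.span {c.e (X i₀)}
  map_eq : ∀ l, c.g (f l) = c.e (X i₀) ^ max (d l) N * w l
  coord : ∀ l, IsUnit (w l) ∨ w l = c.e (X (σ l)) ∧ σ l ≠ i₀
  inj : ∀ l l', ¬ IsUnit (w l) → ¬ IsUnit (w l') → σ l = σ l' → l = l'
  comap_E : E.comap c.j = specIdeal (Ideal.span {c.e (X i₀)})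
  comap_H : ∀ l, (H l).comap c.j = specIdeal (Ideal.span {w l})

/-- A chart on which one of the equations `f l` with `d l ≤ N` divides all the others, and which
does not meet the centres of the further blow-ups. -/
structure CoordChart.IsSide (c : CoordChart π y) (f : Fin r → MvPolynomial (Fin n) ℂ)
    (d : Fin r → ℕ) (N : ℕ) (H : Fin r → Y.IdealSheafData) (A : Finset (Fin n)) (l : Fin r) :
    Prop where
  map_origin : (Ideal.span (Set.range X)).map c.g = Ideal.span {∏ i ∈ A, c.e (X i)}
  le : d l ≤ N
  comap_H : (H l).comap c.j = ⊤
  dvd_pow : c.g (f l) ∣ (∏ i ∈ A, c.e (X i)) ^ N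
  dvd : ∀ m, c.g (f l) ∣ c.g (f m)

/-- Up to a unit f_l is here t^N, which divides every t^{max(d_m, N)} w_m, and the strict transform
H_l is empty. -/
lemma CoordChart.IsMain.isSide {c : CoordChart π y} {E : Y.IdealSheafData}
    {H : Fin r → Y.IdealSheafData} {i₀ : Fin n} {w : Fin r → c.B} {σ : Fin r → Fin n}
    (h : c.IsMain f d N E H i₀ w σ) {l : Fin r} (hl : d l ≤ N) (hw : IsUnit (w l)) :
    c.IsSide f d N H {i₀} l where
  map_origin := by rw [Finset.prod_singleton, h.map_origin]
  le := hl
  comap_H := by rw [h.comap_H, Ideal.span_singleton_eq_top.mpr hw, specIdeal_top]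
  dvd_pow := by
    rw [Finset.prod_singleton, h.map_eq, max_eq_right hl, hw.mul_right_dvd]
  dvd m := by
    rw [h.map_eq, h.map_eq, max_eq_right hl, hw.mul_right_dvd]
    exact (pow_dvd_pow _ (le_max_right _ _)).mul_right _

/-- The local description of the tower after `s` steps, with `N = d₀ + s`. -/
def HasGoodCharts (f : Fin r → MvPolynomial (Fin n) ℂ) (d : Fin r → ℕ) (N : ℕ) {Y : Scheme.{0}}
    (π : Y ⟶ Aff n) (E : Y.IdealSheafData) (H : Fin r → Y.IdealSheafData) : Prop :=
  ∀ y : Y, ∃ c : CoordChart π y,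
    (∃ i₀ w σ, c.IsMain f d N E H i₀ w σ ∧ ∀ l, d l ≤ N → ¬ IsUnit (w l)) ∨
      ∃ A l, c.IsSide f d N H A l

/-- A main chart on which some w_l with d_l ≤ N is a unit is reclassified as a side chart. On the
remaining main charts the next centre is a coordinate subspace. -/
lemma hasGoodCharts_of_isMain {E : Y.IdealSheafData} {H : Fin r → Y.IdealSheafData}
    (h : ∀ y, ∃ c : CoordChart π y, (∃ i₀ w σ, c.IsMain f d N E H i₀ w σ) ∨
      ∃ A l, c.IsSide f d N H A l) : HasGoodCharts f d N π E H := by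
  intro y
  obtain ⟨c, ⟨i₀, w, σ, hc⟩ | hc⟩ := h y
  · refine ⟨c, ?_⟩
    by_cases hw : ∀ l, d l ≤ N → ¬ IsUnit (w l)
    · exact .inl ⟨i₀, w, σ, hc, hw⟩
    · push Not at hw
      obtain ⟨l, hl, hw⟩ := hw
      exact .inr ⟨_, l, hc.isSide hl hw⟩
  · exact ⟨c, .inr hc⟩

variable {d₀ s : ℕ}

lemma CoordChart.IsSide.nextCentre_comap {c : CoordChart π y} (E : Y.IdealSheafData)
    {H : Fin r → Y.IdealSheafData} {A : Finset (Fin n)} {l : Fin r}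
    (h : c.IsSide f d (d₀ + s) H A l) : (nextCentre d d₀ s E H).comap c.j = ⊤ := by
  rw [eq_top_iff, ← h.comap_H]
  exact Scheme.IdealSheafData.comap_mono c.j (le_nextCentre h.le)

lemma CoordChart.IsMain.nextCentre_comap {c : CoordChart π y} {E : Y.IdealSheafData}
    {H : Fin r → Y.IdealSheafData} {i₀ : Fin n} {w : Fin r → c.B} {σ : Fin r → Fin n}
    (h : c.IsMain f d (d₀ + s) E H i₀ w σ) (hw : ∀ l, d l ≤ d₀ + s → ¬ IsUnit (w l))
    (T : Finset (Fin n)) (hT : ∀ i, i ∈ T ↔ i = i₀ ∨ ∃ l, d l ≤ d₀ + s ∧ σ l = i) :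
    (nextCentre d d₀ s E H).comap c.j =
      specIdeal (Ideal.span ((fun i => c.e (X i)) '' (T : Set (Fin n)))) := by
  rw [BlowUpRes.nextCentre_comap, nextCentre]
  simp only [h.comap_E, h.comap_H, ← specIdeal_iSup, ← specIdeal_sup]
  congr 1
  apply le_antisymm
  · refine sup_le ?_ (iSup₂_le fun l hl => ?_) <;>
      rw [Ideal.span_singleton_le_iff_mem] <;> apply Ideal.subset_span
    · exact ⟨i₀, (hT _).mpr (.inl rfl), rfl⟩
    · exact ⟨σ l, (hT _).mpr (.inr ⟨l, hl, rfl⟩), (((h.coord l).resolve_left (hw l hl)).1).symm⟩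
  · rw [Ideal.span_le]
    rintro _ ⟨i, hi, rfl⟩
    obtain rfl | ⟨l, hl, rfl⟩ := (hT i).mp hi
    · exact Ideal.mem_sup_left (Ideal.mem_span_singleton_self _)
    · refine Ideal.mem_sup_right ?_
      have h1 : Ideal.span {w l} ≤ ⨆ j, ⨆ (_ : j ∈ {j : Fin r | d j ≤ d₀ + s}), Ideal.span {w j} :=
        le_iSup₂ (f := fun j (_ : j ∈ {j : Fin r | d j ≤ d₀ + s}) => Ideal.span {w j}) l hl
      apply h1
      rw [((h.coord l).resolve_left (hw l hl)).1]
      exact Ideal.mem_span_singleton_self _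

variable {Y' : Scheme.{0}} {ρ : Y' ⟶ Y}

/-- A side chart is not affected by the next blow-up. -/
lemma CoordChart.IsSide.exists_next {E : Y.IdealSheafData} {H : Fin r → Y.IdealSheafData}
    (hρ : IsBlowUp ρ (nextCentre d d₀ s E H)) {y' : Y'} {c : CoordChart π (ρ y')}
    {A : Finset (Fin n)} {l : Fin r} (h : c.IsSide f d (d₀ + s) H A l) :
    ∃ c' : CoordChart (ρ ≫ π) y', c'.IsSide f d (d₀ + (s + 1))
      (fun j => strictTransform ρ (complOpen (nextCentre d d₀ s E H)) (H j)) A l := by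
  obtain ⟨k, hk, hkρ, hk'⟩ := hρ.exists_lift c.j
    (by rw [h.nextCentre_comap]; exact isInvertible_top)
  refine ⟨⟨c.B, k, c.e, c.g, hk, hk' _ c.mem, c.etale, ?_, c.e_C⟩, h.map_origin, ?_, ?_, ?_, h.dvd⟩
  · rw [← Category.assoc, hkρ, c.comp]
  · exact h.le.trans (by omega)
  -- The centre is empty on this chart, so its equation can be taken to be 1; the strict transform
  -- of the empty H l stays empty.
  · rw [comap_strictTransform ρ _ _ hρ.invertible k 1 ⊤, ← specIdeal_top]
    · congr 1
      exact saturation_eq_top (k := 0) trivial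
    · rw [hkρ, h.nextCentre_comap, Ideal.span_singleton_one, specIdeal_top]
    · rw [hkρ, h.comap_H, specIdeal_top]
  · exact h.dvd_pow.trans (pow_dvd_pow _ (by omega))

/-- The charts of the blow-up of a main chart. -/
lemma CoordChart.IsMain.exists_next {E : Y.IdealSheafData} {H : Fin r → Y.IdealSheafData}
    (hρ : IsBlowUp ρ (nextCentre d d₀ s E H)) {y' : Y'} {c : CoordChart π (ρ y')}
    {i₀ : Fin n} {w : Fin r → c.B} {σ : Fin r → Fin n}
    (h : c.IsMain f d (d₀ + s) E H i₀ w σ) (hw : ∀ l, d l ≤ d₀ + s → ¬ IsUnit (w l)) :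
    ∃ c' : CoordChart (ρ ≫ π) y', (∃ i₀ w σ, c'.IsMain f d (d₀ + (s + 1))
      ((nextCentre d d₀ s E H).comap ρ)
      (fun j => strictTransform ρ (complOpen (nextCentre d d₀ s E H)) (H j)) i₀ w σ) ∨
      ∃ A l, c'.IsSide f d (d₀ + (s + 1))
        (fun j => strictTransform ρ (complOpen (nextCentre d d₀ s E H)) (H j)) A l := by
  classical
  let T : Finset (Fin n) := insert i₀ ((Finset.univ.filter fun l => d l ≤ d₀ + s).image σ)
  have hT : ∀ i, i ∈ T ↔ i = i₀ ∨ ∃ l, d l ≤ d₀ + s ∧ σ l = i := by simp [T]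
  have hcen := h.nextCentre_comap hw T hT
  obtain ⟨_, ⟨k, hkT, rfl⟩, hchart⟩ := hρ.exists_chart c.j _ hcen y' c.mem
  obtain ⟨B', β, e', he', hβe, hβ⟩ := exists_linBlowUp c.etale T k hkT
  obtain ⟨j', hj', hy', hj'ρ⟩ := hchart (.of B') (CommRingCat.ofHom β) hβ
  have hβX (i) : β (c.e (X i)) = e' (linBlowUp T k (X i)) := congr($hβe (X i))
  let c' : CoordChart (ρ ≫ π) y' := ⟨.of B', j', e', β.comp c.g, hj', hy', he', by
      rw [← Category.assoc, hj'ρ, Category.assoc, c.comp, ← Spec.map_comp]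
      rfl, fun z => by
      rw [RingHom.comp_apply, ← c.e_C]
      have := congr($hβe (C z))
      simp only [RingHom.comp_apply] at this
      rw [this]
      simp⟩
  have hspan : (nextCentre d d₀ s E H).comap (j' ≫ ρ) =
      specIdeal (R := .of B') (Ideal.span {e' (X k)}) := by
    rw [hj'ρ, Scheme.IdealSheafData.comap_comp, hcen, comap_specIdeal]
    congr 1
    refine hβ.map_eq.trans ?_
    rw [hβX, linBlowUp_X_self]
  have hH (l) : (strictTransform ρ (complOpen (nextCentre d d₀ s E H)) (H l)).comap j' =
      specIdeal (R := .of B') (saturation (e' (X k)) (Ideal.span {β (w l)})) := by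
    refine comap_strictTransform ρ _ _ hρ.invertible j' _ _ hspan ?_
    rw [hj'ρ, Scheme.IdealSheafData.comap_comp, h.comap_H, comap_specIdeal, Ideal.map_span,
      Set.image_singleton]
    rfl
  have horigin : (Ideal.span (Set.range X)).map c'.g = Ideal.span {β (c.e (X i₀))} := by
    change Ideal.map (β.comp c.g) _ = _
    rw [← Ideal.map_map, h.map_origin, Ideal.map_span, Set.image_singleton]
  have hg (l) : c'.g (f l) = β (c.e (X i₀)) ^ max (d l) (d₀ + s) * β (w l) := by
    change β (c.g (f l)) = _
    rw [h.map_eq, map_mul, map_pow]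
  refine ⟨c', ?_⟩
  have hi₀T : i₀ ∈ T := (hT _).mpr (.inl rfl)
  by_cases hk : k = i₀
  · subst hk
    rw [hβX, linBlowUp_X_self] at horigin
    simp only [hβX, linBlowUp_X_self] at hg
    -- In the chart where t generates the centre, w_l = t w_l' for the hypersurfaces through the
    -- centre; the new equation is the coordinate with the same index. The other w_l are only pulled
    -- back.
    let w' (l : Fin r) : c'.B := if d l ≤ d₀ + s then e' (X (σ l)) else β (w l)
    have hβw (l) (hl : d l ≤ d₀ + s) : β (w l) = e' (X k) * w' l := by
      obtain ⟨h1, h2⟩ := (h.coord l).resolve_left (hw l hl)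
      simp only [w', if_pos hl]
      rw [h1, hβX, linBlowUp_X_of_mem ((hT _).mpr (.inr ⟨l, hl, rfl⟩)) h2, map_mul]
    have hcoord (l) : IsUnit (w' l) ∨ w' l = c'.e (X (σ l)) ∧ σ l ≠ k := by
      by_cases hl : d l ≤ d₀ + s
      · right
        exact ⟨if_pos hl, ((h.coord l).resolve_left (hw l hl)).2⟩
      · simp only [w', if_neg hl]
        by_cases hu : IsUnit (w l)
        · exact .inl (hu.map β)
        · obtain ⟨h1, h2⟩ := (h.coord l).resolve_left hu
          refine .inr ⟨?_, h2⟩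
          rw [h1, hβX, linBlowUp_X_of_notMem]
          -- A hypersurface that is not among those defining the centre has its coordinate outside T
          -- by injectivity of σ, so the substitution leaves it unchanged.
          rw [hT]
          rintro (h3 | ⟨l', hl', h3⟩)
          · exact h2 h3
          · exact hl (h.inj _ _ (hw l' hl') hu h3 ▸ hl')
    have hunit (l) (hu : ¬ IsUnit (w' l)) : ¬ IsUnit (w l) := by
      by_cases hl : d l ≤ d₀ + s
      · exact hw l hl
      · simp only [w', if_neg hl] at hu
        exact fun h => hu (h.map β)
    have hsat (l) (x : c'.B) (hx : e' (X k) * x ∈ Ideal.span {w' l}) : x ∈ Ideal.span {w' l} := by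
      rcases hcoord l with hu | ⟨h1, h2⟩
      · rw [Ideal.span_singleton_eq_top.mpr hu]
        trivial
      · rw [h1] at hx ⊢
        exact mem_span_of_coord_mul_mem he' h2 hx
    refine .inl ⟨k, w', σ, horigin, fun l => ?_, hcoord,
      fun l l' hl hl' => h.inj l l' (hunit l hl) (hunit l' hl'), ?_, fun l => ?_⟩
    -- For d_l ≤ N the extra factor t turns t^N into t^{N+1}; for d_l > N both maxima equal d_l.
    · rw [hg]
      by_cases hl : d l ≤ d₀ + s
      · rw [hβw l hl, max_eq_right hl, max_eq_right (by omega), ← mul_assoc, ← pow_succ]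
        rfl
      · rw [max_eq_left (by omega), max_eq_left (by omega)]
        simp only [w', if_neg hl]
        rfl
    · rw [← Scheme.IdealSheafData.comap_comp]
      exact hspan
    · refine (hH l).trans ?_
      congr 1
      by_cases hl : d l ≤ d₀ + s
      · rw [hβw l hl, ← pow_one (e' (X k))]
        simpa using saturation_pow_mul (hsat l) 1
      · have := saturation_pow_mul (hsat l) 0
        rw [pow_zero, one_mul] at this
        convert this using 3
        simp only [w', if_neg hl]
  -- In the chart where a coordinate x_k = w_l generates the centre, t becomes x_{i₀} x_k, so f_l =
  -- (x_{i₀} x_k)^N x_k, while H_l becomes empty.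
  · obtain ⟨l, hl, hlk⟩ := ((hT k).mp hkT).resolve_left hk
    have hβt : β (c.e (X i₀)) = ∏ i ∈ ({i₀, k} : Finset (Fin n)), e' (X i) := by
      rw [hβX, linBlowUp_X_of_mem hi₀T (Ne.symm hk), Finset.prod_pair (Ne.symm hk), map_mul,
        mul_comm]
    rw [hβt] at horigin
    simp only [hβt] at hg
    have hβw (m) (hm : d m ≤ d₀ + s) : e' (X k) ∣ β (w m) := by
      rw [((h.coord m).resolve_left (hw m hm)).1, hβX]
      by_cases hmk : σ m = k
      · rw [hmk, linBlowUp_X_self]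
      · rw [linBlowUp_X_of_mem ((hT _).mpr (.inr ⟨m, hm, rfl⟩)) hmk, map_mul]
        exact dvd_mul_right _ _
    have hβl : β (w l) = e' (X k) := by
      rw [((h.coord l).resolve_left (hw l hl)).1, hlk, hβX, linBlowUp_X_self]
    have hgl : c'.g (f l) = (∏ i ∈ ({i₀, k} : Finset (Fin n)), e' (X i)) ^ (d₀ + s) * e' (X k) := by
      rw [hg, hβl, max_eq_right hl]
    have hdvd : c'.g (f l) ∣ (∏ i ∈ ({i₀, k} : Finset (Fin n)), c'.e (X i)) ^ (d₀ + (s + 1)) := by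
      rw [hgl, ← add_assoc, pow_succ]
      exact mul_dvd_mul_left _ (Finset.dvd_prod_of_mem (fun i => e' (X i)) (by simp))
    refine .inr ⟨{i₀, k}, l, horigin, hl.trans (by omega), ?_, hdvd, fun m => ?_⟩
    · refine (hH l).trans ?_
      rw [hβl, ← specIdeal_top]
      congr 1
      refine saturation_eq_top (k := 1) ?_
      rw [pow_one]
      exact Ideal.mem_span_singleton_self _
    -- For d_m ≤ N the factor x_k also divides w_m; for d_m > N the power (x_{i₀} x_k)^{N+1} already
    -- divides f_m.
    · by_cases hm : d m ≤ d₀ + s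
      · rw [hgl, hg, max_eq_right hm]
        exact mul_dvd_mul_left _ (hβw m hm)
      · refine hdvd.trans ?_
        rw [hg]
        exact (pow_dvd_pow _ (le_trans (by omega) (le_max_left _ _))).mul_right _

lemma HasGoodCharts.next {E : Y.IdealSheafData} {H : Fin r → Y.IdealSheafData}
    (hY : HasGoodCharts f d (d₀ + s) π E H) (hρ : IsBlowUp ρ (nextCentre d d₀ s E H)) :
    HasGoodCharts f d (d₀ + (s + 1)) (ρ ≫ π) ((nextCentre d d₀ s E H).comap ρ)
      (fun j => strictTransform ρ (complOpen (nextCentre d d₀ s E H)) (H j)) := by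
  refine hasGoodCharts_of_isMain fun y' => ?_
  obtain ⟨c, ⟨i₀, w, σ, hc, hw⟩ | ⟨A, l, hc⟩⟩ := hY (ρ y')
  · exact hc.exists_next hρ hw
  · obtain ⟨c', hc'⟩ := hc.exists_next hρ
    exact ⟨c', .inr ⟨A, l, hc'⟩⟩

lemma HasGoodCharts.isProper {E : Y.IdealSheafData} {H : Fin r → Y.IdealSheafData}
    (hY : HasGoodCharts f d (d₀ + s) π E H) (hρ : IsBlowUp ρ (nextCentre d d₀ s E H)) :
    IsProper ρ := by
  classical
  refine hρ.isProper fun y => ?_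
  obtain ⟨c, ⟨i₀, w, σ, hc, hw⟩ | ⟨A, l, hc⟩⟩ := hY y
  · refine ⟨c.B, c.j, _, c.isOpenImmersion, c.mem, ?_, hc.nextCentre_comap hw
      (insert i₀ ((Finset.univ.filter fun l => d l ≤ d₀ + s).image σ)) (by simp)⟩
    exact Submodule.fg_span ((Finset.finite_toSet _).image _)
  · refine ⟨c.B, c.j, ⊤, c.isOpenImmersion, c.mem, ?_, ?_⟩
    · exact ⟨{1}, by simp⟩
    · rw [hc.nextCentre_comap, specIdeal_top]

end Charts

end

end BlowUpRes

namespace BlowUpRes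

noncomputable section

open MvPolynomial

/-! ### The blow-up of the origin -/

section Dehomogenize

variable {n : ℕ}

/-- Setting `X_k = 1`. -/
def dehom (k : Fin n) : MvPolynomial (Fin n) ℂ →ₐ[ℂ] MvPolynomial (Fin n) ℂ :=
  aeval fun i => if i = k then 1 else X i

lemma dehom_X_self (k : Fin n) : dehom k (X k) = 1 := by simp [dehom]

lemma dehom_X_of_ne {k i : Fin n} (h : i ≠ k) : dehom k (X i) = X i := by simp [dehom, h]

/-- The substitution multiplies each dehomogenized variable by X_k, including X_k = X_k · 1, so a
monomial of degree d contributes the factor X_k^d. -/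
lemma linBlowUp_univ_eq {p : MvPolynomial (Fin n) ℂ} {d : ℕ} (hp : p.IsHomogeneous d)
    (k : Fin n) : linBlowUp Finset.univ k p = X k ^ d * dehom k p := by
  have h1 : ∀ i, (if i ∈ Finset.univ ∧ i ≠ k then X k * X i else X i : MvPolynomial (Fin n) ℂ) =
      X k * if i = k then 1 else X i := by
    intro i
    by_cases h : i = k <;> simp [h]
  rw [linBlowUp, dehom, aeval_def, aeval_def, eval₂_eq, eval₂_eq, Finset.mul_sum]
  refine Finset.sum_congr rfl fun m hm => ?_
  have hd : ∑ i ∈ m.support, m i = d := by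
    rw [← hp (mem_support_iff.mp hm), Finsupp.weight_apply, Finsupp.sum]
    simp
  rw [mul_left_comm]
  congr 1
  rw [← hd, ← Finset.prod_pow_eq_pow_sum, ← Finset.prod_mul_distrib]
  refine Finset.prod_congr rfl fun i _ => ?_
  rw [h1, mul_pow]

lemma eval_dehom (k : Fin n) (b : Fin n → ℂ) (p : MvPolynomial (Fin n) ℂ) :
    eval b (dehom k p) = eval (Function.update b k 1) p := by
  have : (eval b).comp (dehom k : MvPolynomial (Fin n) ℂ →+* MvPolynomial (Fin n) ℂ) =
      eval (Function.update b k 1) := by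
    apply MvPolynomial.ringHom_ext
    · intro z
      simp [dehom]
    · intro i
      by_cases h : i = k
      · subst h
        simp [dehom]
      · simp [dehom, h]
  exact congr($this p)

lemma pderiv_dehom_self (k : Fin n) (p : MvPolynomial (Fin n) ℂ) :
    pderiv k (dehom k p) = 0 := by
  induction p using MvPolynomial.induction_on with
  | C a => simp [dehom]
  | add p q hp hq => simp [hp, hq]
  | mul_X p i hp =>
    rw [map_mul, Derivation.leibniz, hp]
    by_cases h : i = k
    · rw [h, dehom_X_self]
      simp
    · rw [dehom_X_of_ne h, pderiv_X_of_ne h]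
      simp

lemma pderiv_dehom_of_ne {k i : Fin n} (hik : i ≠ k) (p : MvPolynomial (Fin n) ℂ) :
    pderiv i (dehom k p) = dehom k (pderiv i p) := by
  induction p using MvPolynomial.induction_on with
  | C a => simp [dehom]
  | add p q hp hq => simp [hp, hq]
  | mul_X p j hp =>
    rw [map_mul, Derivation.leibniz, hp, Derivation.leibniz]
    by_cases h : j = k
    · rw [h, dehom_X_self, pderiv_X_of_ne (Ne.symm hik)]
      simp [dehom_X_self]
    · rw [dehom_X_of_ne h]
      by_cases hij : j = i
      · subst hij
        simp [dehom_X_of_ne h]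
      · rw [pderiv_X_of_ne hij]
        simp [dehom_X_of_ne h]

lemma gradAt_X (b : Fin n → ℂ) (k : Fin n) : gradAt b (X k) = Pi.single k 1 := by
  ext i
  by_cases h : i = k
  · subst h
    simp [gradAt]
  · simp [gradAt, h, pderiv_X_of_ne (Ne.symm h)]

/-- Euler's identity. At a zero of p the gradient is orthogonal to a, so its k-th entry, lost in
dehomogenizing, can be recovered. -/
lemma dotProduct_gradAt {p : MvPolynomial (Fin n) ℂ} {d : ℕ} (hp : p.IsHomogeneous d)
    (a : Fin n → ℂ) : a ⬝ᵥ gradAt a p = d * eval a p := by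
  have := congr(eval a $(hp.sum_X_mul_pderiv))
  simpa [dotProduct, gradAt] using this

/-- The exceptional divisor of the blow-up of the origin and the strict transforms of hypersurfaces
with independent gradients cross normally. -/
lemma linearIndependent_gradAt_dehom {r : ℕ} {f : Fin r → MvPolynomial (Fin n) ℂ} {d : Fin r → ℕ}
    (hhom : ∀ i, (f i).IsHomogeneous (d i)) (k : Fin n) (b : Fin n → ℂ)
    (hli : LinearIndependent ℂ fun l : {l // eval (Function.update b k 1) (f l) = 0} =>
      gradAt (Function.update b k 1) (f l)) :
    LinearIndependent ℂ fun o : Option {l // eval (Function.update b k 1) (f l) = 0} =>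
      gradAt b (o.elim (X k) fun l => dehom k (f l)) := by
  let a := Function.update b k 1
  -- As a_k = 1 and a is orthogonal to the gradient of f_l, L restores the k-th entry, sending the
  -- gradient of the dehomogenization to that of f_l.
  let L : (Fin n → ℂ) →ₗ[ℂ] (Fin n → ℂ) :=
    { toFun := fun v => v - (a ⬝ᵥ v) • Pi.single k 1
      map_add' := fun u v => by rw [dotProduct_add, add_smul]; abel
      map_smul' := fun z v => by
        rw [dotProduct_smul, smul_assoc, ← smul_sub, RingHom.id_apply] }
  have hself (p) : gradAt b (dehom k p) k = 0 := by
    rw [gradAt, pderiv_dehom_self, map_zero]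
  have hne (p) (i) (hi : i ≠ k) : gradAt b (dehom k p) i = gradAt a p i := by
    rw [gradAt, pderiv_dehom_of_ne hi, eval_dehom]
    rfl
  have hL (l : {l // eval a (f l) = 0}) : L (gradAt b (dehom k (f l))) = gradAt a (f l) := by
    have h1 := dotProduct_gradAt (hhom l) a
    rw [l.2, mul_zero] at h1
    have h2 : gradAt b (dehom k (f l)) = gradAt a (f l) - gradAt a (f l) k • Pi.single k 1 := by
      ext i
      by_cases hi : i = k
      · subst hi
        simp [hself]
      · simp [hne _ _ hi, hi]
    change gradAt b (dehom k (f l)) - (a ⬝ᵥ gradAt b (dehom k (f l))) • Pi.single k 1 = _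
    rw [h2, dotProduct_sub, h1, dotProduct_smul]
    simp [a]
  have hli' : LinearIndependent ℂ fun l : {l // eval a (f l) = 0} =>
      gradAt b (dehom k (f l)) := by
    apply LinearIndependent.of_comp L
    have h1 : (L ∘ fun l : {l // eval a (f l) = 0} => gradAt b (dehom k (f l))) =
      fun l : {l // eval a (f l) = 0} => gradAt a (f l) := funext hL
    rw [h1]
    exact hli
  rw [linearIndependent_option]
  refine ⟨?_, ?_⟩
  · exact hli'
  -- The gradient of X_k is the k-th basis vector, whereas the dehomogenized polynomials do not
  -- involve X_k.
  · intro hmem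
    have h0 : (Submodule.span ℂ (Set.range fun l : {l // eval a (f l) = 0} =>
        gradAt b (dehom k (f l)))) ≤ LinearMap.ker (LinearMap.proj (R := ℂ) (φ := fun _ => ℂ) k) := by
      rw [Submodule.span_le]
      rintro _ ⟨l, rfl⟩
      exact hself _
    have h1 : gradAt b (X k) k = 0 := h0 hmem
    rw [gradAt_X, Pi.single_eq_same] at h1
    exact one_ne_zero h1

end Dehomogenize

variable {n r : ℕ} {f : Fin r → MvPolynomial (Fin n) ℂ} {d : Fin r → ℕ} {d₀ : ℕ}

/-- Charts of the blow-up of the origin. -/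
lemma hasGoodCharts_origin (hhom : ∀ i, (f i).IsHomogeneous (d i)) (hd₀ : ∀ l, d₀ ≤ d l)
    (hli : ∀ a : Fin n → ℂ, a ≠ 0 →
      LinearIndependent ℂ fun l : {l // eval a (f l) = 0} => gradAt a (f l))
    {Y : Scheme.{0}} {π : Y ⟶ Aff n} (hπ : IsBlowUp π (originIdeal n)) :
    HasGoodCharts f d (d₀ + 0) π ((originIdeal n).comap π)
      (fun j => strictTransform π (complOpen (originIdeal n)) (hypersurface (f j))) := by
  classical
  refine hasGoodCharts_of_isMain fun y => ?_
  obtain ⟨_, ⟨k, -, rfl⟩, hchart⟩ := hπ.exists_chart (B := .of (MvPolynomial (Fin n) ℂ))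
    (𝟙 (Aff n)) ((X : Fin n → MvPolynomial (Fin n) ℂ) '' ((Finset.univ : Finset (Fin n)) : Set _))
    (by rw [Scheme.IdealSheafData.comap_id, originIdeal, affIdeal_eq_specIdeal]; simp) y ⟨π y, rfl⟩
  obtain ⟨j, hj, ⟨p, hp⟩, hjπ⟩ := hchart (.of (MvPolynomial (Fin n) ℂ))
    (CommRingCat.ofHom (linBlowUp Finset.univ k)) (isBlowUpAlgebra_linBlowUp _ k (Finset.mem_univ k))
  rw [Category.comp_id] at hjπ
  -- The point p need not be closed; étale coordinates are chosen near a closed specialization b of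
  -- it, and their domain contains p.
  obtain ⟨M, hM, hpM⟩ := Ideal.exists_le_maximal p.asIdeal p.2.ne_top
  obtain ⟨b, hb⟩ := isMaximal_iff_eq_vanishingIdeal_singleton.mp hM
  have ha : Function.update b k 1 ≠ 0 := fun h => by simpa using congr_fun h k
  -- X_k serves as a coordinate even where it does not vanish. The product of the dehomogenized
  -- equations that are non-zero at b is inverted, so that these become units.
  obtain ⟨Δ, e, σ, hΔ, he, hσ, heσ, heC, hu⟩ := exists_etale_coords _ b
    (linearIndependent_gradAt_dehom hhom k b (hli _ ha))
    (∏ l with eval (Function.update b k 1) (f l) ≠ 0, dehom k (f l)) (by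
      rw [map_prod, Finset.prod_ne_zero_iff]
      intro l hl
      rw [eval_dehom]
      exact (Finset.mem_filter.mp hl).2)
  have hΔp : Δ ∉ p.asIdeal := fun h => hΔ (by
    have := hpM h
    rw [hb] at this
    exact this b rfl)
  obtain ⟨q, hq⟩ := mem_range_awayChart.mpr hΔp
  let α := algebraMap (MvPolynomial (Fin n) ℂ) (Localization.Away Δ)
  have hunit (l) (hl : eval (Function.update b k 1) (f l) ≠ 0) : IsUnit (α (dehom k (f l))) :=
    isUnit_of_dvd_unit (map_dvd α (Finset.dvd_prod_of_mem (fun l => dehom k (f l)) (by simpa))) hu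
  let c : CoordChart π y := ⟨.of (Localization.Away Δ), awayChart Δ ≫ j, e,
    α.comp (linBlowUp Finset.univ k), inferInstance, ⟨q, by
      rw [Scheme.Hom.comp_apply, hq]
      exact hp⟩, he, by
      rw [Category.assoc, hjπ, ← Spec.map_comp]
      rfl, fun z => by
      rw [heC]
      simp [α]⟩
  have het : e (X (σ none)) = α (X k) := heσ none
  have horigin : (Ideal.span (Set.range X)).map c.g = Ideal.span {e (X (σ none))} := by
    have h1 := (isBlowUpAlgebra_linBlowUp Finset.univ k (Finset.mem_univ k)).map_eq
    rw [Finset.coe_univ, Set.image_univ] at h1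
    change Ideal.map (α.comp _) _ = _
    rw [← Ideal.map_map, h1, Ideal.map_span, Set.image_singleton, het]
    congr 3
    exact linBlowUp_X_self _ _
  have hg (l) : c.g (f l) = e (X (σ none)) ^ d l * α (dehom k (f l)) := by
    change α (linBlowUp _ _ _) = _
    rw [linBlowUp_univ_eq (hhom l), map_mul, map_pow, het]
  -- The default value is irrelevant: it is used only when the equation is a unit.
  let σ' (l : Fin r) : Fin n :=
    if h : eval (Function.update b k 1) (f l) = 0 then σ (some ⟨l, h⟩) else σ none
  have hcoord (l) : IsUnit (α (dehom k (f l))) ∨ α (dehom k (f l)) = e (X (σ' l)) ∧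
      σ' l ≠ σ none := by
    by_cases hl : eval (Function.update b k 1) (f l) = 0
    · simp only [σ', dif_pos hl]
      exact .inr ⟨(heσ (some ⟨l, hl⟩)).symm, fun h => by simpa using hσ h⟩
    · exact .inl (hunit l hl)
  refine ⟨c, .inl ⟨σ none, fun l => α (dehom k (f l)), σ', horigin, fun l => ?_, hcoord, ?_, ?_,
    fun l => ?_⟩⟩
  · rw [hg, add_zero, max_eq_left (hd₀ l)]
  · intro l l' hl hl' h
    have h1 := not_imp_comm.mp (hunit l) hl
    have h2 := not_imp_comm.mp (hunit l') hl'
    simp only [σ', dif_pos h1, dif_pos h2] at h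
    simpa using hσ h
  · rw [← Scheme.IdealSheafData.comap_comp, originIdeal, comap_affIdeal c.comp, horigin]
  · rw [comap_strictTransform π _ _ hπ.invertible c.j (e (X (σ none))) _
      (by rw [originIdeal, comap_affIdeal c.comp, horigin])
      (by rw [hypersurface, comap_affIdeal c.comp])]
    congr 1
    rw [Ideal.map_span, Set.image_singleton, hg]
    refine saturation_pow_mul (fun x hx => ?_) _
    rcases hcoord l with hu | ⟨h1, h2⟩
    · rw [Ideal.span_singleton_eq_top.mpr hu]
      trivial
    · rw [h1] at hx ⊢
      exact mem_span_of_coord_mul_mem he h2 hx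

end

end BlowUpRes

namespace BlowUpRes

noncomputable section

open MvPolynomial

/-! ### The tower: existence, properness, isomorphism away from the origin -/

variable {n r : ℕ} {f : Fin r → MvPolynomial (Fin n) ℂ} {d : Fin r → ℕ} {d₀ s : ℕ}
  {Y : Scheme.{0}} {π : Y ⟶ Aff n} {E : Y.IdealSheafData} {H : Fin r → Y.IdealSheafData}

lemma exists_isTower (f : Fin r → MvPolynomial (Fin n) ℂ) (d : Fin r → ℕ) (d₀ s : ℕ) :
    ∃ (Y : Scheme.{0}) (π : Y ⟶ Aff n) (E : Y.IdealSheafData) (H : Fin r → Y.IdealSheafData),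
      IsTower f d d₀ s π E H := by
  induction s with
  | zero =>
    obtain ⟨Y, π, hπ⟩ := exists_isBlowUp (Aff n) (originIdeal n)
    exact ⟨Y, π, _, _, .origin π hπ⟩
  | succ s ih =>
    obtain ⟨Y, π, E, H, h⟩ := ih
    obtain ⟨Y', ρ, hρ⟩ := exists_isBlowUp Y (nextCentre d d₀ s E H)
    exact ⟨Y', _, _, _, .next h ρ hρ⟩

lemma IsTower.hasGoodCharts (h : IsTower f d d₀ s π E H)
    (hhom : ∀ i, (f i).IsHomogeneous (d i)) (hd₀ : ∀ l, d₀ ≤ d l)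
    (hli : ∀ a : Fin n → ℂ, a ≠ 0 →
      LinearIndependent ℂ fun l : {l // eval a (f l) = 0} => gradAt a (f l)) :
    HasGoodCharts f d (d₀ + s) π E H := by
  induction h with
  | origin π hπ => exact hasGoodCharts_origin hhom hd₀ hli hπ
  | next h ρ hρ ih => exact ih.next hρ

lemma IsTower.isProper (h : IsTower f d d₀ s π E H)
    (hhom : ∀ i, (f i).IsHomogeneous (d i)) (hd₀ : ∀ l, d₀ ≤ d l)
    (hli : ∀ a : Fin n → ℂ, a ≠ 0 →
      LinearIndependent ℂ fun l : {l // eval a (f l) = 0} => gradAt a (f l)) :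
    IsProper π := by
  induction h with
  | origin π hπ =>
    refine hπ.isProper fun x => ⟨_, 𝟙 _, _, inferInstance, ⟨x, rfl⟩,
      Submodule.fg_span (Set.finite_range X), ?_⟩
    rw [Scheme.IdealSheafData.comap_id, originIdeal, affIdeal_eq_specIdeal]
  | next h ρ hρ ih =>
    have := (h.hasGoodCharts hhom hd₀ hli).isProper hρ
    infer_instance

/-- All centres lie over the origin. Hence over the complement of the origin they are empty and the
blow-ups are isomorphisms. -/
lemma IsTower.comap_originIdeal_le (h : IsTower f d d₀ s π E H) :
    (originIdeal n).comap π ≤ E := by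
  induction h with
  | origin π hπ => exact le_rfl
  | next h ρ hρ ih =>
    rw [Scheme.IdealSheafData.comap_comp]
    exact Scheme.IdealSheafData.comap_mono ρ (ih.trans le_sup_left)

lemma IsTower.isIso_restrict (h : IsTower f d d₀ s π E H) :
    IsIso (π ∣_ complOpen (originIdeal n)) := by
  induction h with
  | origin π hπ =>
    refine hπ.isIso_restrict _ ?_
    rw [comap_complOpen_ι]
    exact isInvertible_top
  | @next s Y Y' π E H h ρ hρ ih =>
    rw [morphismRestrict_comp]
    have : IsIso (ρ ∣_ (π ⁻¹ᵁ complOpen (originIdeal n))) := by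
      refine hρ.isIso_restrict _ ?_
      have h1 : (nextCentre d d₀ s E H).comap (π ⁻¹ᵁ complOpen (originIdeal n)).ι = ⊤ := by
        rw [eq_top_iff, preimage_complOpen, ← comap_complOpen_ι ((originIdeal n).comap π)]
        exact Scheme.IdealSheafData.comap_mono _ (h.comap_originIdeal_le.trans le_sup_left)
      rw [h1]
      exact isInvertible_top
    exact IsIso.comp_isIso' this ih

lemma CoordChart.prod_mem_nonZeroDivisors {y : Y} (c : CoordChart π y) (A : Finset (Fin n)) :
    ∏ i ∈ A, c.e (X i) ∈ nonZeroDivisors c.B :=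
  prod_mem fun i _ => coord_mem_nonZeroDivisors c.etale i

/-- On the charts of the tower, the inverse image of the origin is a normal crossing divisor. -/
lemma HasGoodCharts.exists_origin {N : ℕ} (h : HasGoodCharts f d N π E H) (y : Y) :
    ∃ (c : CoordChart π y) (A : Finset (Fin n)),
      (Ideal.span (Set.range X)).map c.g = Ideal.span {∏ i ∈ A, c.e (X i)} := by
  obtain ⟨c, ⟨i₀, w, σ, hc, hw⟩ | ⟨A, l, hc⟩⟩ := h y
  · exact ⟨c, {i₀}, by rw [hc.map_origin, Finset.prod_singleton]⟩
  · exact ⟨c, A, hc.map_origin⟩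

lemma HasGoodCharts.isInvertible_origin {N : ℕ} (h : HasGoodCharts f d N π E H) :
    IsInvertible ((originIdeal n).comap π) := by
  refine isInvertible_of_chart fun y => ?_
  obtain ⟨c, A, hc⟩ := h.exists_origin y
  refine ⟨c.B, c.j, _, c.isOpenImmersion, c.mem, c.prod_mem_nonZeroDivisors A, ?_⟩
  rw [← Scheme.IdealSheafData.comap_comp, originIdeal, comap_affIdeal c.comp, hc]

end

end BlowUpRes

namespace BlowUpRes

noncomputable section

open MvPolynomial

/-! ### Quotients by étale coordinates -/

section CoordQuotient

variable {n : ℕ} {B : Type} [CommRing B] {e : MvPolynomial (Fin n) ℂ →+* B}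

lemma smooth_comp_C (σ : Type) [Finite σ] {B : Type} [CommRing B] {e : MvPolynomial σ ℂ →+* B}
    (he : e.Etale) : (e.comp C).Smooth := by
  refine RingHom.Smooth.comp ?_ ((RingHom.etale_iff_formallyUnramified_and_smooth e).mp he).2
  rw [← algebraMap_eq, RingHom.smooth_algebraMap]
  exact ⟨inferInstance, inferInstance⟩

/-- The quotient is étale over the polynomial ring in the remaining variables. -/
lemma smooth_quotient_coord (he : e.Etale) (A : Finset (Fin n)) :
    ((Ideal.Quotient.mk (Ideal.span ((fun i => e (X i)) '' (A : Set (Fin n))))).comp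
      (e.comp C)).Smooth := by
  obtain ⟨B', ρ, e', he', hρ, hsurj, hker⟩ := exists_coord_quotient he A
  rw [← hker]
  let E := RingHom.quotientKerEquivOfSurjective hsurj
  have h1 : (Ideal.Quotient.mk (RingHom.ker ρ)).comp (e.comp C) =
      (E.symm : B' →+* B ⧸ RingHom.ker ρ).comp (e'.comp C) := by
    refine RingHom.ext fun z => ?_
    simp only [RingHom.comp_apply]
    have h2 := congr($hρ (C z))
    simp only [RingHom.comp_apply, killVars_C] at h2
    rw [← h2]
    exact (E.symm_apply_apply _).symm
  rw [h1]
  exact (smooth_comp_C _ he').comp (.of_bijective E.symm.bijective)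

lemma isReduced_quotient_coord (he : e.Etale) (A : Finset (Fin n)) :
    _root_.IsReduced (B ⧸ Ideal.span ((fun i => e (X i)) '' (A : Set (Fin n)))) := by
  obtain ⟨B', ρ, e', he', hρ, hsurj, hker⟩ := exists_coord_quotient he A
  rw [← hker]
  have := isReduced_of_etale he'
  exact isReduced_of_injective (RingHom.quotientKerEquivOfSurjective hsurj)
    (RingEquiv.injective _)

lemma mem_span_coords_of_coord_mul_mem (he : e.Etale) {A : Finset (Fin n)} {i : Fin n}
    (hi : i ∉ A) {x : B}
    (hx : e (X i) * x ∈ Ideal.span ((fun i => e (X i)) '' (A : Set (Fin n)))) :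
    x ∈ Ideal.span ((fun i => e (X i)) '' (A : Set (Fin n))) := by
  obtain ⟨B', ρ, e', he', hρ, hsurj, hker⟩ := exists_coord_quotient he A
  rw [← hker, RingHom.mem_ker] at hx ⊢
  have h2 := congr($hρ (X i))
  simp only [RingHom.comp_apply, killVars_X_of_notMem hi] at h2
  rw [map_mul, h2] at hx
  have h3 := mem_nonZeroDivisors_of_etale he' (x := X ⟨i, hi⟩) (X_ne_zero _)
  exact (mul_left_mem_nonZeroDivisors_eq_zero_iff h3).mp hx

end CoordQuotient

/-! ### The singular locus of `Z` -/

section Singular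

variable {n r : ℕ} {f : Fin r → MvPolynomial (Fin n) ℂ} {d : Fin r → ℕ}

/-- The polynomial ring is Jacobson, so x is an intersection of maximal ideals, one of which omits
X_k; by the Nullstellensatz it is a point b. -/
lemma exists_eval_eq_zero_of_notMem (x : Aff n) {k : Fin n}
    (hk : (X k : MvPolynomial (Fin n) ℂ) ∉ x.asIdeal) :
    ∃ b : Fin n → ℂ, b k ≠ 0 ∧ ∀ p ∈ x.asIdeal, eval b p = 0 := by
  have h1 : x.asIdeal.jacobson = x.asIdeal :=
    IsJacobsonRing.out (R := MvPolynomial (Fin n) ℂ) inferInstance x.2.isRadical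
  rw [← h1, Ideal.jacobson, Ideal.mem_sInf] at hk
  push Not at hk
  obtain ⟨M, ⟨hxM, hM⟩, hkM⟩ := hk
  obtain ⟨b, rfl⟩ := isMaximal_iff_eq_vanishingIdeal_singleton.mp hM
  refine ⟨b, ?_, fun p hp => ?_⟩
  · rw [mem_vanishingIdeal_singleton_iff] at hkM
    simpa using hkM
  · have := hxM hp
    rw [mem_vanishingIdeal_singleton_iff] at this
    simpa using this

/-- Away from the origin the subscheme is given by coordinates. -/
lemma exists_coords_zeroScheme
    (hli : ∀ a : Fin n → ℂ, a ≠ 0 →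
      LinearIndependent ℂ fun l : {l // eval a (f l) = 0} => gradAt a (f l))
    (x : Aff n) (hx : x ∈ complOpen (originIdeal n)) (hxZ : x ∈ (zeroScheme f).support) :
    ∃ (Δ : MvPolynomial (Fin n) ℂ) (e : MvPolynomial (Fin n) ℂ →+* Localization.Away Δ)
      (A : Finset (Fin n)), Δ ∉ x.asIdeal ∧ e.Etale ∧
      (∀ c, e (C c) = algebraMap (MvPolynomial (Fin n) ℂ) _ (C c)) ∧
      Set.range (awayChart Δ) ⊆ complOpen (originIdeal n) ∧
      (zeroScheme f).comap (awayChart Δ) = specIdeal (R := .of (Localization.Away Δ))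
        (Ideal.span ((fun i => e (X i)) '' (A : Set (Fin n)))) := by
  classical
  obtain ⟨k, hk⟩ := mem_complOpen_originIdeal.mp hx
  obtain ⟨b, hbk, hb⟩ := exists_eval_eq_zero_of_notMem x hk
  rw [zeroScheme, affIdeal_eq_specIdeal, mem_support_specIdeal, Ideal.span_le] at hxZ
  have hbf (l) : eval b (f l) = 0 := hb _ (hxZ ⟨l, rfl⟩)
  have hb0 : b ≠ 0 := fun h => hbk (by rw [h]; rfl)
  obtain ⟨Δ, e, σ, hΔ, he, hσ, heσ, heC, hu⟩ := exists_etale_coords _ b (hli b hb0) (X k)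
    (by rwa [eval_X])
  refine ⟨Δ, e, Finset.univ.image σ, fun h => hΔ (hb _ h), he, heC, ?_, ?_⟩
  · intro z hz
    refine mem_complOpen_originIdeal.mpr ⟨k, fun hkz => ?_⟩
    obtain ⟨w, rfl⟩ := hz
    exact w.2.ne_top (Ideal.eq_top_of_isUnit_mem _ hkz hu)
  · rw [zeroScheme, affIdeal_eq_specIdeal, comap_specIdeal, Ideal.map_span, ← Set.range_comp]
    congr 2
    ext z
    simp only [Set.mem_range, Set.mem_image, Finset.coe_image, Finset.coe_univ, Set.image_univ,
      exists_exists_eq_and, heσ]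
    exact ⟨fun ⟨l, hl⟩ => ⟨⟨l, hbf l⟩, hl⟩, fun ⟨l, hl⟩ => ⟨l, hl⟩⟩

lemma smoothOn_zeroScheme
    (hli : ∀ a : Fin n → ℂ, a ≠ 0 →
      LinearIndependent ℂ fun l : {l // eval a (f l) = 0} => gradAt a (f l)) :
    SmoothOn (affStr n) (zeroScheme f) (complOpen (originIdeal n)) := by
  refine smooth_of_charts fun x hx => ?_
  have hx' : (complOpen (originIdeal n)).ι x ∈ (zeroScheme f).support := by
    rw [Scheme.IdealSheafData.support_comap] at hx
    exact hx
  obtain ⟨Δ, e, A, hΔ, he, heC, hr, hZ⟩ := exists_coords_zeroScheme hli _ x.2 hx'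
  have hr' : Set.range (awayChart Δ) ⊆ Set.range (complOpen (originIdeal n)).ι := by
    simpa using hr
  have hfac := IsOpenImmersion.lift_fac (complOpen (originIdeal n)).ι (awayChart Δ) hr'
  refine ⟨.of (Localization.Away Δ),
    IsOpenImmersion.lift (complOpen (originIdeal n)).ι (awayChart Δ) hr', _, e.comp C, ?_, ?_, ?_,
    ?_, smooth_quotient_coord he A⟩
  · have : IsOpenImmersion (IsOpenImmersion.lift (complOpen (originIdeal n)).ι (awayChart Δ) hr' ≫
        (complOpen (originIdeal n)).ι) := by
      rw [hfac]
      infer_instance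
    exact .of_comp _ (complOpen (originIdeal n)).ι
  · obtain ⟨z, hz⟩ := mem_range_awayChart.mpr hΔ
    refine ⟨z, (complOpen (originIdeal n)).ι.isOpenEmbedding.injective ?_⟩
    rw [← Scheme.Hom.comp_apply, hfac]
    exact hz
  · rw [← Scheme.IdealSheafData.comap_comp, hfac, hZ]
  · rw [← Category.assoc, hfac, awayChart_affStr]
    congr 2
    exact RingHom.ext fun c => (heC c).symm

/-- Euler's identity, divided by the degree. -/
lemma mem_span_X_of_isHomogeneous {p : MvPolynomial (Fin n) ℂ} {m : ℕ} (hp : p.IsHomogeneous m)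
    (hm : m ≠ 0) : p ∈ Ideal.span (Set.range (X : Fin n → MvPolynomial (Fin n) ℂ)) := by
  have h1 : (m : MvPolynomial (Fin n) ℂ) * p ∈
      Ideal.span (Set.range (X : Fin n → MvPolynomial (Fin n) ℂ)) := by
    rw [← nsmul_eq_mul, ← hp.sum_X_mul_pderiv]
    exact Ideal.sum_mem _ fun i _ => Ideal.mul_mem_right _ _ (Ideal.subset_span ⟨i, rfl⟩)
  have h2 : p = C ((m : ℂ)⁻¹) * ((m : MvPolynomial (Fin n) ℂ) * p) := by
    rw [← mul_assoc, ← map_natCast (C : ℂ →+* MvPolynomial (Fin n) ℂ), ← C_mul,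
      inv_mul_cancel₀ (Nat.cast_ne_zero.mpr hm), C_1, one_mul]
  rw [h2]
  exact Ideal.mul_mem_left _ _ h1

lemma isHomogeneous_pderiv {p : MvPolynomial (Fin n) ℂ} {m : ℕ} (hp : p.IsHomogeneous m)
    (k : Fin n) : (pderiv k p).IsHomogeneous (m - 1) := hp.pderiv

lemma eq_affPt_zero {x : Aff n} (hx : x ∉ complOpen (originIdeal n)) : x = affPt 0 := by
  rw [mem_complOpen_originIdeal] at hx
  push Not at hx
  have hle : Ideal.span (Set.range (X : Fin n → MvPolynomial (Fin n) ℂ)) ≤ x.asIdeal := by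
    rw [Ideal.span_le]
    rintro _ ⟨k, rfl⟩
    exact hx k
  have hmem (p : MvPolynomial (Fin n) ℂ) : p - C (eval 0 p) ∈ x.asIdeal := by
    induction p using MvPolynomial.induction_on with
    | C a => simp
    | add p q hp hq =>
      have := add_mem hp hq
      rwa [show p - C (eval 0 p) + (q - C (eval 0 q)) = p + q - C (eval 0 (p + q)) by
        simp only [map_add]; ring] at this
    | mul_X p i _ =>
      simpa using Ideal.mul_mem_left x.asIdeal p (hx i)
  refine PrimeSpectrum.ext ?_
  ext p
  rw [mem_affPt]
  have h1 := hmem p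
  constructor
  · intro hp
    have h2 : C (eval 0 p) ∈ x.asIdeal := by simpa using sub_mem hp h1
    by_contra h0
    exact x.2.ne_top (Ideal.eq_top_of_isUnit_mem _ h2 ((isUnit_iff_ne_zero.mpr h0).map C))
  · intro hp
    rwa [hp, C_0, sub_zero] at h1

/-- A subscheme defined by equations of order at least two at the origin is singular there. -/
lemma not_smoothOn_zeroScheme (hr : 0 < r) (hhom : ∀ i, (f i).IsHomogeneous (d i))
    (hd : ∀ i, 2 ≤ d i) (hf : ∀ i, f i ≠ 0) {W : (Aff n).Opens}
    (hW : SmoothOn (affStr n) (zeroScheme f) W) : W ≤ complOpen (originIdeal n) := by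
  intro x hxW
  by_contra hx
  obtain rfl := eq_affPt_zero hx
  obtain ⟨h, k, hh, hk, hki⟩ := exists_awayChart_lift W.ι (affPt 0) (by simpa using hxW)
  rw [mem_affPt] at hh
  have h0 : h ≠ 0 := fun e => hh (by rw [e, map_zero])
  have := isDomain_away h0
  let α := algebraMap (MvPolynomial (Fin n) ℂ) (Localization.Away h)
  let I := (Ideal.span (Set.range f)).map α
  let m := (Ideal.span (Set.range (X : Fin n → MvPolynomial (Fin n) ℂ))).map α
  have hsm := smooth_quotient_of_smooth (q := W.ι ≫ affStr n) (B := .of (Localization.Away h)) hW k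
    I (by
      rw [← Scheme.IdealSheafData.comap_comp, hki, zeroScheme, affIdeal_eq_specIdeal,
        comap_specIdeal]
      rfl) (α.comp C) (by rw [← Category.assoc, hki]; exact awayChart_affStr h)
  have hmem (l) : α (f l) ∈ I := Ideal.mem_map_of_mem α (Ideal.subset_span ⟨l, rfl⟩)
  have hIm : I ≤ m := by
    refine Ideal.map_mono (Ideal.span_le.mpr ?_)
    rintro _ ⟨l, rfl⟩
    exact mem_span_X_of_isHomogeneous (hhom l) (by have := hd l; omega)
  have hle : I ≤ m • I := by
    change Ideal.map α _ ≤ _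
    rw [Ideal.map_span, Ideal.span_le]
    rintro _ ⟨_, ⟨l, rfl⟩, rfl⟩
    -- The degree is at least two, so the partial derivatives lie in m; smoothness would give I ⊆ m
    -- I + I² ⊆ m I.
    obtain ⟨c, hcI, hc⟩ := exists_sub_sum_mem_sq α _ hsm (f l) (hmem l)
    have h1 : ∑ k, α (pderiv k (f l)) * c k ∈ m • I :=
      Ideal.sum_mem _ fun k _ => Ideal.mul_mem_mul (Ideal.mem_map_of_mem α
        (mem_span_X_of_isHomogeneous (isHomogeneous_pderiv (hhom l) k)
          (by have := hd l; omega))) (hcI k)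
    have h2 : α (f l) - ∑ k, α (pderiv k (f l)) * c k ∈ m • I := by
      rw [pow_two] at hc
      exact Ideal.mul_mono_left hIm hc
    simpa using add_mem h2 h1
  have hfg : I.FG := Ideal.FG.map (Submodule.fg_span (Set.finite_range f)) α
  -- Nakayama gives z ≡ 1 modulo m with z I = 0. In a domain with I ≠ 0 this forces z = 0, which is
  -- contradicted at the origin.
  obtain ⟨z, hz, hzI⟩ := Submodule.exists_sub_one_mem_and_smul_eq_zero_of_fg_of_le_smul m I hfg hle
  have hαf : α (f ⟨0, hr⟩) ≠ 0 :=
    fun e => hf _ (algebraMap_away_injective h0 (e.trans (map_zero _).symm))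
  have hz0 : z = 0 := (mul_eq_zero.mp (hzI _ (hmem ⟨0, hr⟩))).resolve_right hαf
  have hm0 : m ≤ RingHom.ker (evalAway hh) := by
    rw [Ideal.map_le_iff_le_comap, Ideal.span_le]
    rintro _ ⟨k, rfl⟩
    change evalAway hh (α (X k)) = 0
    rw [evalAway_algebraMap]
    simp
  have h3 : evalAway hh (z - 1) = 0 := hm0 hz
  rw [hz0] at h3
  simp at h3

/-- The singular locus is the origin. -/
lemma complSing_zeroScheme (hr : 0 < r) (hhom : ∀ i, (f i).IsHomogeneous (d i))
    (hd : ∀ i, 2 ≤ d i) (hf : ∀ i, f i ≠ 0)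
    (hli : ∀ a : Fin n → ℂ, a ≠ 0 →
      LinearIndependent ℂ fun l : {l // eval a (f l) = 0} => gradAt a (f l)) :
    complSing (affStr n) (zeroScheme f) = complOpen (originIdeal n) :=
  le_antisymm (sSup_le fun _ hW => not_smoothOn_zeroScheme hr hhom hd hf hW)
    (le_sSup (smoothOn_zeroScheme hli))

end Singular

end

end BlowUpRes

namespace BlowUpRes

noncomputable section

open MvPolynomial

/-! ### The exceptional locus -/

section Exceptional

variable {n : ℕ} {Y : Scheme.{0}} {π : Y ⟶ Aff n}

/-- A non-zero-divisor of a non-zero ring is not nilpotent, so its basic open set is non-empty on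
every non-empty chart. -/
lemma dense_complOpen {X : Scheme.{0}} {I : X.IdealSheafData} (hI : IsInvertible I) :
    Dense (complOpen I : Set X) := by
  rw [dense_iff_inter_open]
  rintro V hV ⟨x, hx⟩
  obtain ⟨B, j, g, hj, ⟨z, -⟩, hjV, hg, hIg⟩ := hI.exists_chart x ⟨V, hV⟩ hx
  have : Nontrivial B := ⟨0, 1, fun h => z.2.ne_top ((Ideal.eq_top_iff_one _).mpr (by
    rw [← h]
    exact zero_mem _))⟩
  have hnil : ¬ IsNilpotent g := by
    rintro ⟨k, hk⟩
    exact zero_notMem_nonZeroDivisors (M₀ := B) (hk ▸ pow_mem hg k)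
  rw [← mem_nilradical, nilradical_eq_sInf, Ideal.mem_sInf] at hnil
  push Not at hnil
  obtain ⟨p, hp, hgp⟩ := hnil
  let y : Spec B := (⟨p, hp⟩ : PrimeSpectrum B)
  refine ⟨j y, hjV ⟨y, rfl⟩, ?_⟩
  change j y ∈ complOpen I
  rw [mem_complOpen]
  intro h
  have h1 : y ∈ (I.comap j).support := by
    rw [Scheme.IdealSheafData.support_comap]
    exact h
  rw [hIg, mem_support_specIdeal, Ideal.span_singleton_le_iff_mem] at h1
  exact hgp h1

/-- The ideal of a point of a space of dimension at least two is not principal. -/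
lemma map_origin_ne_span_singleton (hn : 2 ≤ n) {h : MvPolynomial (Fin n) ℂ}
    (hh : eval 0 h ≠ 0) (g : Localization.Away h) :
    (Ideal.span (Set.range X)).map (algebraMap (MvPolynomial (Fin n) ℂ) (Localization.Away h)) ≠
      Ideal.span {g} := by
  intro heq
  have hm0 : (Ideal.span (Set.range X)).map
      (algebraMap (MvPolynomial (Fin n) ℂ) (Localization.Away h)) ≤
      RingHom.ker (evalAway hh) := by
    rw [Ideal.map_le_iff_le_comap, Ideal.span_le]
    rintro _ ⟨k, rfl⟩
    change evalAway hh (algebraMap (MvPolynomial (Fin n) ℂ) _ (X k)) = 0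
    rw [evalAway_algebraMap]
    simp
  have hg0 : evalAway hh g = 0 := hm0 (heq ▸ Ideal.mem_span_singleton_self g)
  have hX (i : Fin n) : g ∣ algebraMap (MvPolynomial (Fin n) ℂ) _ (X i) := by
    rw [← Ideal.mem_span_singleton, ← heq]
    exact Ideal.mem_map_of_mem _ (Ideal.subset_span ⟨i, rfl⟩)
  choose c hc using hX
  obtain ⟨γ, hγ⟩ := exists_coeff_one_lineAway hh g
  -- Differentiating X_i = g c_i at the origin in the direction v, where g vanishes, makes every
  -- linear form v_i a multiple of the single form γ · v; two independent coordinates exclude this.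
  have key (i : Fin n) (v : Fin n → ℂ) : v i = (γ ⬝ᵥ v) * evalAway hh (c i) := by
    have h1 := congr_arg (fun z => PowerSeries.coeff 1 (lineAway hh v z)) (hc i)
    simp only [map_mul] at h1
    rw [lineAway_algebraMap, PowerSeries.coeff_one_mul, coeff_one_lineHom, gradAt_X, hγ,
      constantCoeff_lineAway, constantCoeff_lineAway, hg0] at h1
    simpa [mul_comm] using h1
  let i₀ : Fin n := ⟨0, by omega⟩
  let i₁ : Fin n := ⟨1, by omega⟩
  have hne : i₁ ≠ i₀ := by simp [i₀, i₁]
  have h00 := key i₀ (Pi.single i₀ 1)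
  have h10 := key i₁ (Pi.single i₀ 1)
  have h11 := key i₁ (Pi.single i₁ 1)
  rw [Pi.single_eq_same] at h00 h11
  rw [Pi.single_eq_of_ne hne] at h10
  rcases mul_eq_zero.mp h10.symm with h | h
  · rw [h, zero_mul] at h00
    exact one_ne_zero h00
  · rw [h, mul_zero] at h11
    exact one_ne_zero h11

lemma excLocus_le (hiso : IsIso (π ∣_ complOpen (originIdeal n))) :
    excLocus π ≤ ((originIdeal n).comap π).support := by
  have h1 : complOpen ((originIdeal n).comap π) ≤ locIsoOpen π := by
    rw [← preimage_complOpen]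
    refine le_sSup ?_
    change IsOpenImmersion _
    rw [← morphismRestrict_ι]
    infer_instance
  intro x hx
  by_contra hx'
  exact hx (h1 (mem_complOpen.mpr hx'))

/-- The exceptional locus is the inverse image of the origin. -/
lemma excLocus_eq (hn : 2 ≤ n) (hiso : IsIso (π ∣_ complOpen (originIdeal n)))
    (hinv : IsInvertible ((originIdeal n).comap π)) :
    excLocus π = ((originIdeal n).comap π).support := by
  refine le_antisymm (excLocus_le hiso) ?_
  intro y hy hy'
  rw [Scheme.IdealSheafData.support_comap] at hy
  have hπy : π y = affPt 0 := eq_affPt_zero fun h => mem_complOpen.mp h hy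
  have hy'' : y ∈ locIsoOpen π := hy'
  rw [locIsoOpen, Opens.mem_sSup] at hy''
  -- If π were a local isomorphism at y, invertibility upstairs would make the ideal of the origin
  -- principal near the origin of 𝐀ⁿ.
  obtain ⟨(V : Y.Opens), hV : IsOpenImmersion (V.ι ≫ π), hyV⟩ := hy''
  obtain ⟨B, j, g, hj, ⟨z, hz⟩, -, hg, hIg⟩ :=
    (hinv.comap_of_isOpenImmersion V.ι).exists_chart ⟨y, hyV⟩ ⊤ trivial
  have hmem : affPt 0 ∈ Set.range (j ≫ V.ι ≫ π) := by
    refine ⟨z, ?_⟩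
    rw [Scheme.Hom.comp_apply, hz, ← hπy]
    rfl
  obtain ⟨h, k, hh, hk, hki⟩ := exists_awayChart_lift (j ≫ V.ι ≫ π) (affPt 0) hmem
  rw [mem_affPt] at hh
  obtain ⟨φ, rfl⟩ := Spec.map_surjective k
  have h1 := congr_arg (fun I => Scheme.IdealSheafData.comap I (Spec.map φ)) hIg
  simp only [← Scheme.IdealSheafData.comap_comp] at h1
  rw [hki, originIdeal, affIdeal_eq_specIdeal, comap_specIdeal, comap_specIdeal, specIdeal_inj,
    Ideal.map_span φ.hom, Set.image_singleton] at h1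
  exact map_origin_ne_span_singleton hn hh _ h1

end Exceptional

/-! ### Heights and generizations of the origin -/

section Height

variable {n : ℕ}

lemma isPrime_span_X (A : Finset (Fin n)) :
    (Ideal.span (X '' (A : Set (Fin n))) : Ideal (MvPolynomial (Fin n) ℂ)).IsPrime := by
  rw [← ker_killVars]
  exact RingHom.ker_isPrime _

/-- Adjoining the variables one at a time gives a strict chain of primes. -/
lemma card_le_height_span_X (A : Finset (Fin n)) :
    (A.card : ℕ∞) ≤ (Ideal.span (X '' (A : Set (Fin n))) :
      Ideal (MvPolynomial (Fin n) ℂ)).height := by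
  classical
  induction A using Finset.induction_on with
  | empty => simp
  | insert a A ha ih =>
    have h1 := isPrime_span_X A
    have h2 := isPrime_span_X (insert a A)
    rw [Finset.card_insert_of_notMem ha, Nat.cast_add, Nat.cast_one]
    refine le_trans (by gcongr)
      (Ideal.height_add_one_le_of_lt_of_isPrime (lt_of_le_of_ne ?_ ?_))
    · exact Ideal.span_mono (Set.image_mono (by simp))
    · intro h
      have h3 : (X a : MvPolynomial (Fin n) ℂ) ∈ Ideal.span (X '' (A : Set (Fin n))) := by
        rw [h]
        exact Ideal.subset_span ⟨a, by simp, rfl⟩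
      rw [← ker_killVars, RingHom.mem_ker, killVars_X_of_notMem ha] at h3
      exact X_ne_zero _ h3

/-- Fewer than `n` equations through the origin also vanish at some generization of it. -/
lemma exists_prime_lt_origin {r : ℕ} (f : Fin r → MvPolynomial (Fin n) ℂ) (hr : r < n)
    (hf : ∀ l, f l ∈ Ideal.span (Set.range (X : Fin n → MvPolynomial (Fin n) ℂ))) :
    ∃ q : Ideal (MvPolynomial (Fin n) ℂ), q.IsPrime ∧ (∀ l, f l ∈ q) ∧
      q < Ideal.span (Set.range X) := by
  have hX : Ideal.span (Set.range (X : Fin n → MvPolynomial (Fin n) ℂ)) =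
    Ideal.span (X '' ((Finset.univ : Finset (Fin n)) : Set (Fin n))) := by simp
  have hprime := isPrime_span_X (Finset.univ : Finset (Fin n))
  have hht := card_le_height_span_X (Finset.univ : Finset (Fin n))
  rw [← hX] at hprime hht
  by_contra! hcon
  -- Otherwise the origin would be a minimal prime over r equations, of height at most r by Krull,
  -- while its height is at least n.
  have hmin : Ideal.span (Set.range X) ∈ (Ideal.span (Set.range f)).minimalPrimes := by
    refine ⟨⟨hprime, Ideal.span_le.mpr ?_⟩, fun q hq hqm => ?_⟩
    · rintro _ ⟨l, rfl⟩
      exact hf l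
    · have := hcon q hq.1 fun l => hq.2 (Ideal.subset_span ⟨l, rfl⟩)
      exact not_lt_iff_le_imp_ge.mp this hqm
  have h1 := hht.trans
    (Ideal.height_le_card_of_mem_minimalPrimes_span (Set.finite_range f) hmin)
  rw [Finset.card_univ, Fintype.card_fin, Nat.cast_le] at h1
  have h2 : (Set.range f).ncard ≤ r := by
    rw [← Set.image_univ]
    exact (Set.ncard_image_le Set.finite_univ).trans (by simp)
  omega

end Height

/-! ### Generic reducedness, birationality and smoothness -/

section Resolution

variable {n r : ℕ} {f : Fin r → MvPolynomial (Fin n) ℂ} {d : Fin r → ℕ}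

lemma isReduced_opens_of_charts {X : Scheme.{0}} (U : X.Opens)
    (h : ∀ x ∈ U, ∃ (B : CommRingCat.{0}) (j : Spec B ⟶ X), IsOpenImmersion j ∧ x ∈ Set.range j ∧
      _root_.IsReduced B) : IsReduced U.toScheme := by
  have hst (x : U.toScheme) : _root_.IsReduced (U.toScheme.presheaf.stalk x) := by
    obtain ⟨B, j, hj, ⟨z, hz⟩, hB⟩ := h _ x.2
    have : IsReduced (Spec B) := inferInstance
    have h1 : _root_.IsReduced (X.presheaf.stalk (j z)) :=
      isReduced_of_injective (j.stalkMap z).hom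
        (ConcreteCategory.bijective_of_isIso (j.stalkMap z)).1
    rw [hz] at h1
    have h2 : _root_.IsReduced (X.presheaf.stalk (U.ι x)) := h1
    exact isReduced_of_injective (inv (U.ι.stalkMap x)).hom
      (ConcreteCategory.bijective_of_isIso (inv (U.ι.stalkMap x))).1
  exact isReduced_of_isReduced_stalk _

/-- Away from the origin Z is cut out by coordinates, hence reduced; since r < n, the origin is a
specialization of another point of Z, so its complement is dense in Z. -/
lemma genericallyReduced_zeroScheme (hr : r < n) (hhom : ∀ i, (f i).IsHomogeneous (d i))
    (hd : ∀ i, 2 ≤ d i)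
    (hli : ∀ a : Fin n → ℂ, a ≠ 0 →
      LinearIndependent ℂ fun l : {l // eval a (f l) = 0} => gradAt a (f l)) :
    GenericallyReduced (zeroScheme f).subscheme := by
  have hsupp (x : Aff n) : x ∈ (zeroScheme f).support ↔ ∀ l, f l ∈ x.asIdeal := by
    rw [zeroScheme, affIdeal_eq_specIdeal, mem_support_specIdeal, Ideal.span_le,
      Set.range_subset_iff]
    rfl
  refine ⟨(zeroScheme f).subschemeι ⁻¹ᵁ complOpen (originIdeal n), ?_, ?_⟩
  · rw [dense_iff_inter_open]
    rintro V hV ⟨z, hz⟩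
    by_cases hzU : (zeroScheme f).subschemeι z ∈ complOpen (originIdeal n)
    · exact ⟨z, hz, hzU⟩
    obtain ⟨q, hq, hfq, hlt⟩ := exists_prime_lt_origin f hr
      fun l => mem_span_X_of_isHomogeneous (hhom l) (by have := hd l; omega)
    let x : Aff n := (⟨q, hq⟩ : PrimeSpectrum (MvPolynomial (Fin n) ℂ))
    have hxz : x ⤳ (zeroScheme f).subschemeι z := by
      refine (PrimeSpectrum.le_iff_specializes x ((zeroScheme f).subschemeι z)).mp ?_
      refine le_trans (b := Ideal.span (Set.range X)) hlt.le ?_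
      rw [Ideal.span_le]
      rintro _ ⟨k, rfl⟩
      by_contra hk
      exact hzU (mem_complOpen_originIdeal.mpr ⟨k, hk⟩)
    have hx : x ∈ Set.range (zeroScheme f).subschemeι := by
      rw [Scheme.IdealSheafData.range_subschemeι]
      exact (hsupp x).mpr hfq
    obtain ⟨y, hy⟩ := hx
    obtain ⟨W, hW, rfl⟩ := (zeroScheme f).subschemeι.isClosedEmbedding.isInducing.isOpen_iff.mp hV
    refine ⟨y, ?_, ?_⟩
    · change (zeroScheme f).subschemeι y ∈ W
      rw [hy]
      exact hxz.mem_open hW hz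
    · change (zeroScheme f).subschemeι y ∈ complOpen (originIdeal n)
      rw [hy, mem_complOpen_originIdeal]
      by_contra! hcon
      refine hlt.not_ge ?_
      rw [Ideal.span_le]
      rintro _ ⟨k, rfl⟩
      exact hcon k
  · refine isReduced_opens_of_charts _ fun z hz => ?_
    have hz' : (zeroScheme f).subschemeι z ∈ (zeroScheme f).support := by
      rw [← SetLike.mem_coe, ← Scheme.IdealSheafData.range_subschemeι]
      exact ⟨z, rfl⟩
    obtain ⟨Δ, e, A, hΔ, he, heC, -, hZ⟩ := exists_coords_zeroScheme hli _ hz hz'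
    obtain ⟨k, hk⟩ := exists_isPullback_subscheme _ _ _ hZ
    refine ⟨_, k, MorphismProperty.of_isPullback hk inferInstance, ?_,
      isReduced_quotient_coord he A⟩
    obtain ⟨w, hw⟩ := mem_range_awayChart.mpr hΔ
    obtain ⟨u, -, hu⟩ := Scheme.exists_preimage_of_isPullback hk w z hw
    exact ⟨u, hu⟩

variable {Y : Scheme.{0}} {π : Y ⟶ Aff n}

lemma isBirationalMorphism_of_isIso (hn : 0 < n) (hiso : IsIso (π ∣_ complOpen (originIdeal n)))
    (hinv : IsInvertible ((originIdeal n).comap π)) : IsBirationalMorphism π := by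
  refine ⟨complOpen (originIdeal n), ?_, ?_, hiso⟩
  · refine IsOpen.dense (complOpen (originIdeal n)).2 ⟨affPt fun _ => 1, affPt_mem_complOpen ?_⟩
    exact fun h => one_ne_zero congr($h ⟨0, hn⟩)
  · rw [preimage_complOpen]
    exact dense_complOpen hinv

lemma CoordChart.comp_affStr {y : Y} (c : CoordChart π y) :
    c.j ≫ π ≫ affStr n = Spec.map (CommRingCat.ofHom (c.e.comp C)) := by
  rw [← Category.assoc, c.comp, ← Spec.map_comp]
  congr 1
  ext z
  exact (c.e_C z).symm

lemma smooth_of_coordChart (h : ∀ y, Nonempty (CoordChart π y)) : Smooth (π ≫ affStr n) := by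
  let c (y : Y) : CoordChart π y := (h y).some
  have := HasRingHomProperty.instIsZariskiLocalAtSource (P := @Smooth.{0})
  refine IsZariskiLocalAtSource.of_openCover (P := @Smooth)
    (coverOfCharts (fun y => Spec (c y).B) (fun y => (c y).j) fun y => (c y).mem) fun y => ?_
  change Smooth ((c y).j ≫ π ≫ affStr n)
  rw [(c y).comp_affStr, HasRingHomProperty.Spec_iff (P := @Smooth)]
  exact smooth_comp_C _ (c y).etale

end Resolution

end

end BlowUpRes

namespace BlowUpRes

noncomputable section

open MvPolynomial

/-! ### From charts to algebraic coordinates -/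

section Coordinates

variable {n : ℕ} {Y : Scheme.{0}} {π : Y ⟶ Aff n} {y : Y}

/-- The algebraic coordinates given by a chart. -/
def CoordChart.algCoords (c : CoordChart π y) :
    AlgCoords (π ≫ affStr n) c.j.opensRange n where
  map := c.j.isoOpensRange.inv ≫ Spec.map (CommRingCat.ofHom c.e)
  etale := by
    have : Etale (Spec.map (CommRingCat.ofHom c.e)) := by
      rw [HasRingHomProperty.Spec_iff (P := @Etale)]
      exact c.etale
    infer_instance
  comm := by
    rw [← Scheme.Hom.isoOpensRange_inv_comp c.j, Category.assoc, Category.assoc, c.comp_affStr,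
      ← Spec.map_comp]
    rfl

lemma CoordChart.comap_ι (c : CoordChart π y) {I : Y.IdealSheafData}
    {a : Ideal (MvPolynomial (Fin n) ℂ)} (h : I.comap c.j = specIdeal (a.map c.e)) :
    I.comap c.j.opensRange.ι = (affIdeal a).comap c.algCoords.map := by
  rw [← Scheme.Hom.isoOpensRange_inv_comp c.j, Scheme.IdealSheafData.comap_comp, h,
    CoordChart.algCoords, Scheme.IdealSheafData.comap_comp, affIdeal_eq_specIdeal, comap_specIdeal]
  rfl

lemma CoordChart.comap_ι_prod (c : CoordChart π y) {I : Y.IdealSheafData} {A : Finset (Fin n)}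
    (h : I.comap c.j = specIdeal (Ideal.span {∏ i ∈ A, c.e (X i)})) :
    I.comap c.j.opensRange.ι = (hypersurface (∏ i ∈ A, X i)).comap c.algCoords.map := by
  refine c.comap_ι (h.trans ?_)
  rw [Ideal.map_span, Set.image_singleton, map_prod]

lemma CoordChart.comap_vanishingIdeal (c : CoordChart π y) {A : Finset (Fin n)}
    (h : (Ideal.span (Set.range X)).map c.g = Ideal.span {∏ i ∈ A, c.e (X i)}) :
    (Scheme.IdealSheafData.vanishingIdeal ((originIdeal n).comap π).support).comap c.j =
      specIdeal (Ideal.span {∏ i ∈ A, c.e (X i)}) := by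
  rw [comap_vanishingIdeal_support _ c.j (Ideal.span {∏ i ∈ A, c.e (X i)}),
    (isRadical_span_prod_coord c.etale A).radical]
  rw [← Scheme.IdealSheafData.comap_comp, originIdeal, comap_affIdeal c.comp, h]

lemma saturation_span_pow_mul {B : Type} [CommRing B] {t : B} {a : Ideal B}
    (ha : ∀ x, t * x ∈ a → x ∈ a) (N : ℕ) : saturation t (Ideal.span {t ^ N} * a) = a := by
  have hpow (k : ℕ) : ∀ x, t ^ k * x ∈ a → x ∈ a := by
    induction k with
    | zero => simp
    | succ k ih => exact fun x hx => ih x (ha _ (by rwa [← mul_assoc, ← pow_succ']))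
  ext b
  rw [mem_saturation]
  constructor
  · rintro ⟨k, hk⟩
    exact hpow k b (Ideal.mul_le_right hk)
  · intro hb
    exact ⟨N, Ideal.mul_mem_mul (Ideal.mem_span_singleton_self _) hb⟩

lemma mem_support_comap {X' X : Scheme.{0}} {I : X.IdealSheafData} {p : X' ⟶ X} {x : X'} :
    x ∈ (I.comap p).support ↔ p x ∈ I.support := by
  rw [Scheme.IdealSheafData.support_comap]
  rfl

end Coordinates

/-! ### The factorization and the two resolutions -/

section Final

variable {n r : ℕ} {f : Fin r → MvPolynomial (Fin n) ℂ} {d : Fin r → ℕ} {N : ℕ}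
  {Y : Scheme.{0}} {π : Y ⟶ Aff n} {E : Y.IdealSheafData} {H : Fin r → Y.IdealSheafData}

/-- The divisor in the factorization of the ideal of the complete intersection. -/
def factorIdeal (f : Fin r → MvPolynomial (Fin n) ℂ) (N : ℕ) (π : Y ⟶ Aff n) : Y.IdealSheafData :=
  (affIdeal (Ideal.span (Set.range X) ^ N ⊔ Ideal.span (Set.range f))).comap π

lemma CoordChart.IsMain.map_span {y : Y} {c : CoordChart π y} {i₀ : Fin n} {w : Fin r → c.B}
    {σ : Fin r → Fin n} (h : c.IsMain f d N E H i₀ w σ) (hw : ∀ l, ¬ IsUnit (w l))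
    (hd : ∀ l, d l ≤ N) :
    (Ideal.span (Set.range f)).map c.g = Ideal.span {c.e (X i₀) ^ N} *
      Ideal.span ((fun i => c.e (X i)) '' ((Finset.univ.image σ : Finset _) : Set (Fin n))) := by
  rw [Ideal.map_span, Ideal.span_mul_span', Set.singleton_mul, Finset.coe_image, Finset.coe_univ,
    Set.image_univ, ← Set.range_comp, ← Set.range_comp, ← Set.range_comp]
  congr 2
  funext l
  simp only [Function.comp_apply]
  rw [h.map_eq, max_eq_right (hd l), ((h.coord l).resolve_left (hw l)).1]

lemma CoordChart.IsSide.map_span {y : Y} {c : CoordChart π y} {A : Finset (Fin n)} {l : Fin r}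
    (h : c.IsSide f d N H A l) :
    (Ideal.span (Set.range f)).map c.g = Ideal.span {c.g (f l)} := by
  rw [Ideal.map_span]
  apply le_antisymm
  · rw [Ideal.span_le]
    rintro _ ⟨_, ⟨m, rfl⟩, rfl⟩
    exact Ideal.mem_span_singleton.mpr (h.dvd m)
  · rw [Ideal.span_singleton_le_iff_mem]
    exact Ideal.subset_span ⟨_, ⟨l, rfl⟩, rfl⟩

lemma CoordChart.IsSide.mem_nonZeroDivisors {y : Y} {c : CoordChart π y} {A : Finset (Fin n)}
    {l : Fin r} (h : c.IsSide f d N H A l) : c.g (f l) ∈ nonZeroDivisors c.B := by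
  obtain ⟨b, hb⟩ := h.dvd_pow
  have h1 := pow_mem (c.prod_mem_nonZeroDivisors A) N
  rw [hb] at h1
  exact (mul_mem_nonZeroDivisors.mp h1).1

/-- The factorization on the charts. -/
lemma HasGoodCharts.exists_factorization (h : HasGoodCharts f d N π E H) (hd : ∀ l, d l ≤ N)
    (y : Y) :
    ∃ (c : CoordChart π y) (A D : Finset (Fin n)) (u : c.B) (b : Ideal c.B),
      Disjoint A D ∧ u ∈ nonZeroDivisors c.B ∧
      (Ideal.span (Set.range X)).map c.g = Ideal.span {∏ i ∈ A, c.e (X i)} ∧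
      (b = ⊤ ∨ b = Ideal.span ((fun i => c.e (X i)) '' (D : Set (Fin n)))) ∧
      (strictTransform π (complOpen (originIdeal n)) (zeroScheme f)).comap c.j = specIdeal b ∧
      (factorIdeal f N π).comap c.j = specIdeal (Ideal.span {u}) ∧
      (zeroScheme f).comap (c.j ≫ π) = specIdeal (b * Ideal.span {u}) := by
  classical
  have hinv := h.isInvertible_origin
  obtain ⟨c, ⟨i₀, w, σ, hc, hw⟩ | ⟨A, l, hc⟩⟩ := h y
  · have hw' (l) := hw l (hd l)
    have hi₀ : i₀ ∉ Finset.univ.image σ := by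
      simp only [Finset.mem_image, Finset.mem_univ, true_and, not_exists]
      exact fun l => ((hc.coord l).resolve_left (hw' l)).2
    have hmap := hc.map_span hw' hd
    refine ⟨c, {i₀}, Finset.univ.image σ, c.e (X i₀) ^ N, _, by simpa using hi₀,
      pow_mem (coord_mem_nonZeroDivisors c.etale i₀) N, ?_, .inr rfl, ?_, ?_, ?_⟩
    · rw [Finset.prod_singleton, hc.map_origin]
    · rw [comap_strictTransform π _ _ hinv c.j (c.e (X i₀)) _
        (by rw [originIdeal, comap_affIdeal c.comp, hc.map_origin])
        (by rw [zeroScheme, comap_affIdeal c.comp]), hmap,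
        saturation_span_pow_mul fun x hx => mem_span_coords_of_coord_mul_mem c.etale hi₀ hx]
    -- On a main chart every f_l is a multiple of t^N, so m^N + I_Z becomes (t^N).
    · rw [factorIdeal, ← Scheme.IdealSheafData.comap_comp, comap_affIdeal c.comp, Ideal.map_sup,
        hmap, Ideal.map_pow, hc.map_origin, Ideal.span_singleton_pow,
        sup_eq_left.mpr Ideal.mul_le_left]
    · rw [zeroScheme, comap_affIdeal c.comp, hmap, mul_comm]
  · refine ⟨c, A, ∅, c.g (f l), ⊤, Finset.disjoint_empty_right _, hc.mem_nonZeroDivisors,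
      hc.map_origin, .inl rfl, ?_, ?_, ?_⟩
    · rw [comap_strictTransform π _ _ hinv c.j (∏ i ∈ A, c.e (X i)) _
        (by rw [originIdeal, comap_affIdeal c.comp, hc.map_origin])
        (by rw [zeroScheme, comap_affIdeal c.comp]), hc.map_span, saturation_eq_top (k := N)]
      exact Ideal.mem_span_singleton.mpr hc.dvd_pow
    -- On a side chart f_l divides the N-th power of the equation of the inverse image of the
    -- origin, so m^N + I_Z becomes (f_l).
    · rw [factorIdeal, ← Scheme.IdealSheafData.comap_comp, comap_affIdeal c.comp, Ideal.map_sup,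
        hc.map_span, Ideal.map_pow, hc.map_origin, Ideal.span_singleton_pow, sup_eq_right.mpr]
      rw [Ideal.span_singleton_le_span_singleton]
      exact hc.dvd_pow
    · rw [zeroScheme, comap_affIdeal c.comp, hc.map_span, Ideal.top_mul]

lemma IsTower.isStrongFactorizingResolution {d₀ s : ℕ} (h : IsTower f d d₀ s π E H) (hr : 0 < r)
    (hrn : r < n) (hhom : ∀ i, (f i).IsHomogeneous (d i)) (hf : ∀ i, f i ≠ 0)
    (hd : ∀ i, 2 ≤ d i) (hd₀ : ∀ l, d₀ ≤ d l) (hds : ∀ l, d l ≤ d₀ + s)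
    (hli : ∀ a : Fin n → ℂ, a ≠ 0 →
      LinearIndependent ℂ fun l : {l // eval a (f l) = 0} => gradAt a (f l)) :
    IsStrongFactorizingResolution (affStr n) π (zeroScheme f) := by
  -- From 1 ≤ r < n; on the line the blow-up of the origin would be an isomorphism.
  have hn : 2 ≤ n := by omega
  have hch := h.hasGoodCharts hhom hd₀ hli
  have hinv := hch.isInvertible_origin
  have hiso := h.isIso_restrict
  have hexc := excLocus_eq hn hiso hinv
  have hsing := complSing_zeroScheme hr hhom hd hf hli
  refine ⟨genericallyReduced_zeroScheme hrn hhom hd hli, h.isProper hhom hd₀ hli,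
    isBirationalMorphism_of_isIso (by omega) hiso hinv,
    smooth_of_coordChart fun y => (hch y).nonempty, ?_, ?_, ?_, ?_⟩
  · rw [hsing]
    exact hiso
  · rw [hsing, excIdeal, hexc]
    intro y
    obtain ⟨c, A, D, u, b, hAD, hu, horigin, hb, hstr, hF, hZ⟩ := hch.exists_factorization hds y
    refine ⟨c.j.opensRange, n, c.algCoords, A, D, c.mem, hAD,
      c.comap_ι_prod (c.comap_vanishingIdeal horigin), ?_⟩
    rcases hb with rfl | rfl
    · left
      rw [← Scheme.Hom.isoOpensRange_inv_comp c.j, Scheme.IdealSheafData.comap_comp, hstr,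
        specIdeal_top, Scheme.IdealSheafData.comap_top]
    · right
      refine c.comap_ι (hstr.trans ?_)
      rw [Ideal.map_span, Set.image_image]
  · rw [hsing]
    refine smooth_of_charts fun y hy => ?_
    obtain ⟨c, A, D, u, b, hAD, hu, horigin, hb, hstr, hF, hZ⟩ := hch.exists_factorization hds y
    refine ⟨c.B, c.j, b, c.e.comp C, c.isOpenImmersion, c.mem, hstr, c.comp_affStr, ?_⟩
    rcases hb with rfl | rfl
    · obtain ⟨z, hz⟩ := c.mem
      have h1 : z ∈ ((strictTransform π (complOpen (originIdeal n)) (zeroScheme f)).comap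
          c.j).support := by
        rw [mem_support_comap, hz]
        exact hy
      rw [hstr, mem_support_specIdeal] at h1
      exact absurd (top_le_iff.mp h1) z.2.ne_top
    · exact smooth_quotient_coord c.etale D
  · rw [hsing]
    refine ⟨factorIdeal f (d₀ + s) π, isInvertible_of_chart fun y => ?_, ?_, eq_of_chart fun y => ?_⟩
    · obtain ⟨c, A, D, u, b, hAD, hu, horigin, hb, hstr, hF, hZ⟩ := hch.exists_factorization hds y
      exact ⟨c.B, c.j, u, c.isOpenImmersion, c.mem, hu, hF⟩
    · rw [hexc]
      intro y hy
      change y ∈ (factorIdeal f (d₀ + s) π).support at hy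
      rw [factorIdeal, mem_support_comap, affIdeal_eq_specIdeal, mem_support_specIdeal] at hy
      rw [mem_support_comap, originIdeal, affIdeal_eq_specIdeal, mem_support_specIdeal]
      exact (π y).2.le_of_pow_le (le_sup_left.trans hy)
    · obtain ⟨c, A, D, u, b, hAD, hu, horigin, hb, hstr, hF, hZ⟩ := hch.exists_factorization hds y
      refine ⟨c.B, c.j, c.isOpenImmersion, c.mem, ?_⟩
      rw [← Scheme.IdealSheafData.comap_comp, hZ, comap_mul, hstr, hF, specIdeal_mul]

/-- For `r = n` there are only side charts. -/
lemma HasGoodCharts.exists_isSide {f : Fin n → MvPolynomial (Fin n) ℂ} {d : Fin n → ℕ}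
    {H : Fin n → Y.IdealSheafData} (h : HasGoodCharts f d N π E H) (hd : ∀ l, d l ≤ N) (y : Y) :
    ∃ (c : CoordChart π y) (A : Finset (Fin n)) (l : Fin n), c.IsSide f d N H A l := by
  obtain ⟨c, ⟨i₀, w, σ, hc, hw⟩ | ⟨A, l, hc⟩⟩ := h y
  -- On a main chart all n strict transforms would have distinct coordinates, leaving none for the
  -- exceptional divisor.
  · have hσ : Function.Injective σ :=
      fun l l' => hc.inj l l' (hw l (hd l)) (hw l' (hd l'))
    obtain ⟨l, hl⟩ := (Finite.injective_iff_surjective.mp hσ) i₀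
    exact absurd hl ((hc.coord l).resolve_left (hw l (hd l))).2
  · exact ⟨c, A, l, hc⟩

/-- The blow-up of the origin of the line is an isomorphism. -/
lemma isInvertible_originIdeal_one : IsInvertible (originIdeal 1) := by
  refine isInvertible_of_chart fun x => ⟨_, 𝟙 _, (X 0 : MvPolynomial (Fin 1) ℂ), inferInstance,
    ⟨x, rfl⟩, mem_nonZeroDivisors_of_ne_zero (X_ne_zero _), ?_⟩
  rw [Scheme.IdealSheafData.comap_id, originIdeal, affIdeal_eq_specIdeal, Set.range_unique]
  rfl

lemma excLocus_eq_bot_of_isIso {X' X : Scheme.{0}} (π : X' ⟶ X) [IsIso π] : excLocus π = ⊥ := by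
  rw [eq_bot_iff]
  intro x hx
  refine absurd ?_ hx
  have h1 : (⊤ : X'.Opens) ≤ locIsoOpen π := by
    refine le_sSup ?_
    change IsOpenImmersion _
    infer_instance
  exact h1 trivial

lemma IsTower.isLogResolution {f : Fin n → MvPolynomial (Fin n) ℂ} {d : Fin n → ℕ}
    {H : Fin n → Y.IdealSheafData} {d₀ s : ℕ} (h : IsTower f d d₀ s π E H) (hn : 0 < n)
    (hhom : ∀ i, (f i).IsHomogeneous (d i))
    (hd : ∀ i, 2 ≤ d i) (hd₀ : ∀ l, d₀ ≤ d l) (hds : ∀ l, d l ≤ d₀ + s)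
    (hs : n = 1 → s = 0)
    (hli : ∀ a : Fin n → ℂ, a ≠ 0 →
      LinearIndependent ℂ fun l : {l // eval a (f l) = 0} => gradAt a (f l)) :
    IsLogResolution (affStr n) π (zeroScheme f) := by
  have hch := h.hasGoodCharts hhom hd₀ hli
  have hside := hch.exists_isSide hds
  have hinv := hch.isInvertible_origin
  have hiso := h.isIso_restrict
  have hZ {y : Y} {c : CoordChart π y} {A l} (hc : c.IsSide f d (d₀ + s) H A l) :
      ((zeroScheme f).comap π).comap c.j = specIdeal (Ideal.span {c.g (f l)}) := by
    rw [← Scheme.IdealSheafData.comap_comp, zeroScheme, comap_affIdeal c.comp, hc.map_span]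
  have hm {y : Y} {c : CoordChart π y} {A l} (hc : c.IsSide f d (d₀ + s) H A l) :
      ((originIdeal n).comap π).comap c.j = specIdeal (Ideal.span {∏ i ∈ A, c.e (X i)}) := by
    rw [← Scheme.IdealSheafData.comap_comp, originIdeal, comap_affIdeal c.comp, hc.map_origin]
  -- The support of F is the whole inverse image of the origin, so its union with the exceptional
  -- locus is that inverse image, even when π is an isomorphism.
  have hsupp : ((zeroScheme f).comap π).support = ((originIdeal n).comap π).support := by
    apply le_antisymm
    · intro y hy
      obtain ⟨c, A, l, hc⟩ := hside y
      obtain ⟨z, hz⟩ := c.mem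
      have h1 : z ∈ (((zeroScheme f).comap π).comap c.j).support := by
        rw [mem_support_comap, hz]
        exact hy
      have h2 : z ∈ (((originIdeal n).comap π).comap c.j).support := by
        rw [hZ hc, mem_support_specIdeal, Ideal.span_singleton_le_iff_mem] at h1
        rw [hm hc, mem_support_specIdeal, Ideal.span_singleton_le_iff_mem]
        exact z.2.mem_of_pow_mem _ (Ideal.mem_of_dvd _ hc.dvd_pow h1)
      rw [mem_support_comap, hz] at h2
      exact h2
    · refine Scheme.IdealSheafData.support_antitone
        (Scheme.IdealSheafData.comap_mono π ?_)
      rw [zeroScheme, originIdeal, affIdeal_eq_specIdeal, affIdeal_eq_specIdeal, specIdeal_le_iff,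
        Ideal.span_le]
      rintro _ ⟨l, rfl⟩
      exact mem_span_X_of_isHomogeneous (hhom l) (by have := hd l; omega)
  refine ⟨h.isProper hhom hd₀ hli, isBirationalMorphism_of_isIso hn hiso hinv,
    smooth_of_coordChart fun y => (hch y).nonempty, ?_, ?_, ?_⟩
  · refine isInvertible_of_chart fun y => ?_
    obtain ⟨c, A, l, hc⟩ := hside y
    exact ⟨c.B, c.j, _, c.isOpenImmersion, c.mem, hc.mem_nonZeroDivisors, hZ hc⟩
  -- On the line there is only the blow-up of the origin, which is an isomorphism; the exceptional
  -- locus is empty.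
  · by_cases hn1 : n = 1
    · obtain rfl := hs hn1
      subst hn1
      have hπ : IsIso π := by
        cases h with
        | origin _ hπ => exact hπ.isIso isInvertible_originIdeal_one
      rw [excIdeal, excLocus_eq_bot_of_isIso, Scheme.IdealSheafData.vanishingIdeal_bot]
      exact isInvertible_top
    · rw [excIdeal, excLocus_eq (by omega) hiso hinv]
      refine isInvertible_of_chart fun y => ?_
      obtain ⟨c, A, l, hc⟩ := hside y
      exact ⟨c.B, c.j, _, c.isOpenImmersion, c.mem, c.prod_mem_nonZeroDivisors A,
        c.comap_vanishingIdeal hc.map_origin⟩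
  · rw [hsupp, sup_eq_right.mpr (excLocus_le hiso)]
    intro y
    obtain ⟨c, A, l, hc⟩ := hside y
    exact ⟨c.j.opensRange, n, c.algCoords, A, c.mem,
      c.comap_ι_prod (c.comap_vanishingIdeal hc.map_origin)⟩

end Final

lemma ofList_take_le {R : Type*} [CommRing R] (rs : List R) (k : ℕ) :
    Ideal.ofList (rs.take k) ≤ Ideal.ofList rs := by
  conv_rhs => rw [← List.take_append_drop k rs, Ideal.ofList_append]
  exact le_sup_left

/-- The members of a regular sequence do not vanish. -/
lemma ne_zero_of_isRegular {R : Type*} [CommRing R] {r : ℕ} {f : Fin r → R}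
    (hreg : RingTheory.Sequence.IsRegular R (List.ofFn f)) (i : Fin r) : f i ≠ 0 := by
  intro h0
  -- If f_i = 0, multiplication by zero is injective on the quotient by the earlier members, so that
  -- quotient vanishes and the sequence generates the unit ideal.
  have h1 := hreg.regular_mod_prev i (by simp)
  have h2 : (List.ofFn f)[(i : ℕ)]'(by simp) = 0 := by simp [h0]
  rw [h2, IsSMulRegular.zero_iff_subsingleton, Submodule.Quotient.subsingleton_iff] at h1
  exact hreg.top_ne_smul (top_le_iff.mp
    (h1.ge.trans (Submodule.smul_mono_left (ofList_take_le _ _)))).symm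

end

end BlowUpRes

theorem proposition4p1 (n r : ℕ) (hr : 0 < r)
    (f : Fin r → MvPolynomial (Fin n) ℂ) (d : Fin r → ℕ)
    (hhom : ∀ i, (f i).IsHomogeneous (d i))
    (hreg : RingTheory.Sequence.IsRegular (MvPolynomial (Fin n) ℂ) (List.ofFn f))
    (hd : ∀ i, 2 ≤ d i) (hmono : Monotone d)
    (hsmooth : ∀ i, SmoothOn (affStr n) (hypersurface (f i)) (complOpen (originIdeal n)))
    (hsnc : IsSNCDivisor ((complOpen (originIdeal n)).ι ≫ affStr n)
      ((∏ i, hypersurface (f i)).comap (complOpen (originIdeal n)).ι)) :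
    (∃ (Y : Scheme.{0}) (π : Y ⟶ Aff n) (E : Y.IdealSheafData) (H : Fin r → Y.IdealSheafData),
      IsTower f d (d ⟨0, hr⟩) (d ⟨r - 1, Nat.sub_one_lt_of_lt hr⟩ - d ⟨0, hr⟩) π E H) ∧
    ∀ (Y : Scheme.{0}) (π : Y ⟶ Aff n) (E : Y.IdealSheafData) (H : Fin r → Y.IdealSheafData),
      IsTower f d (d ⟨0, hr⟩) (d ⟨r - 1, Nat.sub_one_lt_of_lt hr⟩ - d ⟨0, hr⟩) π E H →
        (r + 1 ≤ n → IsStrongFactorizingResolution (affStr n) π (zeroScheme f)) ∧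
        (r = n → IsLogResolution (affStr n) π (zeroScheme f)) := by
  have hf := ne_zero_of_isRegular hreg
  have hli := linearIndependent_gradAt f hf hsmooth hsnc
  have hd₀ (l) : d ⟨0, hr⟩ ≤ d l := hmono (Fin.mk_le_of_le_val (Nat.zero_le _))
  have hds (l : Fin r) :
      d l ≤ d ⟨0, hr⟩ + (d ⟨r - 1, Nat.sub_one_lt_of_lt hr⟩ - d ⟨0, hr⟩) := by
    have h1 : d l ≤ d ⟨r - 1, Nat.sub_one_lt_of_lt hr⟩ :=
      hmono (Fin.le_def.mpr (Nat.le_sub_one_of_lt l.2))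
    omega
  refine ⟨exists_isTower f d _ _, fun Y π E H h => ⟨fun hrn => ?_, fun hrn => ?_⟩⟩
  · exact h.isStrongFactorizingResolution hr hrn hhom hf hd hd₀ hds hli
  · subst hrn
    -- For n = 1 the only equation is both the first and the last, so no further blow-ups occur.
    refine h.isLogResolution hr hhom hd hd₀ hds (fun h1 => ?_) hli
    subst h1
    simp
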